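/- Let $d\ge 0$, and let $(X,Y)\in\mathbb R^d\times\mathbb R$ be a couple of square integrable random variables. Put $R(\theta)=\mathbb E[(Y-\langle\theta,X\rangle)^2]$, let $\theta_*\in\arg\min_{\theta\in\mathbb R^d}R(\theta)$, let $G=\mathbb E(XX^\top)$, and let $G^{-1/2}$ be the pseudo-inverse of $G^{1/2}$. Assume that $$\kappa=\sup\{\mathbb E(\langle\theta,X\rangle^4):\theta\in\mathbb R^d,\ \mathbb E(\langle\theta,X\rangle^2)\le 1\}<\infty,\qquad C=\mathbb E\big[(Y-\langle\theta_*,X\rangle)^2\,\|G^{-1/2}X\|^2\big]<\infty .$$ Let $(X_1,Y_1),\dots,(X_n,Y_n)$, $n\ge1$, be independent copies of $(X,Y)$, and let $\hat\theta\in\arg\min_\theta\sum_{i=1}^n(Y_i-\langle\theta,X_i\rangle)^2$ be any (measurable) empirical risk minimizer. For $\epsilon\in(0,1)$ and real $\kappa>1$ put $$n_\epsilon=\Big[20\sqrt{\kappa d}+\Big(\tfrac52+\tfrac1{2(\kappa-1)}\Big)\sqrt{2(\kappa-1)[\log(\epsilon^{-1})+0.73\,d]}\Big]^2,$$ $$\mu=\sqrt{\tfrac{2(\kappa-1)}n[\log(\epsilon^{-1})+0.73\,d]}+6.81\sqrt{\tfrac{2\kappa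 d}n},\qquad \hat\delta=\frac{\mu}{1-2\mu},\qquad \gamma_-=\frac{2[\log(\epsilon^{-1})+0.73\,d]}{3(\kappa-1)n}.$$ **1. Explicit bounds.** Let $\epsilon\in(0,1)$, $\kappa>1$ and $n>n_\epsilon$. (a) If $\gamma_-\ne1$, there is an event $\Omega$ with $\mathbb P(\Omega)\ge1-\epsilon$, conditionally on which $R(\hat\theta)-R(\theta_*)$ is integrable, and $$\mathbb E\big[R(\hat\theta)-R(\theta_*)\mid\Omega\big]\le\frac{(1+\hat\delta)^2}{(1-\gamma_-)^2\,\mathbb P(\Omega)}\cdot\frac Cn .$$ (b) If $\gamma_-\ne1$, then for every real $M\ge0$, $$\mathbb E\big[\min\{R(\hat\theta)-R(\theta_*),M\}\big]\le\frac{(1+\hat\delta)^2C}{(1-\gamma_-)^2n}+\epsilon M .$$ (c) If moreover $Y=\langle\theta_*,X\rangle+\eta$ with $\eta$ independent of $X$, $\mathbb E(\eta)=0$ and $0<\mathbb E(\eta^2)=\sigma^2<\infty$, and if $\gamma_-<1$, then with probability at least $1-\epsilon$, $$\mathbb E\big[R(\hat\theta)-R(\theta_*)\mid X_1,\dots,X_n\big]\le\frac{(1+\hat\delta)\,d\,\sigma^2}{(1-\gamma_-)\,n}$$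 (conditional expectation of a non-negative random variable, with values in $[0,\infty]$). **2. Orders of magnitude of the explicit quantities.** In this part $d\ge1$ and $n\ge 0$ are any integers and $\kappa$ is any real number. For all $\kappa_0>1$ and $g<1$ there is a constant $c>0$, depending only on $\kappa_0$ and $g$, such that for all $\kappa\ge\kappa_0$: (a) for $\epsilon\in(0,1)$, $n_\epsilon\le c\,\kappa[d+\log(\epsilon^{-1})]$; and if $n>n_\epsilon$ and $\gamma_-\le g$, then $\frac{(1+\hat\delta)^2}{(1-\gamma_-)^2}$ and $\frac{1+\hat\delta}{1-\gamma_-}$ are both at most $1+c\sqrt{\kappa[d+\log(\epsilon^{-1})]/n}$, and for every $p\ge1-\epsilon$ (in particular for $p=\mathbb P(\Omega)$), $$\frac{(1+\hat\delta)^2}{(1-\gamma_-)^2p}\le\Big(1+c\sqrt{\kappa[d+\log(\epsilon^{-1})]/n}\Big)(1-\epsilon)^{-1};$$ (b) if $0<C\le M$ are real numbers and $n>c\,\kappa[d+\log(\kappa M/C)]$, then $\epsilon=C/(Mn^2)$ satisfies $\epsilon<1$ and $n>n_\epsilon$. **3. Bounds with a numerical constant.** There is a numerical constant $c>0$ such that,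 in the setting of the first paragraph (with no lower bound on $\kappa$, and with the convention $\sqrt x=0$ for $x<0$): (a) for $\epsilon\in(0,1)$ and $n\ge c\,\kappa[d+\log(\epsilon^{-1})]$, there is an event $\Omega$ with $\mathbb P(\Omega)\ge1-\epsilon$, conditionally on which $R(\hat\theta)-R(\theta_*)$ is integrable, and $$\mathbb E\big[R(\hat\theta)-R(\theta_*)\mid\Omega\big]\le\Big(1+c\sqrt{\kappa[d+\log(\epsilon^{-1})]/n}\Big)(1-\epsilon)^{-1}\,\frac Cn;$$ (b) if $C>0$, $M>0$ and $n\ge c\,\kappa[d+\log(\kappa M/C)]$, then $$\frac nC\,\mathbb E\big[\min\{R(\hat\theta)-R(\theta_*),M\}\big]\le1+c\sqrt{\kappa[d+\log(Mn/C)]/n};$$ (c) if moreover $Y=\langle\theta_*,X\rangle+\eta$ with $\eta$ as in 1(c), then for $M>0$ and $n\ge c\,\kappa[d+\log(\kappa M/\sigma^2)]$ (where $\log 0=0$ if $\kappa=0$), $$\mathbb E\big[\min\{R(\hat\theta)-R(\theta_*),M\}\big]\le\Big(1+c\sqrt{\kappa[d+\log(Mn/\sigma^2)]/n}\Big)\frac{\sigma^2d}n,$$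 and for $\epsilon\in(0,1)$ and $n\ge c\,\kappa[d+\log(\epsilon^{-1})]$, with probability at least $1-\epsilon$, $$\mathbb E\big[R(\hat\theta)-R(\theta_*)\mid X_1,\dots,X_n\big]\le\Big(1+c\sqrt{\kappa[d+\log(\epsilon^{-1})]/n}\Big)\frac{d\,\sigma^2}n .$$ -/

import Mathlib

open MeasureTheory ProbabilityTheory
open scoped ENNReal

noncomputable section

namespace LeastSquares

/-! ### The numerical quantities -/

/-- The right-hand side `n_ε` of the sample size condition `n > n_ε`. -/
def sampleThreshold (κ : ℝ) (d : ℕ) (ε : ℝ) : ℝ :=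
  (20 * √(κ * d)
    + (5 / 2 + 1 / (2 * (κ - 1))) * √(2 * (κ - 1) * (Real.log ε⁻¹ + 0.73 * d))) ^ 2

/-- The quantity `μ`. -/
def mu (κ : ℝ) (d n : ℕ) (ε : ℝ) : ℝ :=
  √(2 * (κ - 1) / n * (Real.log ε⁻¹ + 0.73 * d)) + 6.81 * √(2 * κ * d / n)

/-- The quantity `δ̂ = μ / (1 - 2 μ)`. -/
def deltaHat (κ : ℝ) (d n : ℕ) (ε : ℝ) : ℝ :=
  mu κ d n ε / (1 - 2 * mu κ d n ε)

/-- The quantity `γ₋`. -/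
def gammaMinus (κ : ℝ) (d n : ℕ) (ε : ℝ) : ℝ :=
  2 * (Real.log ε⁻¹ + 0.73 * d) / (3 * (κ - 1) * n)

/-! ### Population quantities -/

section Population

variable {d : ℕ} {Ω₀ : Type*} [MeasurableSpace Ω₀]

/-- The quadratic risk `R(θ) = E[(Y - ⟨θ, X⟩)²]`. -/
def risk (P₀ : Measure Ω₀) (X : Ω₀ → EuclideanSpace ℝ (Fin d)) (Y : Ω₀ → ℝ)
    (θ : EuclideanSpace ℝ (Fin d)) : ℝ :=
  ∫ ω, (Y ω - inner ℝ θ (X ω)) ^ 2 ∂P₀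

/-- The kurtosis coefficient `sup {E⟨θ, X⟩⁴ : E⟨θ, X⟩² ≤ 1}`, with values in `[0, ∞]`. -/
def kurtosis (P₀ : Measure Ω₀) (X : Ω₀ → EuclideanSpace ℝ (Fin d)) : ℝ≥0∞ :=
  ⨆ (θ : EuclideanSpace ℝ (Fin d))
    (_ : ∫⁻ ω, ENNReal.ofReal ((inner ℝ θ (X ω)) ^ 2) ∂P₀ ≤ 1),
    ∫⁻ ω, ENNReal.ofReal ((inner ℝ θ (X ω)) ^ 4) ∂P₀

/-- The Gram matrix `G = E[X Xᵀ]`. -/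
def gram (P₀ : Measure Ω₀) (X : Ω₀ → EuclideanSpace ℝ (Fin d)) :
    Matrix (Fin d) (Fin d) ℝ :=
  Matrix.of fun i j => ∫ ω, X ω i * X ω j ∂P₀

theorem gram_isHermitian (P₀ : Measure Ω₀) (X : Ω₀ → EuclideanSpace ℝ (Fin d)) :
    (gram P₀ X).IsHermitian := by
  ext i j
  simp [gram, mul_comm]

/-- The matrix `G^{-1/2} = U diag(1(λᵢ > 0) λᵢ^{-1/2}) Uᵀ`, where `G = U diag(λᵢ) Uᵀ`. -/
def gramInvSqrt (P₀ : Measure Ω₀) (X : Ω₀ → EuclideanSpace ℝ (Fin d)) :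
    Matrix (Fin d) (Fin d) ℝ :=
  (gram_isHermitian P₀ X).cfc fun t => if 0 < t then (√t)⁻¹ else 0

/-- The constant `C = E[(Y - ⟨θ, X⟩)² ‖G^{-1/2} X‖²]`, with values in `[0, ∞]`. -/
def rateConst (P₀ : Measure Ω₀) (X : Ω₀ → EuclideanSpace ℝ (Fin d)) (Y : Ω₀ → ℝ)
    (θ : EuclideanSpace ℝ (Fin d)) : ℝ≥0∞ :=
  ∫⁻ ω, ENNReal.ofReal
    ((Y ω - inner ℝ θ (X ω)) ^ 2 * ‖Matrix.toEuclideanLin (gramInvSqrt P₀ X) (X ω)‖ ^ 2) ∂P₀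

/-- `Y = ⟨θ, X⟩ + η` where `η` is independent of `X`, centered, with variance `σ² > 0`. -/
structure HasIndepNoise (P₀ : Measure Ω₀) (X : Ω₀ → EuclideanSpace ℝ (Fin d)) (Y : Ω₀ → ℝ)
    (θ : EuclideanSpace ℝ (Fin d)) (σ : ℝ) : Prop where
  pos : 0 < σ
  indep : IndepFun X (fun ω => Y ω - inner ℝ θ (X ω)) P₀
  mean : ∫ ω, (Y ω - inner ℝ θ (X ω)) ∂P₀ = 0
  variance : ∫ ω, (Y ω - inner ℝ θ (X ω)) ^ 2 ∂P₀ = σ ^ 2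

end Population

/-! ### The sample and the empirical risk minimizer -/

/-- Random design least squares regression: `(Xs i, Ys i)`, `i : Fin n`, are independent copies of
the square integrable couple `(X, Y)`, whose kurtosis coefficient and rate constant are finite,
`θs` minimizes the risk, and `θh` is an empirical risk minimizer. -/
structure IsRegression {d n : ℕ} {Ω₀ Ω : Type*} [MeasurableSpace Ω₀] [MeasurableSpace Ω]
    (P₀ : Measure Ω₀) (X : Ω₀ → EuclideanSpace ℝ (Fin d)) (Y : Ω₀ → ℝ)
    (P : Measure Ω) (Xs : Fin n → Ω → EuclideanSpace ℝ (Fin d)) (Ys : Fin n → Ω → ℝ)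
    (θs : EuclideanSpace ℝ (Fin d)) (θh : Ω → EuclideanSpace ℝ (Fin d)) : Prop where
  memLp_X : MemLp X 2 P₀
  memLp_Y : MemLp Y 2 P₀
  measurable_Xs : ∀ i, Measurable (Xs i)
  measurable_Ys : ∀ i, Measurable (Ys i)
  indep : iIndepFun (fun i ω => (Xs i ω, Ys i ω)) P
  ident : ∀ i, IdentDistrib (fun ω => (Xs i ω, Ys i ω)) (fun ω => (X ω, Y ω)) P P₀
  kurtosis_lt_top : kurtosis P₀ X < ⊤
  rateConst_lt_top : rateConst P₀ X Y θs < ⊤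
  isMin : ∀ θ, risk P₀ X Y θs ≤ risk P₀ X Y θ
  measurable_θh : Measurable θh
  isEmpMin : ∀ᵐ ω ∂P, ∀ θ,
    ∑ i, (Ys i ω - inner ℝ (θh ω) (Xs i ω)) ^ 2 ≤ ∑ i, (Ys i ω - inner ℝ θ (Xs i ω)) ^ 2

/-- The σ-algebra generated by `X_1, …, X_n`. -/
abbrev designSigma {d n : ℕ} {Ω : Type*} (Xs : Fin n → Ω → EuclideanSpace ℝ (Fin d)) :
    MeasurableSpace Ω :=
  ⨆ i, MeasurableSpace.comap (Xs i) inferInstance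

/-- The excess risk `R(θ̂) - R(θ_*)`, a random variable on the sample space. -/
def excessRisk {d : ℕ} {Ω₀ Ω : Type*} [MeasurableSpace Ω₀]
    (P₀ : Measure Ω₀) (X : Ω₀ → EuclideanSpace ℝ (Fin d)) (Y : Ω₀ → ℝ)
    (θs : EuclideanSpace ℝ (Fin d)) (θh : Ω → EuclideanSpace ℝ (Fin d)) (ω : Ω) : ℝ :=
  risk P₀ X Y (θh ω) - risk P₀ X Y θs

end LeastSquares

end

/-! Whiten the design: put W = G^{-1/2} X and z = G^{1/2} (θ̂ - θ_*). Since θ_* is a stationary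
point of the risk, the excess risk is exactly ‖z‖². The normal equations of the empirical problem
read ∑ ⟨z, W_i⟩² = ⟨z, S⟩, where S = ∑ (Y_i - ⟨θ_*, X_i⟩) W_i. If the empirical quadratic form (1/n)
∑ ⟨θ, W_i⟩² is at least ρ on the unit sphere of the range of G, then ‖z‖ ≤ ‖S‖ / (nρ). The terms of
S are independent and centred, so E‖S‖² = nC, and the leading constant is 1/ρ². When the noise is
independent of the design, ∑ ⟨z, W_i⟩² is at most the squared norm of the projection of the noise
vector on the column space of the design; its mean given the design is at most dσ², and only one
factor 1/ρ is lost.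

Everything thus rests on a lower bound for the smallest eigenvalue of an empirical Gram matrix under
fourth moments alone. Only the lower tail matters: the exponent lam (1 - ⟨θ, W⟩²) is bounded above,
so its exponential moment is controlled by its first two moments. Uniformity in θ is PAC-Bayesian:
normalized exponentials are averaged over a standard Gaussian prior, which gives a random variable V
of mean at most one (`HasMoments.exists_evidence`), and the Cameron-Martin shift by √β θ followed by
Jensen's inequality bounds V below for every θ simultaneously, at the price β/2. Truncating W in a
ball makes the Gaussian fluctuation of the exponent harmless.

Markov's inequality for V at level ε⁻¹ gives an event, depending on the design only, on which ρ = |1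
- γ₋| / (1 + δ̂); this is `IsRegression.explicit_bounds`. The elementary inequality behind that
value of ρ is `gamma_tradeoff`. The orders of magnitude are calculus, and the bounds with a
numerical constant on an event follow by replacing κ ≥ 1 by 2κ ≥ 2.

The truncated expectation with a numerical constant does not go through a fixed ε. There V itself is
kept as a random confidence level log (1 + G), and the product of this level with the score is
separated by a Young inequality (`IsRegression.mul_min_excessRisk_le`). -/

set_option linter.unusedSectionVars false

noncomputable section

namespace LeastSquares

/-! ### Standard Gaussian measure: density, shifts, moments. -/

section Gaussian

variable {E : Type*} [NormedAddCommGroup E] [InnerProductSpace ℝ E] [FiniteDimensional ℝ E]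
  [MeasurableSpace E] [BorelSpace E]

/-- The density of the standard Gaussian measure. -/
def stdGaussianDensity (x : E) : ℝ :=
  (2 * Real.pi) ^ (-(Module.finrank ℝ E : ℝ) / 2) * Real.exp (-‖x‖ ^ 2 / 2)

theorem measurable_stdGaussianDensity : Measurable (stdGaussianDensity : E → ℝ) := by
  unfold stdGaussianDensity; fun_prop

theorem stdGaussianDensity_nonneg (x : E) : 0 ≤ stdGaussianDensity x := by
  unfold stdGaussianDensity; positivity

theorem integral_stdGaussianDensity_mul_cexp (t : E) :
    ∫ x : E, (stdGaussianDensity x : ℂ) * Complex.exp (inner ℝ x t * Complex.I)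
      = Complex.exp (-‖t‖ ^ 2 / 2) := by
  have h := GaussianFourier.integral_cexp_neg_mul_sq_norm_add (V := E) (b := 1 / 2)
    (by norm_num) Complex.I t
  have h2 : ∀ x : E, (stdGaussianDensity x : ℂ) * Complex.exp (inner ℝ x t * Complex.I)
      = ((2 * Real.pi : ℝ) : ℂ) ^ (-(Module.finrank ℝ E : ℂ) / 2)
        * Complex.exp (-(1 / 2) * ‖x‖ ^ 2 + Complex.I * inner ℝ t x) := by
    intro x
    unfold stdGaussianDensity
    push_cast
    rw [Complex.ofReal_cpow (by positivity), mul_assoc, ← Complex.exp_add, real_inner_comm]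
    push_cast
    congr 2
    ring
  simp_rw [h2]
  rw [integral_const_mul, h, ← mul_assoc]
  have hpi : ((2 * Real.pi : ℝ) : ℂ) ≠ 0 := by
    exact_mod_cast (by positivity : (2 * Real.pi : ℝ) ≠ 0)
  have h3 : (Real.pi : ℂ) / (1 / 2) = ((2 * Real.pi : ℝ) : ℂ) := by push_cast; ring
  rw [h3, ← Complex.cpow_add _ _ hpi]
  have h4 : -(Module.finrank ℝ E : ℂ) / 2 + (Module.finrank ℝ E : ℂ) / 2 = 0 := by ring
  rw [h4, Complex.cpow_zero, one_mul, Complex.I_sq]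
  congr 1
  ring

/-- If the density were not integrable, its Fourier integral at 0 would take the default value 0,
whereas the closed formula gives 1. -/
theorem integrable_stdGaussianDensity : Integrable (stdGaussianDensity : E → ℝ) := by
  by_contra hn
  have h := integral_stdGaussianDensity_mul_cexp (E := E) 0
  simp only [inner_zero_right, Complex.ofReal_zero, zero_mul, Complex.exp_zero, mul_one,
    norm_zero] at h
  rw [integral_undef] at h
  · simp at h
  · intro hi
    exact hn (by simpa using hi.re)

theorem stdGaussian_eq_withDensity :
    stdGaussian E = volume.withDensity fun x => ENNReal.ofReal (stdGaussianDensity x) := by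
  have hfin : IsFiniteMeasure ((volume : Measure E).withDensity
      fun x => ENNReal.ofReal (stdGaussianDensity x)) :=
    isFiniteMeasure_withDensity_ofReal integrable_stdGaussianDensity.2
  apply Measure.ext_of_charFun
  ext t
  rw [charFun_stdGaussian, charFun_apply,
    integral_withDensity_eq_integral_toReal_smul (by
      exact measurable_stdGaussianDensity.ennreal_ofReal) (by simp),
    ← integral_stdGaussianDensity_mul_cexp]
  congr 1
  ext x
  rw [ENNReal.toReal_ofReal (stdGaussianDensity_nonneg x), Complex.real_smul]

/-- The Cameron-Martin formula. -/
theorem lintegral_stdGaussian_shift {f : E → ℝ≥0∞} (hf : Measurable f) (h : E) :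
    ∫⁻ t, f t ∂(stdGaussian E)
      = ∫⁻ t, f (t + h) * ENNReal.ofReal (Real.exp (-inner ℝ t h - ‖h‖ ^ 2 / 2))
          ∂(stdGaussian E) := by
  have hm := (measurable_stdGaussianDensity (E := E)).ennreal_ofReal
  rw [stdGaussian_eq_withDensity, lintegral_withDensity_eq_lintegral_mul _ hm hf,
    lintegral_withDensity_eq_lintegral_mul _ hm (by fun_prop),
    ← lintegral_add_right_eq_self _ h]
  congr 1
  ext t
  simp only [Pi.mul_apply]
  rw [mul_comm (f (t + h)), ← mul_assoc, ← ENNReal.ofReal_mul (stdGaussianDensity_nonneg t)]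
  congr 2
  unfold stdGaussianDensity
  rw [mul_assoc, ← Real.exp_add, norm_add_sq_real]
  congr 2
  ring

theorem ofReal_integral_le_lintegral {α : Type*} [MeasurableSpace α] {μ : Measure α}
    {f : α → ℝ} (hf : Integrable f μ) :
    ENNReal.ofReal (∫ x, f x ∂μ) ≤ ∫⁻ x, ENNReal.ofReal (f x) ∂μ := by
  rw [integral_eq_lintegral_pos_part_sub_lintegral_neg_part hf]
  refine (ENNReal.ofReal_le_ofReal (sub_le_self _ ENNReal.toReal_nonneg)).trans ?_
  exact ENNReal.ofReal_toReal_le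

/-- Jensen's inequality through the tangent line of the exponential at the mean. With the right-hand
side in `ℝ≥0∞`, integrability of exp f is not required. -/
theorem ofReal_exp_integral_le {α : Type*} [MeasurableSpace α] {μ : Measure α}
    [IsProbabilityMeasure μ] {f : α → ℝ} (hf : Integrable f μ) :
    ENNReal.ofReal (Real.exp (∫ x, f x ∂μ)) ≤ ∫⁻ x, ENNReal.ofReal (Real.exp (f x)) ∂μ := by
  set c := ∫ x, f x ∂μ
  have hi : Integrable (fun x => Real.exp c * (1 + (f x - c))) μ :=
    ((integrable_const _).add (hf.sub (integrable_const _))).const_mul _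
  calc ENNReal.ofReal (Real.exp c)
      = ENNReal.ofReal (∫ x, Real.exp c * (1 + (f x - c)) ∂μ) := by
        have h1 : ∫ x, (1 + (f x - c)) ∂μ = 1 := by
          have e : (fun x => 1 + (f x - c)) = fun x => f x + (1 - c) := by ext x; ring
          rw [e, integral_add hf (integrable_const _)]
          simp [c]
        rw [integral_const_mul, h1, mul_one]
    _ ≤ ∫⁻ x, ENNReal.ofReal (Real.exp c * (1 + (f x - c))) ∂μ := ofReal_integral_le_lintegral hi
    _ ≤ _ := by
        apply lintegral_mono
        intro x
        apply ENNReal.ofReal_le_ofReal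
        have h1 : Real.exp (f x) = Real.exp c * Real.exp (f x - c) := by
          rw [← Real.exp_add]; congr 1; ring
        rw [h1]
        gcongr
        linarith [Real.add_one_le_exp (f x - c)]

theorem integrable_inner_pow_stdGaussian (w : E) (k : ℕ) :
    Integrable (fun t : E => inner ℝ t w ^ k) (stdGaussian E) := by
  have h : MemLp (fun t : E => inner ℝ t w) k (stdGaussian E) := by
    have h0 := IsGaussian.memLp_id (stdGaussian E) k (by simp)
    refine (h0.norm.mul_const ‖w‖).mono (by fun_prop) ?_
    filter_upwards with t
    simpa using norm_inner_le_norm (𝕜 := ℝ) t w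
  rcases Nat.eq_zero_or_pos k with rfl | hk
  · simp
  · have := h.integrable_norm_pow hk.ne'
    refine this.mono (by fun_prop) ?_
    filter_upwards with t
    simp

theorem integrable_norm_pow_stdGaussian (k : ℕ) :
    Integrable (fun t : E => ‖t‖ ^ k) (stdGaussian E) := by
  rcases Nat.eq_zero_or_pos k with rfl | hk
  · simp
  · exact (IsGaussian.memLp_id (stdGaussian E) k (by simp)).integrable_norm_pow hk.ne'

/-- A change of measure inequality for Gaussian measures. -/
theorem exp_integral_shift_le {f : E → ℝ} (hf : Measurable f) (h : E)
    (hi : Integrable (fun t => f (t + h)) (stdGaussian E)) :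
    ENNReal.ofReal (Real.exp (∫ t, f (t + h) ∂(stdGaussian E) - ‖h‖ ^ 2 / 2))
      ≤ ∫⁻ t, ENNReal.ofReal (Real.exp (f t)) ∂(stdGaussian E) := by
  -- After the shift, Jensen is applied to the whole exponent. Its linear term ⟪t, h⟫ has mean zero,
  -- so only ‖h‖²/2 remains: the relative entropy of N(h, I) with respect to N(0, I).
  rw [lintegral_stdGaussian_shift (by fun_prop) h]
  have hin : Integrable (fun t : E => inner ℝ t h) (stdGaussian E) := by
    simpa using integrable_inner_pow_stdGaussian h 1
  have h0 : ∫ t : E, inner ℝ t h ∂(stdGaussian E) = 0 := by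
    have := integral_strongDual_stdGaussian (E := E) (innerSL ℝ h)
    simpa [real_inner_comm] using this
  have h1 := ofReal_exp_integral_le (μ := stdGaussian E)
    (f := fun t => f (t + h) + (-inner ℝ t h - ‖h‖ ^ 2 / 2))
    (hi.add (hin.neg.sub (integrable_const _)))
  have h2 : ∫ t, (f (t + h) + (-inner ℝ t h - ‖h‖ ^ 2 / 2)) ∂(stdGaussian E)
      = ∫ t, f (t + h) ∂(stdGaussian E) - ‖h‖ ^ 2 / 2 := by
    have e : (fun t => f (t + h) + (-inner ℝ t h - ‖h‖ ^ 2 / 2))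
        = fun t => f (t + h) - inner ℝ t h - ‖h‖ ^ 2 / 2 := by ext t; ring
    have hs : Integrable (fun t => f (t + h) - inner ℝ t h) (stdGaussian E) := hi.sub hin
    rw [e, integral_sub hs (integrable_const _), integral_sub hi hin, h0]
    simp
  rw [h2] at h1
  refine h1.trans_eq ?_
  congr 1
  ext t
  rw [Real.exp_add, ENNReal.ofReal_mul (Real.exp_pos _).le]

theorem map_inner_stdGaussian (w : E) :
    (stdGaussian E).map (fun t => inner ℝ t w) = gaussianReal 0 (‖w‖₊ ^ 2) := by
  have h := IsGaussian.map_eq_gaussianReal (μ := stdGaussian E) (innerSL ℝ w)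
  rw [integral_strongDual_stdGaussian, variance_dual_stdGaussian, innerSL_apply_norm] at h
  have h2 : (fun t : E => inner ℝ t w) = innerSL ℝ w := by
    ext t; simp [real_inner_comm]
  rw [h2, h]
  congr 1
  ext
  simp

theorem integral_pow_four_gaussianReal (v : NNReal) :
    ∫ x, x ^ 4 ∂(gaussianReal 0 v) = 3 * (v : ℝ) ^ 2 := by
  have h := iteratedDeriv_mgf_zero (X := id) (μ := gaussianReal 0 v)
    (by rw [integrableExpSet_id_gaussianReal]; simp) 4
  -- The derivatives of the moment generating function keep the form polynomial times exp (v t² /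
  -- 2). This rule is applied four times, and the result is read at t = 0.
  have hd : ∀ (p p' : ℝ → ℝ), (∀ t, HasDerivAt p (p' t) t) →
      deriv (fun t => p t * Real.exp (v * t ^ 2 / 2))
        = fun t => (p' t + v * t * p t) * Real.exp (v * t ^ 2 / 2) := by
    intro p p' hp
    ext t
    have h1 : HasDerivAt (fun t : ℝ => (v : ℝ) * t ^ 2 / 2) (v * t) t := by
      have := (((hasDerivAt_id t).pow 2).const_mul (v : ℝ)).div_const 2
      refine this.congr_deriv ?_
      simp; ring
    have h2 : HasDerivAt (fun t => p t * Real.exp (v * t ^ 2 / 2)) _ t := (hp t).mul h1.exp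
    rw [h2.deriv]; ring
  rw [mgf_id_gaussianReal] at h
  have e0 : (fun t : ℝ => Real.exp ((0 : ℝ) * t + v * t ^ 2 / 2))
      = fun t => (fun _ => (1 : ℝ)) t * Real.exp (v * t ^ 2 / 2) := by
    ext t; simp
  rw [e0] at h
  simp only [iteratedDeriv_succ, iteratedDeriv_zero] at h
  rw [hd _ (fun _ => 0) (fun t => hasDerivAt_const _ _)] at h
  rw [hd (fun t => 0 + v * t * 1) (fun _ => v) (fun t => by
    have := ((hasDerivAt_id t).const_mul (v : ℝ))
    convert! this using 1 <;> first | (ext; simp) | simp)] at h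
  rw [hd (fun t => v + v * t * (0 + v * t * 1)) (fun t => 2 * v ^ 2 * t) (fun t => by
    have := (((hasDerivAt_id t).pow 2).const_mul ((v : ℝ) ^ 2)).const_add (v : ℝ)
    convert! this using 1
    · ext; simp; ring
    · simp; ring)] at h
  rw [hd (fun t => 2 * v ^ 2 * t + v * t * (v + v * t * (0 + v * t * 1)))
    (fun t => 3 * v ^ 2 + 3 * v ^ 3 * t ^ 2) (fun t => by
    have := ((hasDerivAt_id t).const_mul (3 * (v : ℝ) ^ 2)).add
      (((hasDerivAt_id t).pow 3).const_mul ((v : ℝ) ^ 3))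
    convert! this using 1
    · ext; simp; ring
    · simp; ring)] at h
  simpa using h.symm

theorem integral_inner_pow_four_stdGaussian (w : E) :
    ∫ t, inner ℝ t w ^ 4 ∂(stdGaussian E) = 3 * ‖w‖ ^ 4 := by
  have h := integral_pow_four_gaussianReal (‖w‖₊ ^ 2)
  rw [← map_inner_stdGaussian, integral_map (by fun_prop) (by fun_prop)] at h
  rw [h]; push_cast; ring

theorem integral_inner_sq_stdGaussian (w : E) :
    ∫ t, inner ℝ t w ^ 2 ∂(stdGaussian E) = ‖w‖ ^ 2 := by
  have h := variance_dual_stdGaussian (E := E) (innerSL ℝ w)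
  rw [innerSL_apply_norm, variance_of_integral_eq_zero (by fun_prop)
    (integral_strongDual_stdGaussian _)] at h
  simpa [real_inner_comm] using h

theorem integral_inner_stdGaussian (w : E) :
    ∫ t, inner ℝ t w ∂(stdGaussian E) = 0 := by
  simpa [real_inner_comm] using integral_strongDual_stdGaussian (E := E) (innerSL ℝ w)

/-- Invariance of the Gaussian under t ↦ -t. -/
theorem integral_inner_pow_three_stdGaussian (w : E) :
    ∫ t, inner ℝ t w ^ 3 ∂(stdGaussian E) = 0 := by
  have h := stdGaussian_map (LinearIsometryEquiv.neg ℝ (E := E))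
  have h1 : ∫ t, inner ℝ t w ^ 3 ∂(stdGaussian E)
      = ∫ t, -(inner ℝ t w ^ 3) ∂(stdGaussian E) := by
    conv_lhs => rw [← h]
    rw [integral_map (by fun_prop) (by fun_prop)]
    congr 1
    ext t
    simp [inner_neg_left]
    ring
  rw [integral_neg] at h1
  linarith

end Gaussian

end LeastSquares

end

noncomputable section

namespace LeastSquares

/-! ### Polynomial upper bounds for the exponential. -/

theorem exp_le_quadratic_of_nonpos {x : ℝ} (hx : x ≤ 0) :
    Real.exp x ≤ 1 + x + x ^ 2 / 2 := by
  have h1 := Real.quadratic_le_exp_of_nonneg (x := -x) (by linarith)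
  have h2 : Real.exp x * Real.exp (-x) = 1 := by rw [← Real.exp_add]; simp
  have h3 : 0 < Real.exp x := Real.exp_pos x
  have h4 : Real.exp x * (1 + -x + (-x) ^ 2 / 2) ≤ 1 := by nlinarith
  have h5 : 0 < 1 + -x + (-x) ^ 2 / 2 := by nlinarith
  refine le_of_mul_le_mul_right (h4.trans ?_) h5
  nlinarith [sq_nonneg (x ^ 2)]

theorem exp_le_cubic_of_nonneg {x : ℝ} (h0 : 0 ≤ x) (h1 : x ≤ 5 / 4) :
    Real.exp x ≤ 1 + x + x ^ 2 / 2 + x ^ 3 / 4 := by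
  -- The Taylor estimate with remainder requires an argument at most 1, so it is used at x/2 and
  -- squared; 5/96 is its remainder constant at order 4.
  obtain ⟨y, rfl⟩ : ∃ y, x = 2 * y := ⟨x / 2, by ring⟩
  have hy0 : 0 ≤ y := by linarith
  have hy1 : y ≤ 5 / 8 := by linarith
  have h2 := Real.exp_bound' (x := y) hy0 (by linarith) (n := 4) (by norm_num)
  simp only [Finset.sum_range_succ, Finset.sum_range_zero, Nat.factorial] at h2
  norm_num at h2
  have h3 : Real.exp (2 * y) = Real.exp y ^ 2 := by rw [← Real.exp_nat_mul]; simp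
  have hp := Real.exp_pos y
  rw [h3]
  have h4 : Real.exp y ^ 2 ≤ (1 + y + y ^ 2 / 2 + y ^ 3 / 6 + y ^ 4 * 5 / 96) ^ 2 := by
    refine pow_le_pow_left₀ hp.le ?_ 2
    linarith
  refine h4.trans ?_
  have e : (1 + 2 * y + (2 * y) ^ 2 / 2 + (2 * y) ^ 3 / 4)
      - (1 + y + y ^ 2 / 2 + y ^ 3 / 6 + y ^ 4 * 5 / 96) ^ 2
      = y ^ 3 * (2 / 3 - (11 / 16 * y + 13 / 48 * y ^ 2 + 23 / 288 * y ^ 3 + 5 / 288 * y ^ 4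
        + 25 / 9216 * y ^ 5)) := by ring
  have hb : ∀ k : ℕ, y ^ k ≤ (5 / 8) ^ k := fun k => pow_le_pow_left₀ hy0 hy1 k
  have h5 : 0 ≤ 2 / 3 - (11 / 16 * y + 13 / 48 * y ^ 2 + 23 / 288 * y ^ 3 + 5 / 288 * y ^ 4
        + 25 / 9216 * y ^ 5) := by
    have := hb 2; have := hb 3; have := hb 4; have := hb 5
    norm_num at *
    linarith
  have := mul_nonneg (pow_nonneg hy0 3) h5
  linarith

/-- Only an upper bound on x is needed: negative x of any size obeys the quadratic bound. This
one-sidedness lets fourth moments suffice. The range 5/4 is 1 + 1/4, for lam ≤ 1 and lam ‖w‖² / β ≤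
1/4. -/
theorem exp_le_of_le {x b : ℝ} (hb0 : 0 ≤ b) (hb : b ≤ 5 / 4) (hx : x ≤ b) :
    Real.exp x ≤ 1 + x + x ^ 2 / 2 + b ^ 3 / 4 := by
  rcases le_total x 0 with h | h
  · have := exp_le_quadratic_of_nonpos h
    have := pow_nonneg hb0 3
    linarith
  · have := exp_le_cubic_of_nonneg h (hx.trans hb)
    have := pow_le_pow_left₀ h hx 3
    linarith

/-! ### PAC-Bayesian exponential inequality with a Gaussian prior. -/

section PacBayes

variable {E : Type*} [NormedAddCommGroup E] [InnerProductSpace ℝ E] [FiniteDimensional ℝ E]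
  [MeasurableSpace E] [BorelSpace E]

/-- The exponent, with mean `lam * (1 - ⟪θ, w⟫²)` when `t` is Gaussian with mean `√β θ` and
identity covariance. -/
def smoothExponent (lam β : ℝ) (t w : E) : ℝ :=
  lam * (1 - (inner ℝ t w) ^ 2 / β + ‖w‖ ^ 2 / β)

/-- A polynomial upper bound for `exp (smoothExponent lam β t w) - 1`. -/
def expBound (lam β : ℝ) (t w : E) : ℝ :=
  smoothExponent lam β t w + smoothExponent lam β t w ^ 2 / 2
    + (lam * (1 + ‖w‖ ^ 2 / β)) ^ 3 / 4

/-- The integral of `expBound lam β t` against the law `Q`. -/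
def logBound (lam β : ℝ) (Q : Measure E) (t : E) : ℝ := ∫ w, expBound lam β t w ∂Q

/-- The normalized exponential moment, averaged with respect to a Gaussian prior. -/
def evidence (lam β : ℝ) (Q : Measure E) {n : ℕ} (z : Fin n → E) : ℝ≥0∞ :=
  ∫⁻ t, ENNReal.ofReal (Real.exp (∑ i, smoothExponent lam β t (z i)
    - n * logBound lam β Q t)) ∂(stdGaussian E)

theorem exp_smoothExponent_le {lam β : ℝ} (hl : 0 < lam) (hl1 : lam ≤ 1) (hβ : 0 < β) {w : E}
    (hw : lam * ‖w‖ ^ 2 ≤ β / 4) (t : E) :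
    Real.exp (smoothExponent lam β t w) ≤ 1 + expBound lam β t w := by
  have h1 : lam * (‖w‖ ^ 2 / β) ≤ 1 / 4 := by
    rw [← mul_div_assoc, div_le_iff₀ hβ]; linarith
  have h2 := exp_le_of_le (x := smoothExponent lam β t w) (b := lam * (1 + ‖w‖ ^ 2 / β))
    (by positivity) (by linarith) (by
      unfold smoothExponent
      have : 0 ≤ lam * ((inner ℝ t w) ^ 2 / β) := by positivity
      nlinarith)
  unfold expBound
  linarith

theorem measurable_smoothExponent (lam β : ℝ) {α : Type*} [MeasurableSpace α] {f g : α → E}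
    (hf : Measurable f) (hg : Measurable g) :
    Measurable (fun a => smoothExponent lam β (f a) (g a)) := by
  unfold smoothExponent; fun_prop

theorem measurable_expBound (lam β : ℝ) :
    Measurable (fun p : E × E => expBound lam β p.1 p.2) := by
  have := measurable_smoothExponent (E := E) lam β measurable_fst measurable_snd
  unfold expBound
  fun_prop

/-- For w in a ball, the growth in t is at most quadratic. This yields the Gaussian-integrable
dominating function behind the exchanges of integrals below. -/
theorem abs_smoothExponent_le {lam β B : ℝ} (hl : 0 < lam) (hβ : 0 < β) {w : E} (hB : ‖w‖ ≤ B)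
    (t h : E) :
    |smoothExponent lam β (t + h) w|
      ≤ lam * (1 + (2 * ‖h‖ ^ 2 + 1) * B ^ 2 / β) + lam * (2 * B ^ 2 / β) * ‖t‖ ^ 2 := by
  have h1 : ‖w‖ ^ 2 ≤ B ^ 2 := pow_le_pow_left₀ (norm_nonneg _) hB 2
  have h2 : (inner ℝ (t + h) w) ^ 2 ≤ (2 * ‖t‖ ^ 2 + 2 * ‖h‖ ^ 2) * B ^ 2 := by
    calc (inner ℝ (t + h) w) ^ 2 = |inner ℝ (t + h) w| ^ 2 := (sq_abs _).symm
      _ ≤ (‖t + h‖ * ‖w‖) ^ 2 := by gcongr; exact abs_real_inner_le_norm _ _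
      _ = ‖t + h‖ ^ 2 * ‖w‖ ^ 2 := by ring
      _ ≤ (2 * ‖t‖ ^ 2 + 2 * ‖h‖ ^ 2) * B ^ 2 := by
        gcongr
        have := norm_add_le t h
        have : ‖t + h‖ ^ 2 ≤ (‖t‖ + ‖h‖) ^ 2 := by gcongr
        nlinarith [sq_nonneg (‖t‖ - ‖h‖)]
  have h3 : |1 - (inner ℝ (t + h) w) ^ 2 / β + ‖w‖ ^ 2 / β|
      ≤ 1 + (2 * ‖t‖ ^ 2 + 2 * ‖h‖ ^ 2) * B ^ 2 / β + B ^ 2 / β := by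
    have a1 : (inner ℝ (t + h) w) ^ 2 / β ≤ (2 * ‖t‖ ^ 2 + 2 * ‖h‖ ^ 2) * B ^ 2 / β := by gcongr
    have a2 : ‖w‖ ^ 2 / β ≤ B ^ 2 / β := by gcongr
    have a3 : 0 ≤ (inner ℝ (t + h) w) ^ 2 / β := by positivity
    have a4 : 0 ≤ ‖w‖ ^ 2 / β := by positivity
    rw [abs_le]; constructor <;> linarith
  unfold smoothExponent
  rw [abs_mul, abs_of_pos hl]
  calc lam * |1 - (inner ℝ (t + h) w) ^ 2 / β + ‖w‖ ^ 2 / β|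
      ≤ lam * (1 + (2 * ‖t‖ ^ 2 + 2 * ‖h‖ ^ 2) * B ^ 2 / β + B ^ 2 / β) := by gcongr
    _ = _ := by ring

theorem abs_expBound_le {lam β B : ℝ} (hl : 0 < lam) (hβ : 0 < β) {w : E} (hB : ‖w‖ ≤ B)
    (t h : E) :
    |expBound lam β (t + h) w|
      ≤ (lam * (1 + (2 * ‖h‖ ^ 2 + 1) * B ^ 2 / β) + lam * (2 * B ^ 2 / β) * ‖t‖ ^ 2)
        + (lam * (1 + (2 * ‖h‖ ^ 2 + 1) * B ^ 2 / β) + lam * (2 * B ^ 2 / β) * ‖t‖ ^ 2) ^ 2 / 2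
        + (lam * (1 + B ^ 2 / β)) ^ 3 / 4 := by
  have h1 := abs_smoothExponent_le hl hβ hB t h
  set g := lam * (1 + (2 * ‖h‖ ^ 2 + 1) * B ^ 2 / β) + lam * (2 * B ^ 2 / β) * ‖t‖ ^ 2
  have h2 : smoothExponent lam β (t + h) w ^ 2 ≤ g ^ 2 := by
    rw [← sq_abs]; gcongr
  have h3 : (lam * (1 + ‖w‖ ^ 2 / β)) ^ 3 ≤ (lam * (1 + B ^ 2 / β)) ^ 3 := by gcongr
  have h4 : 0 ≤ (lam * (1 + ‖w‖ ^ 2 / β)) ^ 3 := by positivity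
  unfold expBound
  rw [abs_le] at h1 ⊢
  constructor <;> nlinarith [sq_nonneg (smoothExponent lam β (t + h) w)]

theorem integrable_expBound_prod {lam β B : ℝ} (hl : 0 < lam) (hβ : 0 < β) {Q : Measure E}
    [IsProbabilityMeasure Q] (hB : ∀ᵐ w ∂Q, ‖w‖ ≤ B) (h : E) :
    Integrable (fun p : E × E => expBound lam β (p.1 + h) p.2) ((stdGaussian E).prod Q) := by
  have hi : Integrable (fun t : E =>
      (lam * (1 + (2 * ‖h‖ ^ 2 + 1) * B ^ 2 / β) + lam * (2 * B ^ 2 / β) * ‖t‖ ^ 2)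
        + (lam * (1 + (2 * ‖h‖ ^ 2 + 1) * B ^ 2 / β) + lam * (2 * B ^ 2 / β) * ‖t‖ ^ 2) ^ 2 / 2
        + (lam * (1 + B ^ 2 / β)) ^ 3 / 4) (stdGaussian E) := by
    set c0 := lam * (1 + (2 * ‖h‖ ^ 2 + 1) * B ^ 2 / β)
    set c1 := lam * (2 * B ^ 2 / β)
    have e : (fun t : E => (c0 + c1 * ‖t‖ ^ 2) + (c0 + c1 * ‖t‖ ^ 2) ^ 2 / 2
        + (lam * (1 + B ^ 2 / β)) ^ 3 / 4)
        = fun t : E => (c0 + c0 ^ 2 / 2 + (lam * (1 + B ^ 2 / β)) ^ 3 / 4)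
          + ((c1 + c0 * c1) * ‖t‖ ^ 2 + c1 ^ 2 / 2 * ‖t‖ ^ 4) := by
      ext t; ring
    rw [e]
    exact (integrable_const _).add (((integrable_norm_pow_stdGaussian 2).const_mul _).add
      ((integrable_norm_pow_stdGaussian 4).const_mul _))
  refine (hi.comp_fst Q).mono' ?_ ?_
  · have := measurable_expBound (E := E) lam β
    exact (this.comp (by fun_prop : Measurable fun p : E × E => (p.1 + h, p.2))).aestronglyMeasurable
  · have : ∀ᵐ p ∂((stdGaussian E).prod Q), ‖p.2‖ ≤ B :=
      (Measure.quasiMeasurePreserving_snd (μ := stdGaussian E) (ν := Q)).ae hB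
    filter_upwards [this] with p hp
    exact abs_expBound_le hl hβ hp p.1 h

theorem integrable_expBound {lam β B : ℝ} (hl : 0 < lam) (hβ : 0 < β) {Q : Measure E}
    [IsProbabilityMeasure Q] (hB : ∀ᵐ w ∂Q, ‖w‖ ≤ B) (t : E) :
    Integrable (fun w => expBound lam β t w) Q := by
  refine (integrable_const _).mono' (f := fun w => expBound lam β t w) ?_ (by
    filter_upwards [hB] with w hw
    simpa using abs_expBound_le hl hβ hw 0 t)
  exact ((measurable_expBound lam β).comp measurable_prodMk_left).aestronglyMeasurable

theorem measurable_logBound (lam β : ℝ) (Q : Measure E) [SFinite Q] :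
    Measurable (logBound lam β Q) :=
  ((measurable_expBound lam β).stronglyMeasurable.integral_prod_right').measurable

theorem lintegral_exp_smoothExponent_le {lam β B : ℝ} (hl : 0 < lam) (hl1 : lam ≤ 1)
    (hβ : 0 < β) (hB : lam * B ^ 2 ≤ β / 4) {Q : Measure E} [IsProbabilityMeasure Q]
    (hQ : ∀ᵐ w ∂Q, ‖w‖ ≤ B) (t : E) :
    ∫⁻ w, ENNReal.ofReal (Real.exp (smoothExponent lam β t w)) ∂Q
      ≤ ENNReal.ofReal (Real.exp (logBound lam β Q t)) := by
  have hi := integrable_expBound hl hβ hQ t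
  have hw : ∀ᵐ w ∂Q, Real.exp (smoothExponent lam β t w) ≤ 1 + expBound lam β t w := by
    filter_upwards [hQ] with w hw
    refine exp_smoothExponent_le hl hl1 hβ (le_trans ?_ hB) t
    gcongr
  calc ∫⁻ w, ENNReal.ofReal (Real.exp (smoothExponent lam β t w)) ∂Q
      ≤ ∫⁻ w, ENNReal.ofReal (1 + expBound lam β t w) ∂Q := by
        apply lintegral_mono_ae
        filter_upwards [hw] with w hw using ENNReal.ofReal_le_ofReal hw
    _ = ENNReal.ofReal (∫ w, (1 + expBound lam β t w) ∂Q) := by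
        have h1 : Integrable (fun w => 1 + expBound lam β t w) Q := (integrable_const _).add hi
        rw [ofReal_integral_eq_lintegral_ofReal h1]
        filter_upwards [hw] with w hw using (Real.exp_pos _).le.trans hw
    _ ≤ _ := by
        apply ENNReal.ofReal_le_ofReal
        rw [integral_add (integrable_const _) hi]
        simp only [integral_const, probReal_univ, smul_eq_mul, mul_one]
        linarith [Real.add_one_le_exp (logBound lam β Q t),
          show logBound lam β Q t = ∫ w, expBound lam β t w ∂Q from rfl]

theorem measurable_evidence_integrand (lam β : ℝ) (Q : Measure E) [SFinite Q] (n : ℕ) :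
    Measurable fun p : (Fin n → E) × E =>
      ENNReal.ofReal (Real.exp (∑ i, smoothExponent lam β p.2 (p.1 i)
        - n * logBound lam β Q p.2)) := by
  have h1 := measurable_logBound lam β Q
  have h2 : ∀ i, Measurable fun p : (Fin n → E) × E => smoothExponent lam β p.2 (p.1 i) :=
    fun i => measurable_smoothExponent lam β measurable_snd
      ((measurable_pi_apply i).comp measurable_fst)
  exact ((Finset.measurable_fun_sum _ fun i _ => h2 i).sub
    ((h1.comp measurable_snd).const_mul _)).exp.ennreal_ofReal

theorem measurable_evidence (lam β : ℝ) (Q : Measure E) [SFinite Q] (n : ℕ) :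
    Measurable fun z : Fin n → E => evidence lam β Q z :=
  (measurable_evidence_integrand lam β Q n).lintegral_prod_right'

/-- By Tonelli it is enough to fix t. Independence then factors the exponential moment, and each of
the n factors is at most exp (`logBound`), which the normalization cancels. -/
theorem lintegral_evidence_le_one {lam β B : ℝ} (hl : 0 < lam) (hl1 : lam ≤ 1)
    (hβ : 0 < β) (hB : lam * B ^ 2 ≤ β / 4) {Q : Measure E} [IsProbabilityMeasure Q]
    (hQ : ∀ᵐ w ∂Q, ‖w‖ ≤ B) {Ω : Type*} [MeasurableSpace Ω] {P : Measure Ω}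
    [IsProbabilityMeasure P] {n : ℕ} {Z : Fin n → Ω → E} (hZ : ∀ i, Measurable (Z i))
    (hind : iIndepFun Z P) (hlaw : ∀ i, P.map (Z i) = Q) :
    ∫⁻ ω, evidence lam β Q (fun i => Z i ω) ∂P ≤ 1 := by
  unfold evidence
  rw [lintegral_lintegral_swap]
  swap
  · exact ((measurable_evidence_integrand lam β Q n).comp
      ((measurable_pi_lambda _ fun i => (hZ i).comp measurable_fst).prodMk measurable_snd)).aemeasurable
  calc _ ≤ ∫⁻ _ : E, 1 ∂(stdGaussian E) := lintegral_mono fun t => ?_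
    _ = 1 := by simp
  set m := logBound lam β Q t
  have hms : Measurable fun w : E => ENNReal.ofReal (Real.exp (smoothExponent lam β t w)) := by
    have : Measurable fun w : E => smoothExponent lam β t w :=
      measurable_smoothExponent lam β measurable_const measurable_id
    exact this.exp.ennreal_ofReal
  have e : ∀ ω, ENNReal.ofReal (Real.exp (∑ i, smoothExponent lam β t (Z i ω) - n * m))
      = ENNReal.ofReal (Real.exp (-(n * m)))
        * ∏ i, ENNReal.ofReal (Real.exp (smoothExponent lam β t (Z i ω))) := by
    intro ω
    rw [← ENNReal.ofReal_prod_of_nonneg (fun i _ => (Real.exp_pos _).le),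
      ← ENNReal.ofReal_mul (Real.exp_pos _).le, ← Real.exp_sum, ← Real.exp_add]
    congr 2
    ring
  simp_rw [e]
  rw [lintegral_const_mul' _ _ ENNReal.ofReal_ne_top,
    lintegral_prod_eq_prod_lintegral_of_indepFun Finset.univ
      (fun i ω => ENNReal.ofReal (Real.exp (smoothExponent lam β t (Z i ω))))
      (hind.comp _ (fun _ => hms)) (fun i => hms.comp (hZ i))]
  have h1 : ∀ i, ∫⁻ ω, ENNReal.ofReal (Real.exp (smoothExponent lam β t (Z i ω))) ∂P
      ≤ ENNReal.ofReal (Real.exp m) := by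
    intro i
    have := lintegral_exp_smoothExponent_le hl hl1 hβ hB hQ t
    rw [← lintegral_map hms (hZ i), hlaw i]
    exact this

  calc _ ≤ ENNReal.ofReal (Real.exp (-(n * m))) * ∏ _i : Fin n, ENNReal.ofReal (Real.exp m) := by
        gcongr with i; exact h1 i
    _ = 1 := by
      rw [Finset.prod_const, ← ENNReal.ofReal_pow (Real.exp_pos _).le,
        ← ENNReal.ofReal_mul (Real.exp_pos _).le, ← Real.exp_nat_mul, ← Real.exp_add]
      simp

theorem integrable_inner_add_pow_stdGaussian (h w : E) (k : ℕ) :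
    Integrable (fun t : E => inner ℝ (t + h) w ^ k) (stdGaussian E) := by
  simp_rw [inner_add_left, add_pow]
  refine integrable_finsetSum _ fun i _ => ?_
  exact ((integrable_inner_pow_stdGaussian w i).mul_const _).mul_const _

theorem integral_affine {α : Type*} [MeasurableSpace α] {μ : Measure α} [IsProbabilityMeasure μ]
    {f g : α → ℝ} (hf : Integrable f μ) (hg : Integrable g μ) (a b c : ℝ) :
    ∫ x, (a + b * f x + c * g x) ∂μ = a + b * ∫ x, f x ∂μ + c * ∫ x, g x ∂μ := by
  have h1 : Integrable (fun x => a + b * f x) μ := (integrable_const a).add (hf.const_mul b)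
  rw [integral_add h1 (hg.const_mul c), integral_add (integrable_const a) (hf.const_mul b),
    integral_const_mul, integral_const_mul]
  simp

theorem integral_inner_add_sq_stdGaussian (h w : E) :
    ∫ t, inner ℝ (t + h) w ^ 2 ∂(stdGaussian E) = ‖w‖ ^ 2 + inner ℝ h w ^ 2 := by
  have i1 := integrable_inner_pow_stdGaussian w 1
  have i2 := integrable_inner_pow_stdGaussian w 2
  have e : (fun t : E => inner ℝ (t + h) w ^ 2) = fun t : E =>
      inner ℝ h w ^ 2 + (2 * inner ℝ h w) * inner ℝ t w ^ 1 + 1 * inner ℝ t w ^ 2 := by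
    ext t; rw [inner_add_left]; ring
  rw [e, integral_affine i1 i2]
  simp [integral_inner_sq_stdGaussian, integral_inner_stdGaussian]
  ring

theorem integral_inner_add_pow_four_stdGaussian (h w : E) :
    ∫ t, inner ℝ (t + h) w ^ 4 ∂(stdGaussian E)
      = 3 * ‖w‖ ^ 4 + 6 * inner ℝ h w ^ 2 * ‖w‖ ^ 2 + inner ℝ h w ^ 4 := by
  have i1 := integrable_inner_pow_stdGaussian w 1
  have i2 := integrable_inner_pow_stdGaussian w 2
  have i3 := integrable_inner_pow_stdGaussian w 3
  have i4 := integrable_inner_pow_stdGaussian w 4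
  have i12 : Integrable (fun t : E => inner ℝ h w ^ 4
      + (4 * inner ℝ h w ^ 3) * inner ℝ t w ^ 1 + (6 * inner ℝ h w ^ 2) * inner ℝ t w ^ 2)
      (stdGaussian E) := ((integrable_const _).add (i1.const_mul _)).add (i2.const_mul _)
  have i34 : Integrable (fun t : E => 0 + (4 * inner ℝ h w) * inner ℝ t w ^ 3
      + 1 * inner ℝ t w ^ 4) (stdGaussian E) :=
    ((integrable_const _).add (i3.const_mul _)).add (i4.const_mul _)
  have e : (fun t : E => inner ℝ (t + h) w ^ 4) = fun t : E =>
      (inner ℝ h w ^ 4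
        + (4 * inner ℝ h w ^ 3) * inner ℝ t w ^ 1 + (6 * inner ℝ h w ^ 2) * inner ℝ t w ^ 2)
      + (0 + (4 * inner ℝ h w) * inner ℝ t w ^ 3 + 1 * inner ℝ t w ^ 4) := by
    ext t; rw [inner_add_left]; ring
  rw [e, integral_add i12 i34, integral_affine i1 i2, integral_affine i3 i4]
  simp only [integral_inner_sq_stdGaussian, integral_inner_pow_three_stdGaussian,
    integral_inner_pow_four_stdGaussian, pow_one, integral_inner_stdGaussian]
  ring

/-- The mean of `expBound lam β t w` when `t` is Gaussian with mean `√β θ`. -/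
def meanExpBound (lam β : ℝ) (θ w : E) : ℝ :=
  lam * (1 - (inner ℝ θ w) ^ 2)
    + lam ^ 2 / 2 * (1 - 2 * (inner ℝ θ w) ^ 2 + (inner ℝ θ w) ^ 4
      + 4 * ((inner ℝ θ w) ^ 2 * (‖w‖ ^ 2 / β)) + 2 * (‖w‖ ^ 2 / β) ^ 2)
    + (lam * (1 + ‖w‖ ^ 2 / β)) ^ 3 / 4

theorem inner_sqrt_smul_sq {β : ℝ} (hβ : 0 < β) (θ w : E) :
    inner ℝ (√β • θ) w ^ 2 = β * inner ℝ θ w ^ 2 := by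
  rw [real_inner_smul_left, mul_pow, Real.sq_sqrt hβ.le]

theorem integrable_smoothExponent_shift (lam β : ℝ) (h w : E) :
    Integrable (fun t => smoothExponent lam β (t + h) w) (stdGaussian E) := by
  unfold smoothExponent
  exact (((integrable_const _).sub
    ((integrable_inner_add_pow_stdGaussian h w 2).div_const _)).add (integrable_const _)).const_mul _

theorem integral_smoothExponent_shift (lam : ℝ) {β : ℝ} (hβ : 0 < β) (θ w : E) :
    ∫ t, smoothExponent lam β (t + √β • θ) w ∂(stdGaussian E)
      = lam * (1 - (inner ℝ θ w) ^ 2) := by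
  have i2 := integrable_inner_add_pow_stdGaussian (√β • θ) w 2
  have e : (fun t : E => smoothExponent lam β (t + √β • θ) w) = fun t : E =>
      (lam * (1 + ‖w‖ ^ 2 / β)) + (-lam / β) * inner ℝ (t + √β • θ) w ^ 2
        + 0 * inner ℝ (t + √β • θ) w ^ 2 := by
    ext t; unfold smoothExponent; ring
  rw [e, integral_affine i2 i2, integral_inner_add_sq_stdGaussian, inner_sqrt_smul_sq hβ]
  field_simp
  ring

theorem integral_expBound_shift (lam : ℝ) {β : ℝ} (hβ : 0 < β) (θ w : E) :
    ∫ t, expBound lam β (t + √β • θ) w ∂(stdGaussian E) = meanExpBound lam β θ w := by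
  have i2 := integrable_inner_add_pow_stdGaussian (√β • θ) w 2
  have i4 := integrable_inner_add_pow_stdGaussian (√β • θ) w 4
  have e : (fun t : E => expBound lam β (t + √β • θ) w) = fun t : E =>
      (lam * (1 + ‖w‖ ^ 2 / β) + (lam * (1 + ‖w‖ ^ 2 / β)) ^ 2 / 2
        + (lam * (1 + ‖w‖ ^ 2 / β)) ^ 3 / 4)
      + (-lam / β - lam ^ 2 * (1 + ‖w‖ ^ 2 / β) / β) * inner ℝ (t + √β • θ) w ^ 2
      + (lam ^ 2 / β ^ 2 / 2) * inner ℝ (t + √β • θ) w ^ 4 := by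
    ext t; unfold expBound smoothExponent; ring
  have e4 : inner ℝ (√β • θ) w ^ 4 = β ^ 2 * inner ℝ θ w ^ 4 := by
    calc inner ℝ (√β • θ) w ^ 4 = (inner ℝ (√β • θ) w ^ 2) ^ 2 := by ring
      _ = _ := by rw [inner_sqrt_smul_sq hβ]; ring
  rw [e, integral_affine i2 i4,
    integral_inner_add_sq_stdGaussian, integral_inner_add_pow_four_stdGaussian, e4,
    inner_sqrt_smul_sq hβ]
  unfold meanExpBound
  field_simp
  ring

/-- The change of measure inequality with the shift √β θ, valid for all unit θ and all samples z at
once. The term ‖w‖²/β in `smoothExponent` cancels the variance of ⟪t, w⟫²/β, so averaging recovers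
the unsmoothed sum; the price is β/2 = ‖√β θ‖²/2. -/
theorem le_evidence {lam β B : ℝ} (hl : 0 < lam) (hβ : 0 < β) {Q : Measure E}
    [IsProbabilityMeasure Q] (hQ : ∀ᵐ w ∂Q, ‖w‖ ≤ B) {n : ℕ} (z : Fin n → E) {θ : E}
    (hθ : ‖θ‖ = 1) :
    ENNReal.ofReal (Real.exp (∑ i, lam * (1 - (inner ℝ θ (z i)) ^ 2)
      - n * ∫ w, meanExpBound lam β θ w ∂Q - β / 2)) ≤ evidence lam β Q z := by
  have hp := integrable_expBound_prod hl hβ hQ (√β • θ)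
  have hi1 : Integrable (fun t => ∑ i, smoothExponent lam β (t + √β • θ) (z i))
      (stdGaussian E) :=
    integrable_finsetSum _ fun i _ => integrable_smoothExponent_shift lam β _ _
  have hi2 : Integrable (fun t => (n : ℝ) * logBound lam β Q (t + √β • θ))
      (stdGaussian E) := hp.integral_prod_left.const_mul _
  have hm : Measurable fun t : E => ∑ i, smoothExponent lam β t (z i)
      - n * logBound lam β Q t := by
    have h1 := measurable_logBound lam β Q
    have h2 : ∀ i, Measurable fun t : E => smoothExponent lam β t (z i) := fun i =>
      measurable_smoothExponent lam β measurable_id measurable_const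
    exact (Finset.measurable_fun_sum _ fun i _ => h2 i).sub (h1.const_mul _)
  have h := exp_integral_shift_le hm (√β • θ) (hi1.sub hi2)
  refine le_trans (le_of_eq ?_) h
  have e1 : ∫ t, ∑ i, smoothExponent lam β (t + √β • θ) (z i) ∂(stdGaussian E)
      = ∑ i, lam * (1 - (inner ℝ θ (z i)) ^ 2) := by
    rw [integral_finsetSum _ fun i _ => integrable_smoothExponent_shift lam β _ _]
    simp_rw [integral_smoothExponent_shift lam hβ]
  have e2 : ∫ t, logBound lam β Q (t + √β • θ) ∂(stdGaussian E)
      = ∫ w, meanExpBound lam β θ w ∂Q := by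
    unfold logBound
    rw [integral_integral_swap hp]
    simp_rw [integral_expBound_shift lam hβ]
  have e3 : ‖√β • θ‖ ^ 2 = β := by
    rw [norm_smul, mul_pow, hθ, Real.norm_eq_abs, sq_abs, Real.sq_sqrt hβ.le]; ring
  rw [integral_sub hi1 hi2, integral_const_mul, e1, e2, e3]

end PacBayes

end LeastSquares

end

noncomputable section

namespace LeastSquares

/-! ### Moments of a whitened law. -/

section Moments

variable {d : ℕ} {Q : Measure (EuclideanSpace ℝ (Fin d))} {κ : ℝ}

/-- A law whose second moments are at most those of an isotropic law and whose fourth moments are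
controlled by `κ`. -/
structure HasMoments (Q : Measure (EuclideanSpace ℝ (Fin d))) (κ : ℝ) : Prop where
  integrable_sq : ∀ θ, Integrable (fun w => inner ℝ θ w ^ 2) Q
  integral_sq_le : ∀ θ, ∫ w, inner ℝ θ w ^ 2 ∂Q ≤ ‖θ‖ ^ 2
  integrable_four : ∀ θ, Integrable (fun w => inner ℝ θ w ^ 4) Q
  integral_four_le : ∀ θ, ∫ w, inner ℝ θ w ^ 4 ∂Q ≤ κ * ‖θ‖ ^ 4

theorem norm_sq_eq_sum_inner (w : EuclideanSpace ℝ (Fin d)) :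
    ‖w‖ ^ 2 = ∑ j, inner ℝ (EuclideanSpace.single j (1 : ℝ)) w ^ 2 := by
  rw [EuclideanSpace.real_norm_sq_eq]
  simp [EuclideanSpace.inner_single_left]

theorem norm_four_le_sum_inner (w : EuclideanSpace ℝ (Fin d)) :
    ‖w‖ ^ 4 ≤ d * ∑ j, inner ℝ (EuclideanSpace.single j (1 : ℝ)) w ^ 4 := by
  have h := sq_sum_le_card_mul_sum_sq (s := Finset.univ)
    (f := fun j : Fin d => inner ℝ (EuclideanSpace.single j (1 : ℝ)) w ^ 2)
  rw [← norm_sq_eq_sum_inner] at h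
  simp only [← pow_mul, Finset.card_univ, Fintype.card_fin] at h
  simpa using h

theorem inner_sq_mul_norm_sq_le_sum (θ w : EuclideanSpace ℝ (Fin d)) :
    inner ℝ θ w ^ 2 * ‖w‖ ^ 2
      ≤ ∑ j, (inner ℝ θ w ^ 4 / 2 + inner ℝ (EuclideanSpace.single j (1 : ℝ)) w ^ 4 / 2) := by
  rw [norm_sq_eq_sum_inner, Finset.mul_sum]
  gcongr with j
  nlinarith [sq_nonneg (inner ℝ θ w ^ 2 - inner ℝ (EuclideanSpace.single j (1 : ℝ)) w ^ 2)]

variable (h : HasMoments Q κ)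
include h

theorem HasMoments.integrable_norm_sq : Integrable (fun w => ‖w‖ ^ 2) Q := by
  simp_rw [norm_sq_eq_sum_inner]
  exact integrable_finsetSum _ fun j _ => h.integrable_sq _

theorem HasMoments.integral_norm_sq_le : ∫ w, ‖w‖ ^ 2 ∂Q ≤ d := by
  simp_rw [norm_sq_eq_sum_inner]
  rw [integral_finsetSum _ fun j _ => h.integrable_sq _]
  calc _ ≤ ∑ j : Fin d, ‖EuclideanSpace.single j (1 : ℝ)‖ ^ 2 := by
        gcongr with j; exact h.integral_sq_le _
    _ = d := by simp

theorem HasMoments.integrable_norm_four : Integrable (fun w => ‖w‖ ^ 4) Q := by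
  refine ((integrable_finsetSum Finset.univ fun (j : Fin d) _ =>
    h.integrable_four (EuclideanSpace.single j (1 : ℝ))).const_mul (d : ℝ)).mono'
      (by fun_prop) ?_
  filter_upwards with w
  rw [Real.norm_of_nonneg (by positivity)]
  exact norm_four_le_sum_inner w

/-- Cauchy-Schwarz over the d coordinates, each of fourth moment at most κ. -/
theorem HasMoments.integral_norm_four_le : ∫ w, ‖w‖ ^ 4 ∂Q ≤ κ * d ^ 2 := by
  have hs := integrable_finsetSum Finset.univ fun (j : Fin d) _ =>
    h.integrable_four (EuclideanSpace.single j (1 : ℝ))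
  calc ∫ w, ‖w‖ ^ 4 ∂Q
      ≤ ∫ w, d * ∑ j, inner ℝ (EuclideanSpace.single j (1 : ℝ)) w ^ 4 ∂Q :=
        integral_mono h.integrable_norm_four (hs.const_mul _) norm_four_le_sum_inner
    _ = d * ∑ j : Fin d, ∫ w, inner ℝ (EuclideanSpace.single j (1 : ℝ)) w ^ 4 ∂Q := by
        rw [integral_const_mul, integral_finsetSum _ fun j _ => h.integrable_four _]
    _ ≤ d * ∑ _j : Fin d, κ := by
        gcongr with j
        simpa using h.integral_four_le (EuclideanSpace.single j (1 : ℝ))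
    _ = κ * d ^ 2 := by simp; ring

theorem HasMoments.integrable_inner_sq_mul_norm_sq (θ : EuclideanSpace ℝ (Fin d)) :
    Integrable (fun w => inner ℝ θ w ^ 2 * ‖w‖ ^ 2) Q := by
  refine (integrable_finsetSum Finset.univ fun (j : Fin d) _ =>
    ((h.integrable_four θ).div_const 2).add
      ((h.integrable_four (EuclideanSpace.single j (1 : ℝ))).div_const 2)).mono'
      (by fun_prop) ?_
  filter_upwards with w
  rw [Real.norm_of_nonneg (by positivity)]
  exact inner_sq_mul_norm_sq_le_sum θ w

theorem HasMoments.integral_inner_sq_mul_norm_sq_le {θ : EuclideanSpace ℝ (Fin d)}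
    (hθ : ‖θ‖ = 1) : ∫ w, inner ℝ θ w ^ 2 * ‖w‖ ^ 2 ∂Q ≤ κ * d := by
  have h1 : ∀ j : Fin d, Integrable (fun w => inner ℝ θ w ^ 4 / 2
      + inner ℝ (EuclideanSpace.single j (1 : ℝ)) w ^ 4 / 2) Q := fun j =>
    ((h.integrable_four θ).div_const 2).add ((h.integrable_four _).div_const 2)
  calc _ ≤ ∫ w, ∑ j, (inner ℝ θ w ^ 4 / 2
          + inner ℝ (EuclideanSpace.single j (1 : ℝ)) w ^ 4 / 2) ∂Q :=
        integral_mono (h.integrable_inner_sq_mul_norm_sq θ)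
          (integrable_finsetSum _ fun j _ => h1 j) (inner_sq_mul_norm_sq_le_sum θ)
    _ = ∑ j : Fin d, ((∫ w, inner ℝ θ w ^ 4 ∂Q) / 2
          + (∫ w, inner ℝ (EuclideanSpace.single j (1 : ℝ)) w ^ 4 ∂Q) / 2) := by
        rw [integral_finsetSum _ fun j _ => h1 j]
        congr 1
        ext j
        rw [integral_add ((h.integrable_four θ).div_const 2) ((h.integrable_four _).div_const 2),
          integral_div, integral_div]
    _ ≤ ∑ _j : Fin d, (κ / 2 + κ / 2) := by
        gcongr with j
        · simpa [hθ] using h.integral_four_le θ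
        · simpa using h.integral_four_le (EuclideanSpace.single j (1 : ℝ))
    _ = κ * d := by simp; ring

end Moments

/-! ### Truncation and the tuned PAC-Bayesian bound. -/

section Truncation

variable {d : ℕ}

/-- Truncation outside of the ball of radius `B`. -/
def truncate (B : ℝ) (w : EuclideanSpace ℝ (Fin d)) : EuclideanSpace ℝ (Fin d) :=
  if ‖w‖ ≤ B then w else 0

theorem measurable_truncate (B : ℝ) :
    Measurable (truncate B : EuclideanSpace ℝ (Fin d) → EuclideanSpace ℝ (Fin d)) :=
  Measurable.ite (measurableSet_le measurable_norm measurable_const) measurable_id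
    measurable_const

theorem norm_truncate_le {B : ℝ} (hB : 0 ≤ B) (w : EuclideanSpace ℝ (Fin d)) :
    ‖truncate B w‖ ≤ B := by
  unfold truncate
  split_ifs with h
  · exact h
  · simpa using hB

theorem inner_truncate_sq_le (B : ℝ) (θ w : EuclideanSpace ℝ (Fin d)) :
    inner ℝ θ (truncate B w) ^ 2 ≤ inner ℝ θ w ^ 2 := by
  unfold truncate
  split_ifs with h
  · exact le_rfl
  · simp; positivity

/-- The pointwise upper bound of `meanExpBound lam β θ (truncate B w)`. -/
def truncBound (lam β B : ℝ) (θ w : EuclideanSpace ℝ (Fin d)) : ℝ :=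
  (lam + lam ^ 2 / 2 + lam ^ 3 / 4)
    + (-(lam + lam ^ 2)) * inner ℝ θ w ^ 2 + lam ^ 2 / 2 * inner ℝ θ w ^ 4
    + ((lam + lam ^ 2) / B ^ 2 + 2 * lam ^ 2 / β) * (inner ℝ θ w ^ 2 * ‖w‖ ^ 2)
    + 3 * lam ^ 3 / (4 * β) * ‖w‖ ^ 2
    + (lam ^ 2 + 3 * lam ^ 3 / 4 + lam ^ 2 / 16) / β ^ 2 * ‖w‖ ^ 4

/-- Inside the ball, the cubic power of lam ‖w‖²/β is reduced to a square by lam ‖w‖²/β ≤ 1/4,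
whence the coefficient lam²/16. Outside, truncation loses the negative term -(lam + lam²) ⟪θ, w⟫²,
which is compensated by the term carrying ‖w‖²/B² ≥ 1. -/
theorem meanExpBound_truncate_le {lam β B : ℝ} (hl : 0 < lam) (hβ : 0 < β) (hB0 : 0 < B)
    (hB : lam * B ^ 2 ≤ β / 4) (θ w : EuclideanSpace ℝ (Fin d)) :
    meanExpBound lam β θ (truncate B w) ≤ truncBound lam β B θ w := by
  unfold truncate
  split_ifs with hw
  · have hτ : lam * (‖w‖ ^ 2 / β) ≤ 1 / 4 := by
      rw [← mul_div_assoc, div_le_iff₀ hβ]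
      have : lam * ‖w‖ ^ 2 ≤ lam * B ^ 2 := by gcongr
      linarith
    have h1 : 0 ≤ (lam + lam ^ 2) / B ^ 2 * (inner ℝ θ w ^ 2 * ‖w‖ ^ 2) := by positivity
    have h2 : lam * (‖w‖ ^ 2 / β) * (lam * (‖w‖ ^ 2 / β)) ^ 2 ≤ 1 / 4 * (lam * (‖w‖ ^ 2 / β)) ^ 2 := by
      gcongr
    have e : truncBound lam β B θ w - meanExpBound lam β θ w
        = (lam + lam ^ 2) / B ^ 2 * (inner ℝ θ w ^ 2 * ‖w‖ ^ 2)
          + (1 / 4 * (lam * (‖w‖ ^ 2 / β)) ^ 2 - lam * (‖w‖ ^ 2 / β) * (lam * (‖w‖ ^ 2 / β)) ^ 2)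
            / 4 := by
      unfold truncBound meanExpBound; ring
    linarith
  · push Not at hw
    have h1 : 1 ≤ ‖w‖ ^ 2 / B ^ 2 := by
      rw [le_div_iff₀ (by positivity)]
      nlinarith
    have h2 : (lam + lam ^ 2) * inner ℝ θ w ^ 2 * 1
        ≤ (lam + lam ^ 2) * inner ℝ θ w ^ 2 * (‖w‖ ^ 2 / B ^ 2) := by gcongr
    have e : truncBound lam β B θ w - meanExpBound lam β θ (0 : EuclideanSpace ℝ (Fin d))
        = ((lam + lam ^ 2) * inner ℝ θ w ^ 2 * (‖w‖ ^ 2 / B ^ 2)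
            - (lam + lam ^ 2) * inner ℝ θ w ^ 2 * 1) + lam ^ 2 / 2 * inner ℝ θ w ^ 4
          + 2 * lam ^ 2 / β * (inner ℝ θ w ^ 2 * ‖w‖ ^ 2)
          + 3 * lam ^ 3 / (4 * β) * ‖w‖ ^ 2
          + (lam ^ 2 + 3 * lam ^ 3 / 4 + lam ^ 2 / 16) / β ^ 2 * ‖w‖ ^ 4 := by
      unfold truncBound meanExpBound; simp; ring
    have h3 : 0 ≤ lam ^ 2 / 2 * inner ℝ θ w ^ 4
          + 2 * lam ^ 2 / β * (inner ℝ θ w ^ 2 * ‖w‖ ^ 2)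
          + 3 * lam ^ 3 / (4 * β) * ‖w‖ ^ 2
          + (lam ^ 2 + 3 * lam ^ 3 / 4 + lam ^ 2 / 16) / β ^ 2 * ‖w‖ ^ 4 := by positivity
    linarith

variable {Q : Measure (EuclideanSpace ℝ (Fin d))} {κ : ℝ}

theorem HasMoments.integrable_truncBound [IsProbabilityMeasure Q] (h : HasMoments Q κ)
    (lam β B : ℝ) (θ : EuclideanSpace ℝ (Fin d)) :
    Integrable (fun w => truncBound lam β B θ w) Q := by
  unfold truncBound
  exact ((((((integrable_const _).add ((h.integrable_sq θ).const_mul _)).add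
    ((h.integrable_four θ).const_mul _)).add
    ((h.integrable_inner_sq_mul_norm_sq θ).const_mul _)).add
    (h.integrable_norm_sq.const_mul _)).add (h.integrable_norm_four.const_mul _))

theorem HasMoments.integral_truncBound_le [IsProbabilityMeasure Q] (h : HasMoments Q κ)
    {lam β : ℝ} (hl : 0 < lam) (hβ : 0 < β) (B : ℝ) {θ : EuclideanSpace ℝ (Fin d)}
    (hθ : ‖θ‖ = 1) (hθ2 : ∫ w, inner ℝ θ w ^ 2 ∂Q = 1) :
    ∫ w, truncBound lam β B θ w ∂Q
      ≤ lam ^ 2 / 2 * (κ - 1) + lam ^ 3 / 4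
        + ((lam + lam ^ 2) / B ^ 2 + 2 * lam ^ 2 / β) * (κ * d)
        + 3 * lam ^ 3 / (4 * β) * d
        + (lam ^ 2 + 3 * lam ^ 3 / 4 + lam ^ 2 / 16) / β ^ 2 * (κ * d ^ 2) := by
  have i0 : Integrable (fun _ : EuclideanSpace ℝ (Fin d) => lam + lam ^ 2 / 2 + lam ^ 3 / 4) Q :=
    integrable_const _
  have i1 := (h.integrable_sq θ).const_mul (-(lam + lam ^ 2))
  have i2 := (h.integrable_four θ).const_mul (lam ^ 2 / 2)
  have i3 := (h.integrable_inner_sq_mul_norm_sq θ).const_mul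
    ((lam + lam ^ 2) / B ^ 2 + 2 * lam ^ 2 / β)
  have i4 := h.integrable_norm_sq.const_mul (3 * lam ^ 3 / (4 * β))
  have i5 := h.integrable_norm_four.const_mul
    ((lam ^ 2 + 3 * lam ^ 3 / 4 + lam ^ 2 / 16) / β ^ 2)
  unfold truncBound
  rw [integral_add ((((i0.fun_add i1).fun_add i2).fun_add i3).fun_add i4) i5,
    integral_add (((i0.fun_add i1).fun_add i2).fun_add i3) i4,
    integral_add ((i0.fun_add i1).fun_add i2) i3,
    integral_add (i0.fun_add i1) i2, integral_add i0 i1]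
  simp only [integral_const_mul, hθ2]
  have j2 : ∫ w, inner ℝ θ w ^ 4 ∂Q ≤ κ := by simpa [hθ] using h.integral_four_le θ
  have j3 := h.integral_inner_sq_mul_norm_sq_le hθ
  have j4 := h.integral_norm_sq_le
  have j5 := h.integral_norm_four_le
  have k2 : lam ^ 2 / 2 * ∫ w, inner ℝ θ w ^ 4 ∂Q ≤ lam ^ 2 / 2 * κ := by gcongr
  have k3 : ((lam + lam ^ 2) / B ^ 2 + 2 * lam ^ 2 / β) * ∫ w, inner ℝ θ w ^ 2 * ‖w‖ ^ 2 ∂Q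
    ≤ ((lam + lam ^ 2) / B ^ 2 + 2 * lam ^ 2 / β) * (κ * d) := by gcongr
  have k4 : 3 * lam ^ 3 / (4 * β) * ∫ w, ‖w‖ ^ 2 ∂Q ≤ 3 * lam ^ 3 / (4 * β) * d := by gcongr
  have k5 : (lam ^ 2 + 3 * lam ^ 3 / 4 + lam ^ 2 / 16) / β ^ 2 * ∫ w, ‖w‖ ^ 4 ∂Q
    ≤ (lam ^ 2 + 3 * lam ^ 3 / 4 + lam ^ 2 / 16) / β ^ 2 * (κ * d ^ 2) := by gcongr
  simp only [integral_const, probReal_univ, smul_eq_mul, one_mul]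
  linarith

/-- The PAC-Bayesian lower bound for the smallest eigenvalue of the empirical Gram matrix: the
random variable `V` has mean at most one. -/
theorem HasMoments.exists_evidence [IsProbabilityMeasure Q] (h : HasMoments Q κ) (hκ : 1 ≤ κ)
    (hd : 0 < d) {n : ℕ} (hn : 0 < n) {lam : ℝ} (hl : 0 < lam) (hl1 : lam ≤ 1)
    {Ω : Type*} [MeasurableSpace Ω] {P : Measure Ω} [IsProbabilityMeasure P]
    {W : Fin n → Ω → EuclideanSpace ℝ (Fin d)} (hW : ∀ i, Measurable (W i))
    (hind : iIndepFun W P) (hlaw : ∀ i, P.map (W i) = Q) :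
    ∃ V : (Fin n → EuclideanSpace ℝ (Fin d)) → ℝ≥0∞, Measurable V ∧
      ∫⁻ ω, V (fun i => W i ω) ∂P ≤ 1 ∧
      ∀ z θ, ‖θ‖ = 1 → ∫ w, inner ℝ θ w ^ 2 ∂Q = 1 →
        ENNReal.ofReal (Real.exp (n * lam * (1 - (∑ i, inner ℝ θ (z i) ^ 2) / n
          - lam * (κ - 1) / 2 - lam ^ 2 / 4 - 6.4 * √(κ * d / n)) - 0.73 * d)) ≤ V z := by
  set a := √(κ * d / n)
  have hn' : (0 : ℝ) < n := by exact_mod_cast hn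
  have hd' : (0 : ℝ) < d := by exact_mod_cast hd
  have hκ0 : 0 < κ := by linarith
  have ha : 0 < a := by positivity
  have ha2 : κ * d = n * a ^ 2 := by
    rw [Real.sq_sqrt (by positivity)]; field_simp
  -- This β equates the entropy cost β/2 with the fluctuation term n · 2 lam² κ d / β; both are n
  -- lam a. The radius B chosen next is the largest one with lam B² ≤ β/4.
  set β := 2 * lam * n * a with hβdef
  have hβ : 0 < β := by positivity
  set B := √(n * a / 2)
  have hB0 : 0 < B := by positivity
  have hB2 : B ^ 2 = n * a / 2 := Real.sq_sqrt (by positivity)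
  have hB : lam * B ^ 2 ≤ β / 4 := by rw [hB2, hβdef]; linarith
  have hQ' : IsProbabilityMeasure (Q.map (truncate B)) :=
    Measure.isProbabilityMeasure_map (measurable_truncate B).aemeasurable
  have hQB : ∀ᵐ w ∂(Q.map (truncate B)), ‖w‖ ≤ B := by
    rw [ae_map_iff (measurable_truncate B).aemeasurable
      (measurableSet_le measurable_norm measurable_const)]
    exact Filter.Eventually.of_forall (norm_truncate_le hB0.le)
  refine ⟨fun z => evidence lam β (Q.map (truncate B)) fun i => truncate B (z i), ?_, ?_, ?_⟩
  · exact (measurable_evidence lam β _ n).comp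
      (measurable_pi_lambda _ fun i => (measurable_truncate B).comp (measurable_pi_apply i))
  · refine lintegral_evidence_le_one hl hl1 hβ hB hQB (Z := fun i ω => truncate B (W i ω))
      (fun i => (measurable_truncate B).comp (hW i))
      (hind.comp _ fun _ => measurable_truncate B) fun i => ?_
    rw [← hlaw i, Measure.map_map (measurable_truncate B) (hW i)]
    rfl
  · intro z θ hθ hθ2
    refine le_trans ?_ (le_evidence hl hβ hQB _ hθ)
    apply ENNReal.ofReal_le_ofReal
    apply Real.exp_le_exp.2
    have h1 : ∫ w, meanExpBound lam β θ w ∂(Q.map (truncate B))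
        ≤ ∫ w, truncBound lam β B θ w ∂Q := by
      have hm : Measurable fun w => meanExpBound lam β θ w := by
        unfold meanExpBound; fun_prop
      rw [integral_map (measurable_truncate B).aemeasurable hm.aestronglyMeasurable]
      have hi := (integrable_expBound_prod hl hβ hQB (√β • θ)).integral_prod_right
      simp only [integral_expBound_shift lam hβ] at hi
      exact integral_mono (hi.comp_measurable (measurable_truncate B))
        (h.integrable_truncBound _ _ _ _) (meanExpBound_truncate_le hl hβ hB0 hB θ)
    have h2 := h1.trans (h.integral_truncBound_le hl hβ B hθ hθ2)
    have h3 : ∑ i, lam * (1 - inner ℝ θ (z i) ^ 2)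
        ≤ ∑ i, lam * (1 - inner ℝ θ (truncate B (z i)) ^ 2) := by
      refine Finset.sum_le_sum fun i _ => mul_le_mul_of_nonneg_left ?_ hl.le
      have := inner_truncate_sq_le B θ (z i)
      linarith
    have h4 : ∑ i, lam * (1 - inner ℝ θ (z i) ^ 2)
        = n * lam * (1 - (∑ i, inner ℝ θ (z i) ^ 2) / n) := by
      rw [← Finset.mul_sum, Finset.sum_sub_distrib]
      simp
      field_simp
    have h5 : lam ^ 2 / 2 * (κ - 1) + lam ^ 3 / 4
        + ((lam + lam ^ 2) / B ^ 2 + 2 * lam ^ 2 / β) * (κ * d)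
        + 3 * lam ^ 3 / (4 * β) * d
        + (lam ^ 2 + 3 * lam ^ 3 / 4 + lam ^ 2 / 16) / β ^ 2 * (κ * d ^ 2)
        ≤ lam ^ 2 / 2 * (κ - 1) + lam ^ 3 / 4 + 2 * a * (lam + lam ^ 2) + lam * a
          + 3 / 8 * lam ^ 2 * a + (1 / 4 + 3 / 16 * lam + 1 / 64) * (d / n) := by
      have e1 : ((lam + lam ^ 2) / B ^ 2 + 2 * lam ^ 2 / β) * (κ * d)
          = 2 * a * (lam + lam ^ 2) + lam * a := by
        rw [hB2, ha2, hβdef]; field_simp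
      have e2 : (lam ^ 2 + 3 * lam ^ 3 / 4 + lam ^ 2 / 16) / β ^ 2 * (κ * d ^ 2)
          = (1 / 4 + 3 / 16 * lam + 1 / 64) * (d / n) := by
        have : κ * d ^ 2 = n * a ^ 2 * d := by rw [← ha2]; ring
        rw [this, hβdef]; field_simp; ring
      have e3 : 3 * lam ^ 3 / (4 * β) * d ≤ 3 / 8 * lam ^ 2 * a := by
        have : (d : ℝ) ≤ n * a ^ 2 := by rw [← ha2]; nlinarith
        calc 3 * lam ^ 3 / (4 * β) * d ≤ 3 * lam ^ 3 / (4 * β) * (n * a ^ 2) := by gcongr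
          _ = _ := by rw [hβdef]; field_simp; ring
      linarith
    have h6 : n * ∫ w, meanExpBound lam β θ w ∂(Q.map (truncate B))
        ≤ n * (lam ^ 2 / 2 * (κ - 1) + lam ^ 3 / 4 + 2 * a * (lam + lam ^ 2) + lam * a
          + 3 / 8 * lam ^ 2 * a) + (1 / 4 + 3 / 16 * lam + 1 / 64) * d := by
      calc _ ≤ n * (lam ^ 2 / 2 * (κ - 1) + lam ^ 3 / 4 + 2 * a * (lam + lam ^ 2) + lam * a
          + 3 / 8 * lam ^ 2 * a + (1 / 4 + 3 / 16 * lam + 1 / 64) * (d / n)) := by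
            gcongr; exact h2.trans h5
        _ = _ := by field_simp
    have h7 : (1 / 4 + 3 / 16 * lam + 1 / 64) * (d : ℝ) ≤ 0.73 * d := by
      gcongr; norm_num; linarith
    -- The coefficient of n lam a on the left is 4 + 19/8 lam, which for lam ≤ 1 is at most 6.375,
    -- hence the constant 6.4.
    have h8 : n * (2 * a * (lam + lam ^ 2) + lam * a + 3 / 8 * lam ^ 2 * a) + β / 2
        ≤ n * lam * (6.4 * a) := by
      have : n * lam * (6.4 * a)
          - (n * (2 * a * (lam + lam ^ 2) + lam * a + 3 / 8 * lam ^ 2 * a) + β / 2)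
          = n * lam * a * (2.4 - 19 / 8 * lam) := by rw [hβdef]; ring
      have : 0 ≤ n * lam * a * (2.4 - 19 / 8 * lam) :=
        mul_nonneg (by positivity) (by linarith)
      linarith
    linarith

end Truncation

end LeastSquares

end

noncomputable section

namespace LeastSquares

/-! ### Whitening by a possibly singular Gram matrix. -/

section Whitening

variable {d : ℕ} {Ω₀ : Type*} [MeasurableSpace Ω₀] {P₀ : Measure Ω₀}
  {X : Ω₀ → EuclideanSpace ℝ (Fin d)}

/-- The operator `f(G)`, for the Gram matrix `G`. -/
def gramFun (P₀ : Measure Ω₀) (X : Ω₀ → EuclideanSpace ℝ (Fin d)) (f : ℝ → ℝ) :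
    EuclideanSpace ℝ (Fin d) →L[ℝ] EuclideanSpace ℝ (Fin d) :=
  Matrix.toEuclideanCLM (𝕜 := ℝ) ((gram_isHermitian P₀ X).cfc f)

theorem cfc_mul_cfc {A : Matrix (Fin d) (Fin d) ℝ} (hA : A.IsHermitian) (f g : ℝ → ℝ) :
    hA.cfc f * hA.cfc g = hA.cfc fun t => f t * g t := by
  unfold Matrix.IsHermitian.cfc
  rw [← map_mul, Matrix.diagonal_mul_diagonal]
  congr 2

theorem gramFun_gramFun (f g : ℝ → ℝ) (x : EuclideanSpace ℝ (Fin d)) :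
    gramFun P₀ X f (gramFun P₀ X g x) = gramFun P₀ X (fun t => f t * g t) x := by
  unfold gramFun
  rw [← cfc_mul_cfc, map_mul]
  rfl

theorem star_cfc {A : Matrix (Fin d) (Fin d) ℝ} (hA : A.IsHermitian) (f : ℝ → ℝ) :
    star (hA.cfc f) = hA.cfc f := by
  unfold Matrix.IsHermitian.cfc
  rw [← map_star, Matrix.star_eq_conjTranspose, Matrix.diagonal_conjTranspose]
  congr 2

theorem inner_gramFun_right (f : ℝ → ℝ) (u x : EuclideanSpace ℝ (Fin d)) :
    inner ℝ u (gramFun P₀ X f x) = inner ℝ (gramFun P₀ X f u) x := by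
  have h : star (gramFun P₀ X f) = gramFun P₀ X f := by
    unfold gramFun
    rw [← map_star, star_cfc]
  rw [ContinuousLinearMap.star_eq_adjoint] at h
  rw [← ContinuousLinearMap.adjoint_inner_left, h]

theorem gramFun_id : gramFun P₀ X (fun t => t) = Matrix.toEuclideanCLM (𝕜 := ℝ) (gram P₀ X) := by
  unfold gramFun
  congr 1
  conv_rhs => rw [(gram_isHermitian P₀ X).spectral_theorem]
  rfl

theorem integrable_inner_mul_inner (hX : MemLp X 2 P₀) (u v : EuclideanSpace ℝ (Fin d)) :
    Integrable (fun ω => inner ℝ u (X ω) * inner ℝ v (X ω)) P₀ :=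
  MemLp.integrable_mul (hX.const_inner u) (hX.const_inner v)

theorem integrable_inner_sq (hX : MemLp X 2 P₀) (u : EuclideanSpace ℝ (Fin d)) :
    Integrable (fun ω => inner ℝ u (X ω) ^ 2) P₀ := by
  simpa [sq] using integrable_inner_mul_inner hX u u

theorem integral_inner_mul_inner (hX : MemLp X 2 P₀) (u v : EuclideanSpace ℝ (Fin d)) :
    ∫ ω, inner ℝ u (X ω) * inner ℝ v (X ω) ∂P₀
      = inner ℝ u (gramFun P₀ X (fun t => t) v) := by
  have hi : ∀ i j, Integrable (fun ω => X ω i * X ω j) P₀ := fun i j => by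
    have := integrable_inner_mul_inner hX (EuclideanSpace.single i (1 : ℝ))
      (EuclideanSpace.single j (1 : ℝ))
    simpa [EuclideanSpace.inner_single_left] using this
  have e : ∀ ω, inner ℝ u (X ω) * inner ℝ v (X ω)
      = ∑ i, ∑ j, u i * v j * (X ω i * X ω j) := by
    intro ω
    simp only [PiLp.inner_apply, RCLike.inner_apply, conj_trivial, Finset.sum_mul_sum]
    congr 1; ext i; congr 1; ext j; ring
  simp_rw [e]
  rw [integral_finsetSum _ fun i _ => integrable_finsetSum _ fun j _ => (hi i j).const_mul _]
  simp_rw [integral_finsetSum _ fun j _ => (hi _ j).const_mul _, integral_const_mul]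
  rw [gramFun_id]
  simp only [PiLp.inner_apply, RCLike.inner_apply, conj_trivial, Matrix.ofLp_toEuclideanCLM,
    Matrix.mulVec, dotProduct, gram, Matrix.of_apply, Finset.sum_mul]
  congr 1; ext i; congr 1; ext j; ring

theorem integral_inner_sq (hX : MemLp X 2 P₀) (u : EuclideanSpace ℝ (Fin d)) :
    ∫ ω, inner ℝ u (X ω) ^ 2 ∂P₀ = inner ℝ u (gramFun P₀ X (fun t => t) u) := by
  simpa [sq] using integral_inner_mul_inner hX u u

theorem gram_eigenvalues_nonneg (hX : MemLp X 2 P₀) (i : Fin d) :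
    0 ≤ (gram_isHermitian P₀ X).eigenvalues i := by
  have hps : (gram P₀ X).PosSemidef := by
    rw [← Matrix.isPositive_toEuclideanLin_iff]
    refine ⟨(Matrix.isSymmetric_toEuclideanLin_iff).2 (gram_isHermitian P₀ X), fun u => ?_⟩
    have := integral_inner_sq hX u
    rw [gramFun_id] at this
    rw [← Matrix.coe_toEuclideanCLM_eq_toEuclideanLin]
    simp only [ContinuousLinearMap.coe_coe, RCLike.re_to_real]
    rw [real_inner_comm, ← this]
    positivity
  exact hps.eigenvalues_nonneg i

/-- Eigenvalues of G are nonnegative, so identities such as √t √t = t are only needed on [0, ∞). -/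
theorem gramFun_congr (hX : MemLp X 2 P₀) {f g : ℝ → ℝ} (h : ∀ t, 0 ≤ t → f t = g t) :
    gramFun P₀ X f = gramFun P₀ X g := by
  unfold gramFun Matrix.IsHermitian.cfc
  have : f ∘ (gram_isHermitian P₀ X).eigenvalues = g ∘ (gram_isHermitian P₀ X).eigenvalues := by
    ext i
    exact h _ (gram_eigenvalues_nonneg hX i)
  rw [this]

/-- The operator `G^{-1/2}`. -/
def whiten (P₀ : Measure Ω₀) (X : Ω₀ → EuclideanSpace ℝ (Fin d)) :
    EuclideanSpace ℝ (Fin d) →L[ℝ] EuclideanSpace ℝ (Fin d) :=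
  gramFun P₀ X fun t => if 0 < t then (√t)⁻¹ else 0

theorem whiten_apply (x : EuclideanSpace ℝ (Fin d)) :
    whiten P₀ X x = Matrix.toEuclideanLin (gramInvSqrt P₀ X) x := rfl

/-- The operator `G^{1/2}`. -/
def gramSqrt (P₀ : Measure Ω₀) (X : Ω₀ → EuclideanSpace ℝ (Fin d)) :
    EuclideanSpace ℝ (Fin d) →L[ℝ] EuclideanSpace ℝ (Fin d) :=
  gramFun P₀ X fun t => √t

theorem norm_gramSqrt_sq (hX : MemLp X 2 P₀) (u : EuclideanSpace ℝ (Fin d)) :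
    ‖gramSqrt P₀ X u‖ ^ 2 = ∫ ω, inner ℝ u (X ω) ^ 2 ∂P₀ := by
  rw [integral_inner_sq hX, ← real_inner_self_eq_norm_sq]
  unfold gramSqrt
  rw [← inner_gramFun_right, gramFun_gramFun]
  rw [gramFun_congr hX fun t ht => Real.mul_self_sqrt ht]

/-- When G is singular the whitened law is isotropic only on the range of G: its covariance is the
orthogonal projection 1(G > 0). -/
theorem integral_inner_whiten_sq (hX : MemLp X 2 P₀) (u : EuclideanSpace ℝ (Fin d)) :
    ∫ ω, inner ℝ u (whiten P₀ X (X ω)) ^ 2 ∂P₀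
      = ‖gramFun P₀ X (fun t => if 0 < t then 1 else 0) u‖ ^ 2 := by
  simp_rw [whiten, inner_gramFun_right]
  rw [← norm_gramSqrt_sq hX]
  unfold gramSqrt
  rw [gramFun_gramFun, gramFun_congr hX (g := fun t => if 0 < t then 1 else 0)]
  intro t ht
  split_ifs with h
  · exact mul_inv_cancel₀ (Real.sqrt_pos.2 h).ne'
  · simp

/-- The operator 1(G > 0) is self-adjoint and idempotent, hence ‖p‖² = ⟪u, p⟫, and Cauchy-Schwarz
concludes. -/
theorem norm_gramFun_indicator_le (u : EuclideanSpace ℝ (Fin d)) :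
    ‖gramFun P₀ X (fun t => if 0 < t then 1 else 0) u‖ ≤ ‖u‖ := by
  set p := gramFun P₀ X (fun t => if 0 < t then 1 else 0) u with hp
  have h : ‖p‖ ^ 2 = inner ℝ u p := by
    rw [← real_inner_self_eq_norm_sq]
    nth_rw 1 [hp]
    have e : (fun t : ℝ => (if 0 < t then (1 : ℝ) else 0) * if 0 < t then (1 : ℝ) else 0)
        = fun t => if 0 < t then 1 else 0 := by
      funext t; split_ifs <;> simp
    rw [← inner_gramFun_right, hp, gramFun_gramFun, e]
  have h2 := real_inner_le_norm u p
  rw [← h] at h2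
  by_contra hc
  push Not at hc
  nlinarith [norm_nonneg u, norm_nonneg p]

theorem integral_inner_whiten_sq_le (hX : MemLp X 2 P₀) (u : EuclideanSpace ℝ (Fin d)) :
    ∫ ω, inner ℝ u (whiten P₀ X (X ω)) ^ 2 ∂P₀ ≤ ‖u‖ ^ 2 := by
  rw [integral_inner_whiten_sq hX]
  exact pow_le_pow_left₀ (norm_nonneg _) (norm_gramFun_indicator_le u) 2

theorem integral_inner_whiten_sq_gramSqrt (hX : MemLp X 2 P₀) (u : EuclideanSpace ℝ (Fin d)) :
    ∫ ω, inner ℝ (gramSqrt P₀ X u) (whiten P₀ X (X ω)) ^ 2 ∂P₀ = ‖gramSqrt P₀ X u‖ ^ 2 := by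
  rw [integral_inner_whiten_sq hX]
  unfold gramSqrt
  rw [gramFun_gramFun, gramFun_congr hX]
  intro t ht
  split_ifs with h
  · simp
  · rw [le_antisymm (not_lt.1 h) ht]; simp

/-- Almost surely, `X` lies in the range of the Gram matrix. -/
theorem ae_inner_gramSqrt_whiten (hX : MemLp X 2 P₀) :
    ∀ᵐ ω ∂P₀, ∀ u, inner ℝ (gramSqrt P₀ X u) (whiten P₀ X (X ω)) = inner ℝ u (X ω) := by
  -- The second moment of X along a vector of the kernel of G is zero.
  have h1 : ∀ u, ∀ᵐ ω ∂P₀, inner ℝ (gramFun P₀ X (fun t => 1 - if 0 < t then 1 else 0) u) (X ω)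
      = 0 := by
    intro u
    have h0 := integral_inner_sq hX (gramFun P₀ X (fun t => 1 - if 0 < t then 1 else 0) u)
    have hz : gramFun P₀ X (fun t => t * (1 - if 0 < t then 1 else 0)) = 0 := by
      rw [gramFun_congr hX (g := fun _ => (0 : ℝ))]
      · unfold gramFun Matrix.IsHermitian.cfc
        simp [Function.comp_def]
      · intro t ht
        split_ifs with h
        · simp
        · simp [le_antisymm (not_lt.1 h) ht]
    rw [gramFun_gramFun, hz, _root_.zero_apply, inner_zero_right,
      integral_eq_zero_iff_of_nonneg (fun _ => sq_nonneg _) (integrable_inner_sq hX _)] at h0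
    filter_upwards [h0] with ω hω
    simpa using hω
  -- Restricting to the canonical basis keeps a single null set for all u.
  have h2 : ∀ᵐ ω ∂P₀, ∀ j : Fin d, inner ℝ (gramFun P₀ X (fun t => 1 - if 0 < t then 1 else 0)
      (EuclideanSpace.single j (1 : ℝ))) (X ω) = 0 := ae_all_iff.2 fun j => h1 _
  filter_upwards [h2] with ω hω u
  have h3 : gramFun P₀ X (fun t => 1 - if 0 < t then 1 else 0) (X ω) = 0 := by
    ext j
    have := hω j
    rw [← inner_gramFun_right, EuclideanSpace.inner_single_left] at this
    simpa using this
  have h4 : gramFun P₀ X (fun t => 1 - if 0 < t then 1 else 0) (X ω)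
      = X ω - gramFun P₀ X (fun t => if 0 < t then 1 else 0) (X ω) := by
    unfold gramFun
    have : (gram_isHermitian P₀ X).cfc (fun t => 1 - if 0 < t then (1 : ℝ) else 0)
        = 1 - (gram_isHermitian P₀ X).cfc (fun t => if 0 < t then 1 else 0) := by
      unfold Matrix.IsHermitian.cfc
      rw [← map_one (Unitary.conjStarAlgAut ℝ _ (gram_isHermitian P₀ X).eigenvectorUnitary),
        ← map_sub, ← Matrix.diagonal_one, Matrix.diagonal_sub]
      congr 2
    rw [this, map_sub, map_one]
    rfl
  rw [h4, sub_eq_zero] at h3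
  unfold gramSqrt whiten
  rw [← inner_gramFun_right, gramFun_gramFun]
  conv_rhs => rw [h3]
  rw [gramFun_congr hX]
  intro t ht
  split_ifs with h
  · exact mul_inv_cancel₀ (Real.sqrt_pos.2 h).ne'
  · simp

end Whitening

/-! ### Consequences of a finite kurtosis coefficient. -/

section Kurtosis

variable {d : ℕ} {Ω₀ : Type*} [MeasurableSpace Ω₀] {P₀ : Measure Ω₀}
  {X : Ω₀ → EuclideanSpace ℝ (Fin d)}

/-- Homogeneity: θ is rescaled to second moment one. If its second moment is 0, then ⟪θ, X⟫ vanishes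
almost surely and both sides are 0. -/
theorem integrable_and_integral_four_le_kurtosis (hX : MemLp X 2 P₀) (hk : kurtosis P₀ X < ⊤)
    (θ : EuclideanSpace ℝ (Fin d)) :
    Integrable (fun ω => inner ℝ θ (X ω) ^ 4) P₀ ∧
      ∫ ω, inner ℝ θ (X ω) ^ 4 ∂P₀
        ≤ (kurtosis P₀ X).toReal * (∫ ω, inner ℝ θ (X ω) ^ 2 ∂P₀) ^ 2 := by
  have hm : ∀ u, AEStronglyMeasurable (fun ω => inner ℝ u (X ω)) P₀ :=
    fun u => (hX.const_inner u).1
  have hunit : ∀ u : EuclideanSpace ℝ (Fin d), ∫ ω, inner ℝ u (X ω) ^ 2 ∂P₀ ≤ 1 →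
      Integrable (fun ω => inner ℝ u (X ω) ^ 4) P₀ ∧
        ∫ ω, inner ℝ u (X ω) ^ 4 ∂P₀ ≤ (kurtosis P₀ X).toReal := by
    intro u hu
    have h1 : ∫⁻ ω, ENNReal.ofReal (inner ℝ u (X ω) ^ 2) ∂P₀ ≤ 1 := by
      rw [← ofReal_integral_eq_lintegral_ofReal (integrable_inner_sq hX u)
        (Filter.Eventually.of_forall fun _ => sq_nonneg _)]
      simpa using hu
    have h2 : ∫⁻ ω, ENNReal.ofReal (inner ℝ u (X ω) ^ 4) ∂P₀ ≤ kurtosis P₀ X :=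
      le_iSup₂_of_le (f := fun (θ : EuclideanSpace ℝ (Fin d))
        (_ : ∫⁻ ω, ENNReal.ofReal ((inner ℝ θ (X ω)) ^ 2) ∂P₀ ≤ 1) =>
          ∫⁻ ω, ENNReal.ofReal ((inner ℝ θ (X ω)) ^ 4) ∂P₀) u h1 le_rfl
    have hnn : 0 ≤ᵐ[P₀] fun ω => inner ℝ u (X ω) ^ 4 :=
      Filter.Eventually.of_forall fun _ => by positivity
    have hi : Integrable (fun ω => inner ℝ u (X ω) ^ 4) P₀ := by
      refine ⟨(hm u).pow 4, ?_⟩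
      rw [hasFiniteIntegral_iff_ofReal hnn]
      exact h2.trans_lt hk
    refine ⟨hi, ?_⟩
    rw [integral_eq_lintegral_of_nonneg_ae hnn hi.1]
    exact ENNReal.toReal_mono hk.ne h2
  set s := ∫ ω, inner ℝ θ (X ω) ^ 2 ∂P₀ with hs
  have hs0 : 0 ≤ s := integral_nonneg fun _ => sq_nonneg _
  rcases hs0.eq_or_lt with h0 | hpos
  · have h1 := h0.symm
    rw [hs, integral_eq_zero_iff_of_nonneg (fun _ => sq_nonneg _) (integrable_inner_sq hX _)] at h1
    have h2 : (fun ω => inner ℝ θ (X ω) ^ 4) =ᵐ[P₀] fun _ => (0 : ℝ) := by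
      filter_upwards [h1] with ω hω
      have : inner ℝ θ (X ω) = 0 := by simpa using hω
      simp [this]
    refine ⟨(integrable_zero _ _ _).congr h2.symm, ?_⟩
    rw [integral_congr_ae h2, ← h0]
    simp
  · have hu := hunit ((√s)⁻¹ • θ) (by
      simp_rw [real_inner_smul_left, mul_pow]
      rw [integral_const_mul, inv_pow, Real.sq_sqrt hs0, ← hs, inv_mul_cancel₀ hpos.ne'])
    have e4 : √s ^ 4 = s ^ 2 := by
      calc √s ^ 4 = (√s ^ 2) ^ 2 := by ring
        _ = s ^ 2 := by rw [Real.sq_sqrt hs0]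
    have e : ∀ ω, inner ℝ ((√s)⁻¹ • θ) (X ω) ^ 4 = (s ^ 2)⁻¹ * inner ℝ θ (X ω) ^ 4 := by
      intro ω
      rw [real_inner_smul_left, mul_pow, inv_pow, e4]
    simp_rw [e] at hu
    have hc : (s ^ 2)⁻¹ ≠ 0 := by positivity
    refine ⟨(integrable_const_mul_iff hc.isUnit _).1 hu.1, ?_⟩
    have h2 := hu.2
    rw [integral_const_mul, inv_mul_le_iff₀ (by positivity)] at h2
    linarith

/-- The variance of ⟪θ, X⟫² is nonnegative. -/
theorem one_le_kurtosis [IsProbabilityMeasure P₀] (hX : MemLp X 2 P₀) (hk : kurtosis P₀ X < ⊤)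
    {θ : EuclideanSpace ℝ (Fin d)} (hθ : ∫ ω, inner ℝ θ (X ω) ^ 2 ∂P₀ ≠ 0) :
    1 ≤ (kurtosis P₀ X).toReal := by
  obtain ⟨hi, hle⟩ := integrable_and_integral_four_le_kurtosis hX hk θ
  have i2 := integrable_inner_sq hX θ
  set s := ∫ ω, inner ℝ θ (X ω) ^ 2 ∂P₀ with hs
  have h1 : 0 ≤ ∫ ω, (s ^ 2 + (-2 * s) * inner ℝ θ (X ω) ^ 2 + 1 * inner ℝ θ (X ω) ^ 4) ∂P₀ :=
    integral_nonneg fun ω => by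
      have := sq_nonneg (inner ℝ θ (X ω) ^ 2 - s)
      simp only [Pi.zero_apply]
      linarith
  rw [integral_affine i2 hi, ← hs] at h1
  have h2 : 0 < s ^ 2 := by positivity
  by_contra hc
  push Not at hc
  nlinarith

theorem hasMoments_whiten (hX : MemLp X 2 P₀) (hk : kurtosis P₀ X < ⊤) {κ : ℝ}
    (hκ : (kurtosis P₀ X).toReal ≤ κ) :
    HasMoments (P₀.map fun ω => whiten P₀ X (X ω)) κ := by
  have hm : AEMeasurable (fun ω => whiten P₀ X (X ω)) P₀ :=
    (whiten P₀ X).continuous.measurable.comp_aemeasurable hX.1.aemeasurable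
  have hin : ∀ θ k, AEStronglyMeasurable (fun w => inner ℝ θ w ^ k)
      (P₀.map fun ω => whiten P₀ X (X ω)) := fun θ k => by fun_prop
  have hw : ∀ θ ω, inner ℝ θ (whiten P₀ X (X ω)) = inner ℝ (whiten P₀ X θ) (X ω) :=
    fun θ ω => inner_gramFun_right _ _ _
  refine ⟨fun θ => ?_, fun θ => ?_, fun θ => ?_, fun θ => ?_⟩
  · rw [integrable_map_measure (hin θ 2) hm]
    simpa [Function.comp_def, hw] using integrable_inner_sq hX (whiten P₀ X θ)
  · rw [integral_map hm (hin θ 2)]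
    exact integral_inner_whiten_sq_le hX θ
  · rw [integrable_map_measure (hin θ 4) hm]
    simpa [Function.comp_def, hw] using
      (integrable_and_integral_four_le_kurtosis hX hk (whiten P₀ X θ)).1
  · rw [integral_map hm (hin θ 4)]
    have h1 := (integrable_and_integral_four_le_kurtosis hX hk (whiten P₀ X θ)).2
    have h2 := integral_inner_whiten_sq_le hX θ
    simp_rw [hw] at h2 ⊢
    refine h1.trans ?_
    have h3 : 0 ≤ ∫ ω, inner ℝ (whiten P₀ X θ) (X ω) ^ 2 ∂P₀ := integral_nonneg fun _ => sq_nonneg _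
    calc _ ≤ κ * (‖θ‖ ^ 2) ^ 2 := by
          gcongr
          exact ENNReal.toReal_nonneg.trans hκ
      _ = _ := by ring

end Kurtosis

end LeastSquares

end

/-! ### Excess risk, normal equations and the score. -/

noncomputable section

namespace LeastSquares

/-- First-order condition for a quadratic minimized at t = 0, shared by the population and the
empirical problems. Evaluating at t = b / (|c| + 1) avoids any hypothesis on c. -/
theorem eq_zero_of_forall_le_quadratic {a b c : ℝ} (h : ∀ t : ℝ, a ≤ a - 2 * t * b + t ^ 2 * c) :
    b = 0 := by
  have hc : c ≤ |c| := le_abs_self c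
  have hc0 : 0 ≤ |c| := abs_nonneg c
  have h1 := h (b / (|c| + 1))
  have e : a - 2 * (b / (|c| + 1)) * b + (b / (|c| + 1)) ^ 2 * c
      = a - b ^ 2 * (2 * (|c| + 1) - c) / (|c| + 1) ^ 2 := by
    field_simp
    ring
  rw [e] at h1
  have h2 : b ^ 2 * (2 * (|c| + 1) - c) / (|c| + 1) ^ 2 ≤ 0 := by linarith
  rw [div_le_iff₀ (by positivity), zero_mul] at h2
  have h3 : b ^ 2 * 1 ≤ b ^ 2 * (2 * (|c| + 1) - c) := by gcongr; linarith
  have h4 : b ^ 2 = 0 := le_antisymm (by linarith) (sq_nonneg _)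
  exact pow_eq_zero_iff (two_ne_zero) |>.1 h4

section Regression

variable {d n : ℕ} {Ω₀ Ω : Type*} [MeasurableSpace Ω₀] [MeasurableSpace Ω]
  {P₀ : Measure Ω₀} [IsProbabilityMeasure P₀] {P : Measure Ω} [IsProbabilityMeasure P]
  {X : Ω₀ → EuclideanSpace ℝ (Fin d)} {Y : Ω₀ → ℝ}
  {Xs : Fin n → Ω → EuclideanSpace ℝ (Fin d)} {Ys : Fin n → Ω → ℝ}
  {θs : EuclideanSpace ℝ (Fin d)} {θh : Ω → EuclideanSpace ℝ (Fin d)}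

theorem memLp_residual (hX : MemLp X 2 P₀) (hY : MemLp Y 2 P₀) (θ : EuclideanSpace ℝ (Fin d)) :
    MemLp (fun ω => Y ω - inner ℝ θ (X ω)) 2 P₀ :=
  hY.sub (hX.const_inner θ)

theorem risk_add (hX : MemLp X 2 P₀) (hY : MemLp Y 2 P₀) (θ u : EuclideanSpace ℝ (Fin d)) :
    risk P₀ X Y (θ + u) = risk P₀ X Y θ
      - 2 * ∫ ω, (Y ω - inner ℝ θ (X ω)) * inner ℝ u (X ω) ∂P₀
      + ∫ ω, inner ℝ u (X ω) ^ 2 ∂P₀ := by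
  have hr := memLp_residual hX hY θ
  have i0 : Integrable (fun ω => (Y ω - inner ℝ θ (X ω)) ^ 2) P₀ := hr.integrable_sq
  have i1 : Integrable (fun ω => (Y ω - inner ℝ θ (X ω)) * inner ℝ u (X ω)) P₀ :=
    MemLp.integrable_mul hr (hX.const_inner u)
  have i2 := integrable_inner_sq hX u
  unfold risk
  have e : ∀ ω, (Y ω - inner ℝ (θ + u) (X ω)) ^ 2
      = (Y ω - inner ℝ θ (X ω)) ^ 2 - 2 * ((Y ω - inner ℝ θ (X ω)) * inner ℝ u (X ω))
        + inner ℝ u (X ω) ^ 2 := by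
    intro ω; rw [inner_add_left]; ring
  simp_rw [e]
  have i01 : Integrable (fun ω => (Y ω - inner ℝ θ (X ω)) ^ 2
      - 2 * ((Y ω - inner ℝ θ (X ω)) * inner ℝ u (X ω))) P₀ := i0.sub (i1.const_mul 2)
  rw [integral_add i01 i2, integral_sub i0 (i1.const_mul 2),
    integral_const_mul]

theorem integral_residual_mul_inner (hX : MemLp X 2 P₀) (hY : MemLp Y 2 P₀)
    (hmin : ∀ θ, risk P₀ X Y θs ≤ risk P₀ X Y θ) (u : EuclideanSpace ℝ (Fin d)) :
    ∫ ω, (Y ω - inner ℝ θs (X ω)) * inner ℝ u (X ω) ∂P₀ = 0 := by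
  refine eq_zero_of_forall_le_quadratic (a := risk P₀ X Y θs)
    (c := ∫ ω, inner ℝ u (X ω) ^ 2 ∂P₀) fun t => ?_
  refine (hmin (θs + t • u)).trans_eq ?_
  rw [risk_add hX hY]
  simp_rw [real_inner_smul_left, mul_pow]
  rw [integral_const_mul]
  have e : ∀ ω, (Y ω - inner ℝ θs (X ω)) * (t * inner ℝ u (X ω))
      = t * ((Y ω - inner ℝ θs (X ω)) * inner ℝ u (X ω)) := fun ω => by ring
  simp_rw [e]
  rw [integral_const_mul]
  ring

namespace IsRegression

variable (h : IsRegression P₀ X Y P Xs Ys θs θh)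
include h

/-- The residual at θ_* is orthogonal to every ⟨u, X⟩, so the cross term in the expansion of the
risk vanishes. -/
theorem excessRisk_eq (ω : Ω) :
    excessRisk P₀ X Y θs θh ω = ‖gramSqrt P₀ X (θh ω - θs)‖ ^ 2 := by
  rw [norm_gramSqrt_sq h.memLp_X]
  unfold excessRisk
  have e : θh ω = θs + (θh ω - θs) := by abel
  conv_lhs => rw [e]
  rw [risk_add h.memLp_X h.memLp_Y, integral_residual_mul_inner h.memLp_X h.memLp_Y h.isMin]
  ring

theorem measurable_excessRisk : Measurable (excessRisk P₀ X Y θs θh) := by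
  have e : excessRisk P₀ X Y θs θh = fun ω => ‖gramSqrt P₀ X (θh ω - θs)‖ ^ 2 :=
    funext h.excessRisk_eq
  rw [e]
  exact (((gramSqrt P₀ X).continuous.measurable.comp
    (h.measurable_θh.sub_const θs)).norm).pow_const 2

theorem excessRisk_nonneg (ω : Ω) : 0 ≤ excessRisk P₀ X Y θs θh ω := by
  rw [h.excessRisk_eq]; positivity

theorem ident_X (i : Fin n) : IdentDistrib (Xs i) X P P₀ := (h.ident i).comp measurable_fst

theorem ae_inner_design :
    ∀ᵐ ω ∂P, ∀ i u, inner ℝ (gramSqrt P₀ X u) (whiten P₀ X (Xs i ω)) = inner ℝ u (Xs i ω) := by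
  refine ae_all_iff.2 fun i => ?_
  refine (h.ident_X i).symm.ae_snd (p := fun x => ∀ u, inner ℝ (gramSqrt P₀ X u) (whiten P₀ X x)
    = inner ℝ u x) ?_ (ae_inner_gramSqrt_whiten h.memLp_X)
  -- The quantifier over u is uncountable; measurability comes from an intersection of closed sets.
  apply IsClosed.measurableSet
  simp only [Set.ofPred_forall]
  exact isClosed_iInter fun u => isClosed_eq (by fun_prop) (by fun_prop)

/-- The normal equations. -/
theorem ae_normal_equations :
    ∀ᵐ ω ∂P, ∀ u, ∑ i, (Ys i ω - inner ℝ θs (Xs i ω)) * inner ℝ u (Xs i ω)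
      = ∑ i, inner ℝ (θh ω - θs) (Xs i ω) * inner ℝ u (Xs i ω) := by
  filter_upwards [h.isEmpMin] with ω hω u
  have h1 : ∑ i, (Ys i ω - inner ℝ (θh ω) (Xs i ω)) * inner ℝ u (Xs i ω) = 0 := by
    refine eq_zero_of_forall_le_quadratic
      (a := ∑ i, (Ys i ω - inner ℝ (θh ω) (Xs i ω)) ^ 2)
      (c := ∑ i, inner ℝ u (Xs i ω) ^ 2) fun t => ?_
    refine (hω (θh ω + t • u)).trans_eq ?_
    rw [Finset.mul_sum, Finset.mul_sum, ← Finset.sum_sub_distrib, ← Finset.sum_add_distrib]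
    congr 1
    ext i
    rw [inner_add_left, real_inner_smul_left]
    ring
  rw [← sub_eq_zero, ← h1, ← Finset.sum_sub_distrib]
  congr 1
  ext i
  rw [inner_sub_left]
  ring

/-- The law of the whitened design is the image of the law of `X`. -/
theorem map_whiten (i : Fin n) :
    P.map (fun ω => whiten P₀ X (Xs i ω)) = P₀.map fun ω => whiten P₀ X (X ω) :=
  ((h.ident_X i).comp (whiten P₀ X).continuous.measurable).map_eq

theorem iIndepFun_whiten : iIndepFun (fun i ω => whiten P₀ X (Xs i ω)) P :=
  h.indep.comp (fun _ p => whiten P₀ X p.1)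
    fun _ => (whiten P₀ X).continuous.measurable.comp measurable_fst

theorem integral_inner_law_gramSqrt (u : EuclideanSpace ℝ (Fin d)) :
    ∫ w, inner ℝ (gramSqrt P₀ X u) w ^ 2 ∂(P₀.map fun ω => whiten P₀ X (X ω))
      = ‖gramSqrt P₀ X u‖ ^ 2 := by
  have hm : AEMeasurable (fun ω => whiten P₀ X (X ω)) P₀ :=
    (whiten P₀ X).continuous.measurable.comp_aemeasurable h.memLp_X.1.aemeasurable
  rw [integral_map hm (by fun_prop)]
  exact integral_inner_whiten_sq_gramSqrt h.memLp_X u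

end IsRegression

/-- `ρ` is a lower bound for the quadratic form of the empirical Gram matrix of `z` on the unit
sphere of the support of an isotropic law `Q`. -/
def GramLowerBound (Q : Measure (EuclideanSpace ℝ (Fin d)))
    (z : Fin n → EuclideanSpace ℝ (Fin d)) (ρ : ℝ) : Prop :=
  ∀ θ, ‖θ‖ = 1 → ∫ w, inner ℝ θ w ^ 2 ∂Q = 1 → ρ ≤ (∑ i, inner ℝ θ (z i) ^ 2) / n

namespace IsRegression

variable (h : IsRegression P₀ X Y P Xs Ys θs θh)
include h

/-- A normalized vector of the range of G^{1/2} has second moment one under the whitened law, so the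
lower bound applies to it; homogeneity does the rest. -/
theorem mul_norm_sq_le (hn : 0 < n) {z : Fin n → EuclideanSpace ℝ (Fin d)} {ρ : ℝ}
    (hρ : GramLowerBound (P₀.map fun ω => whiten P₀ X (X ω)) z ρ)
    (u : EuclideanSpace ℝ (Fin d)) :
    n * ρ * ‖gramSqrt P₀ X u‖ ^ 2 ≤ ∑ i, inner ℝ (gramSqrt P₀ X u) (z i) ^ 2 := by
  have hn' : (0 : ℝ) < n := by exact_mod_cast hn
  rcases eq_or_ne (gramSqrt P₀ X u) 0 with h0 | h0
  · simp [h0]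
  have hpos : 0 < ‖gramSqrt P₀ X u‖ := norm_pos_iff.2 h0
  have h1 := hρ ((‖gramSqrt P₀ X u‖)⁻¹ • gramSqrt P₀ X u)
    (by rw [norm_smul, norm_inv, norm_norm, inv_mul_cancel₀ hpos.ne']) (by
      simp_rw [real_inner_smul_left, mul_pow]
      rw [integral_const_mul, h.integral_inner_law_gramSqrt, inv_pow,
        inv_mul_cancel₀ (by positivity)])
  simp_rw [real_inner_smul_left, mul_pow] at h1
  rw [← Finset.mul_sum, inv_pow, le_div_iff₀ hn', ← div_eq_inv_mul, le_div_iff₀ (by positivity)]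
    at h1
  linarith

/-- The excess risk bound used under a heteroscedastic noise. -/
theorem ae_excessRisk_le_of_gramLowerBound (hn : 0 < n) :
    ∀ᵐ ω ∂P, ∀ ρ, 0 < ρ → GramLowerBound (P₀.map fun ω => whiten P₀ X (X ω))
        (fun i => whiten P₀ X (Xs i ω)) ρ →
      excessRisk P₀ X Y θs θh ω
        ≤ ‖∑ i, (Ys i ω - inner ℝ θs (Xs i ω)) • whiten P₀ X (Xs i ω)‖ ^ 2 / (n * ρ) ^ 2 := by
  have hn' : (0 : ℝ) < n := by exact_mod_cast hn
  filter_upwards [h.ae_inner_design, h.ae_normal_equations] with ω hd hne ρ hρ0 hρ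
  have h1 := h.mul_norm_sq_le hn hρ (θh ω - θs)
  rw [h.excessRisk_eq]
  -- The normal equations turn the empirical quadratic form at z into ⟪z, S⟫. Then nρ‖z‖² ≤ ‖z‖‖S‖,
  -- and a factor ‖z‖ is cancelled.
  have h2 : ∑ i, inner ℝ (gramSqrt P₀ X (θh ω - θs)) (whiten P₀ X (Xs i ω)) ^ 2
      = inner ℝ (gramSqrt P₀ X (θh ω - θs))
        (∑ i, (Ys i ω - inner ℝ θs (Xs i ω)) • whiten P₀ X (Xs i ω)) := by
    rw [inner_sum]
    simp_rw [inner_smul_right, hd]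
    rw [hne]
    simp_rw [sq]
  rw [h2] at h1
  set z := gramSqrt P₀ X (θh ω - θs)
  set S := ∑ i, (Ys i ω - inner ℝ θs (Xs i ω)) • whiten P₀ X (Xs i ω)
  have h3 := h1.trans (real_inner_le_norm z S)
  have hnρ : 0 < n * ρ := by positivity
  rw [le_div_iff₀ (by positivity), ← mul_pow]
  refine pow_le_pow_left₀ (by positivity) ?_ 2
  rcases (norm_nonneg z).eq_or_lt with h0 | hpos
  · rw [← h0, zero_mul]; exact norm_nonneg _
  · refine le_of_mul_le_mul_left ?_ hpos
    linarith

/-- The excess risk bound used under an independent noise. -/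
theorem ae_mul_excessRisk_le (hn : 0 < n) :
    ∀ᵐ ω ∂P, ∀ ρ, GramLowerBound (P₀.map fun ω => whiten P₀ X (X ω))
        (fun i => whiten P₀ X (Xs i ω)) ρ →
      n * ρ * excessRisk P₀ X Y θs θh ω
        ≤ 2 * ∑ i, inner ℝ (θh ω - θs) (Xs i ω) * (Ys i ω - inner ℝ θs (Xs i ω))
          - ∑ i, inner ℝ (θh ω - θs) (Xs i ω) ^ 2 := by
  filter_upwards [h.ae_inner_design, h.ae_normal_equations] with ω hd hne ρ hρ
  have h1 := h.mul_norm_sq_le hn hρ (θh ω - θs)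
  rw [h.excessRisk_eq]
  refine h1.trans_eq ?_
  simp_rw [hd]
  have h2 := hne (θh ω - θs)
  -- The linear and quadratic sums agree at θ̂ - θ_*, so the quadratic form is rewritten as twice
  -- the first minus the second. In that form it is dominated by a supremum over u that involves
  -- only the design and the noise.
  have h3 : ∑ i, inner ℝ (θh ω - θs) (Xs i ω) * (Ys i ω - inner ℝ θs (Xs i ω))
      = ∑ i, inner ℝ (θh ω - θs) (Xs i ω) ^ 2 := by
    rw [Finset.sum_congr rfl fun i _ => mul_comm _ _, h2]
    simp_rw [sq]
  rw [h3]
  ring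

theorem memLp_score :
    MemLp (fun ω => (Y ω - inner ℝ θs (X ω)) • whiten P₀ X (X ω)) 2 P₀ := by
  have hm : AEStronglyMeasurable (fun ω => (Y ω - inner ℝ θs (X ω)) • whiten P₀ X (X ω)) P₀ :=
    (memLp_residual h.memLp_X h.memLp_Y θs).1.smul
      ((whiten P₀ X).continuous.comp_aestronglyMeasurable h.memLp_X.1)
  rw [memLp_two_iff_integrable_sq_norm hm]
  refine ⟨hm.norm.pow 2, ?_⟩
  rw [hasFiniteIntegral_iff_ofReal (Filter.Eventually.of_forall fun _ => sq_nonneg _)]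
  have := h.rateConst_lt_top
  unfold rateConst at this
  simpa [norm_smul, mul_pow, whiten_apply] using this

theorem integral_norm_score_sq :
    ∫ ω, ‖(Y ω - inner ℝ θs (X ω)) • whiten P₀ X (X ω)‖ ^ 2 ∂P₀
      = (rateConst P₀ X Y θs).toReal := by
  rw [integral_eq_lintegral_of_nonneg_ae (Filter.Eventually.of_forall fun _ => sq_nonneg _)
    (h.memLp_score.1.norm.pow 2)]
  unfold rateConst
  simp [norm_smul, mul_pow, whiten_apply]

theorem ident_score (i : Fin n) :
    IdentDistrib (fun ω => (Ys i ω - inner ℝ θs (Xs i ω)) • whiten P₀ X (Xs i ω))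
      (fun ω => (Y ω - inner ℝ θs (X ω)) • whiten P₀ X (X ω)) P P₀ := by
  have hu : Measurable fun p : EuclideanSpace ℝ (Fin d) × ℝ =>
    (p.2 - inner ℝ θs p.1) • whiten P₀ X p.1 := by fun_prop
  exact (h.ident i).comp hu

theorem iIndepFun_score :
    iIndepFun (fun i ω => (Ys i ω - inner ℝ θs (Xs i ω)) • whiten P₀ X (Xs i ω)) P :=
  h.indep.comp (fun _ p => (p.2 - inner ℝ θs p.1) • whiten P₀ X p.1) fun _ => by fun_prop

theorem memLp_score_sample (i : Fin n) :
    MemLp (fun ω => (Ys i ω - inner ℝ θs (Xs i ω)) • whiten P₀ X (Xs i ω)) 2 P :=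
  (h.ident_score i).memLp_iff.2 h.memLp_score

theorem integrable_norm_sum_score_sq :
    Integrable (fun ω => ‖∑ i, (Ys i ω - inner ℝ θs (Xs i ω)) • whiten P₀ X (Xs i ω)‖ ^ 2) P := by
  have := (memLp_finsetSum Finset.univ fun i _ => h.memLp_score_sample i).integrable_norm_pow
    (p := 2) two_ne_zero
  simpa using this

/-- Each coordinate of the score is centred by the first-order condition at θ_*, so by independence
the variances add, coordinate by coordinate. -/
theorem integral_norm_sum_score_sq :
    ∫ ω, ‖∑ i, (Ys i ω - inner ℝ θs (Xs i ω)) • whiten P₀ X (Xs i ω)‖ ^ 2 ∂P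
      = n * (rateConst P₀ X Y θs).toReal := by
  set U : Fin n → Ω → EuclideanSpace ℝ (Fin d) :=
    fun i ω => (Ys i ω - inner ℝ θs (Xs i ω)) • whiten P₀ X (Xs i ω) with hU
  set U₀ : Ω₀ → EuclideanSpace ℝ (Fin d) :=
    fun ω => (Y ω - inner ℝ θs (X ω)) • whiten P₀ X (X ω) with hU₀
  have hcoord : ∀ k : Fin d, Measurable fun x : EuclideanSpace ℝ (Fin d) => x k := fun k => by
    fun_prop
  have hmem : ∀ i k, MemLp (fun ω => U i ω k) 2 P := fun i k => by
    have := (h.memLp_score_sample i).const_inner (𝕜 := ℝ) (EuclideanSpace.single k (1 : ℝ))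
    simpa [EuclideanSpace.inner_single_left, hU] using this
  have hmem₀ : ∀ k, MemLp (fun ω => U₀ ω k) 2 P₀ := fun k => by
    have := h.memLp_score.const_inner (𝕜 := ℝ) (EuclideanSpace.single k (1 : ℝ))
    simpa [EuclideanSpace.inner_single_left, hU₀] using this
  have hid : ∀ i k, IdentDistrib (fun ω => U i ω k) (fun ω => U₀ ω k) P P₀ := fun i k =>
    (h.ident_score i).comp (hcoord k)
  have hmean₀ : ∀ k, ∫ ω, U₀ ω k ∂P₀ = 0 := fun k => by
    have := integral_residual_mul_inner h.memLp_X h.memLp_Y h.isMin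
      (whiten P₀ X (EuclideanSpace.single k (1 : ℝ)))
    rw [← this]
    congr 1
    ext ω
    unfold whiten
    rw [← inner_gramFun_right, EuclideanSpace.inner_single_left]
    simp [hU₀, whiten]
  have hmean : ∀ i k, ∫ ω, U i ω k ∂P = 0 := fun i k => by rw [(hid i k).integral_eq, hmean₀]
  have hk : ∀ k, ∫ ω, (∑ i, U i ω k) ^ 2 ∂P = n * ∫ ω, (U₀ ω k) ^ 2 ∂P₀ := by
    intro k
    have h1 : Var[∑ i, fun ω => U i ω k; P] = ∑ i, Var[fun ω => U i ω k; P] := by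
      refine IndepFun.variance_sum (fun i _ => hmem i k) fun i _ j _ hij => ?_
      exact (h.iIndepFun_score.indepFun hij).comp (hcoord k) (hcoord k)
    have h2 : ∀ i, Var[fun ω => U i ω k; P] = ∫ ω, (U₀ ω k) ^ 2 ∂P₀ := fun i => by
      rw [(hid i k).variance_eq, variance_of_integral_eq_zero (hmem₀ k).1.aemeasurable (hmean₀ k)]
    have h3 : ∫ ω, (∑ i, fun ω => U i ω k) ω ∂P = 0 := by
      simp only [Finset.sum_apply]
      rw [integral_finsetSum _ fun i _ => (hmem i k).integrable one_le_two]
      simp [hmean]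
    rw [variance_of_integral_eq_zero
      (Finset.aemeasurable_sum _ fun i _ => (hmem i k).1.aemeasurable) h3] at h1
    simp only [Finset.sum_apply, h2, Finset.sum_const, Finset.card_univ, Fintype.card_fin,
      nsmul_eq_mul] at h1
    exact h1
  rw [← h.integral_norm_score_sq]
  simp_rw [EuclideanSpace.real_norm_sq_eq]
  rw [integral_finsetSum _ fun k _ => ?_, integral_finsetSum _ fun k _ => ?_, Finset.mul_sum]
  · refine Finset.sum_congr rfl fun k _ => ?_
    rw [← hk k]
    simp [hU]
  · exact (hmem₀ k).integrable_sq
  · have := (memLp_finsetSum Finset.univ fun i _ => hmem i k).integrable_sq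
    simpa [hU] using this

end IsRegression

end Regression

end LeastSquares

end

noncomputable section

namespace LeastSquares

/-! ### Projection of the noise on the column space of the design. -/

section Projection

variable {d n : ℕ}

/-- The squared norm of the projection of `e` on the column space of the design `x`, as the
supremum of `2 ⟪A u, e⟫ - ‖A u‖²`. -/
def projSup (x : Fin n → EuclideanSpace ℝ (Fin d)) (e : Fin n → ℝ) : ℝ≥0∞ :=
  ⨆ k : ℕ, ENNReal.ofReal (2 * ∑ i, inner ℝ (TopologicalSpace.denseSeq _ k) (x i) * e i
    - ∑ i, inner ℝ (TopologicalSpace.denseSeq (EuclideanSpace ℝ (Fin d)) k) (x i) ^ 2)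

theorem measurable_projSup :
    Measurable fun p : (Fin n → EuclideanSpace ℝ (Fin d)) × (Fin n → ℝ) => projSup p.1 p.2 := by
  refine Measurable.iSup fun k => ?_
  have h1 : ∀ i : Fin n, Measurable fun p : (Fin n → EuclideanSpace ℝ (Fin d)) × (Fin n → ℝ) =>
      inner ℝ (TopologicalSpace.denseSeq (EuclideanSpace ℝ (Fin d)) k) (p.1 i) := fun i =>
    ((measurable_pi_apply i).comp measurable_fst).const_inner
  have h2 : ∀ i : Fin n, Measurable fun p : (Fin n → EuclideanSpace ℝ (Fin d)) × (Fin n → ℝ) =>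
      p.2 i := fun i => (measurable_pi_apply i).comp measurable_snd
  exact (((Finset.measurable_fun_sum _ fun i _ => (h1 i).mul (h2 i)).const_mul 2).sub
    (Finset.measurable_fun_sum _ fun i _ => (h1 i).pow_const 2)).ennreal_ofReal

/-- The supremum is taken over a countable dense set so as to be measurable; continuity in u extends
the bound to all u. -/
theorem le_projSup (x : Fin n → EuclideanSpace ℝ (Fin d)) (e : Fin n → ℝ)
    (u : EuclideanSpace ℝ (Fin d)) :
    ENNReal.ofReal (2 * ∑ i, inner ℝ u (x i) * e i - ∑ i, inner ℝ u (x i) ^ 2)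
      ≤ projSup x e := by
  have hc : IsClosed {u : EuclideanSpace ℝ (Fin d) |
      ENNReal.ofReal (2 * ∑ i, inner ℝ u (x i) * e i - ∑ i, inner ℝ u (x i) ^ 2)
        ≤ projSup x e} := by
    refine isClosed_le ?_ continuous_const
    exact ENNReal.continuous_ofReal.comp (by fun_prop)
  have hd : Set.range (TopologicalSpace.denseSeq (EuclideanSpace ℝ (Fin d))) ⊆
      {u : EuclideanSpace ℝ (Fin d) |
      ENNReal.ofReal (2 * ∑ i, inner ℝ u (x i) * e i - ∑ i, inner ℝ u (x i) ^ 2)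
        ≤ projSup x e} := by
    rintro _ ⟨k, rfl⟩
    exact le_iSup (fun k : ℕ => ENNReal.ofReal
      (2 * ∑ i, inner ℝ (TopologicalSpace.denseSeq (EuclideanSpace ℝ (Fin d)) k) (x i) * e i
      - ∑ i, inner ℝ (TopologicalSpace.denseSeq (EuclideanSpace ℝ (Fin d)) k) (x i) ^ 2)) k
  have h1 := closure_minimal hd hc
  rw [(TopologicalSpace.denseRange_denseSeq _).closure_range] at h1
  exact h1 (Set.mem_univ u)

/-- In an orthonormal basis of the column space, completing the square in each coordinate bounds the
supremum by the sum of the squared coordinates of e. Each has mean s, and the dimension is at most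
d. -/
theorem lintegral_projSup_le {ν : Measure (Fin n → ℝ)} {s : ℝ}
    (hν : ∀ a : Fin n → ℝ, ∫⁻ e, ENNReal.ofReal ((∑ i, a i * e i) ^ 2) ∂ν
      = ENNReal.ofReal (s * ∑ i, a i ^ 2)) (x : Fin n → EuclideanSpace ℝ (Fin d)) :
    ∫⁻ e, projSup x e ∂ν ≤ ENNReal.ofReal (d * s) := by
  let A : EuclideanSpace ℝ (Fin d) →ₗ[ℝ] EuclideanSpace ℝ (Fin n) :=
    { toFun := fun u => WithLp.toLp 2 fun i => inner ℝ u (x i)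
      map_add' := fun u v => by ext i; simp [inner_add_left]
      map_smul' := fun c u => by ext i; simp [real_inner_smul_left] }
  let K := LinearMap.range A
  let b := stdOrthonormalBasis ℝ K
  have hK : Module.finrank ℝ K ≤ d := by
    have := LinearMap.finrank_range_le A
    simpa using this
  have h1 : ∀ e, projSup x e
      ≤ ∑ k, ENNReal.ofReal ((∑ i, (b k : EuclideanSpace ℝ (Fin n)) i * e i) ^ 2) := by
    intro e
    refine iSup_le fun k => ?_
    rw [← ENNReal.ofReal_sum_of_nonneg fun _ _ => sq_nonneg _]
    apply ENNReal.ofReal_le_ofReal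
    set u := TopologicalSpace.denseSeq (EuclideanSpace ℝ (Fin d)) k
    set y : K := ⟨A u, LinearMap.mem_range_self A u⟩ with hy
    have hy1 : ∑ i, inner ℝ u (x i) ^ 2 = ∑ k, (b.repr y k) ^ 2 := by
      have e1 : ‖y‖ ^ 2 = ∑ k, (b.repr y k) ^ 2 := by
        rw [← b.repr.norm_map y, EuclideanSpace.real_norm_sq_eq]
      rw [← e1, Submodule.coe_norm, EuclideanSpace.real_norm_sq_eq]
      rfl
    have hy2 : ∑ i, inner ℝ u (x i) * e i
        = ∑ k, b.repr y k * ∑ i, (b k : EuclideanSpace ℝ (Fin n)) i * e i := by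
      have e1 : (y : EuclideanSpace ℝ (Fin n)) = ∑ k, b.repr y k • (b k : EuclideanSpace ℝ (Fin n)) := by
        conv_lhs => rw [← b.sum_repr y]
        simp
      have e2 : ∀ i, inner ℝ u (x i) = ∑ k, b.repr y k * (b k : EuclideanSpace ℝ (Fin n)) i := by
        intro i
        have := congrArg (fun v : EuclideanSpace ℝ (Fin n) => v i) e1
        simpa [hy, A] using this
      simp_rw [e2, Finset.sum_mul, Finset.mul_sum]
      rw [Finset.sum_comm]
      congr 1; ext k; congr 1; ext i; ring
    rw [hy1, hy2, Finset.mul_sum, ← Finset.sum_sub_distrib]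
    refine Finset.sum_le_sum fun k _ => ?_
    nlinarith [sq_nonneg (b.repr y k - ∑ i, (b k : EuclideanSpace ℝ (Fin n)) i * e i)]
  have h2 : ∀ k, ∫⁻ e, ENNReal.ofReal ((∑ i, (b k : EuclideanSpace ℝ (Fin n)) i * e i) ^ 2) ∂ν
      = ENNReal.ofReal s := by
    intro k
    rw [hν, ← EuclideanSpace.real_norm_sq_eq, ← Submodule.coe_norm, b.norm_eq_one]
    simp
  calc ∫⁻ e, projSup x e ∂ν
      ≤ ∫⁻ e, ∑ k, ENNReal.ofReal ((∑ i, (b k : EuclideanSpace ℝ (Fin n)) i * e i) ^ 2) ∂ν :=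
        lintegral_mono h1
    _ = ∑ _k : Fin (Module.finrank ℝ K), ENNReal.ofReal s := by
        rw [lintegral_finsetSum _ fun k _ => ?_]
        · simp_rw [h2]
        · exact ((Finset.measurable_fun_sum _ fun i _ =>
            (measurable_pi_apply i).const_mul _).pow_const 2).ennreal_ofReal
    _ ≤ ENNReal.ofReal (d * s) := by
        rw [Finset.sum_const, Finset.card_univ, Fintype.card_fin, nsmul_eq_mul,
          ENNReal.ofReal_mul (by positivity), ENNReal.ofReal_natCast]
        gcongr

theorem setLIntegral_prod_projSup_le {μ : Measure (Fin n → EuclideanSpace ℝ (Fin d))}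
    [SFinite μ] {ν : Measure (Fin n → ℝ)} [SFinite ν] {s : ℝ}
    (hν : ∀ a : Fin n → ℝ, ∫⁻ e, ENNReal.ofReal ((∑ i, a i * e i) ^ 2) ∂ν
      = ENNReal.ofReal (s * ∑ i, a i ^ 2))
    {B : Set (Fin n → EuclideanSpace ℝ (Fin d))} (hB : MeasurableSet B) :
    ∫⁻ p in Prod.fst ⁻¹' B, projSup p.1 p.2 ∂(μ.prod ν) ≤ ENNReal.ofReal (d * s) * μ B := by
  rw [← lintegral_indicator (measurable_fst hB),
    lintegral_prod _ (measurable_projSup.indicator (measurable_fst hB)).aemeasurable]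
  calc _ ≤ ∫⁻ x, B.indicator (fun _ => ENNReal.ofReal (d * s)) x ∂μ := by
        refine lintegral_mono fun x => ?_
        by_cases hx : x ∈ B
        · simp only [Set.indicator, Set.mem_preimage, hx, if_true]
          exact lintegral_projSup_le hν x
        · simp [Set.indicator, hx]
    _ = _ := by rw [lintegral_indicator hB, setLIntegral_const]

end Projection

theorem designSigma_eq_comap {d n : ℕ} {Ω : Type*}
    (Xs : Fin n → Ω → EuclideanSpace ℝ (Fin d)) :
    designSigma Xs = MeasurableSpace.comap (fun ω i => Xs i ω) inferInstance := by
  unfold designSigma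
  simp only [MeasurableSpace.pi, MeasurableSpace.comap_iSup, MeasurableSpace.comap_comp]
  rfl

/-! ### Conditional expectation given the design, under independent noise. -/

section Regression

variable {d n : ℕ} {Ω₀ Ω : Type*} [MeasurableSpace Ω₀] [MeasurableSpace Ω]
  {P₀ : Measure Ω₀} [IsProbabilityMeasure P₀] {P : Measure Ω} [IsProbabilityMeasure P]
  {X : Ω₀ → EuclideanSpace ℝ (Fin d)} {Y : Ω₀ → ℝ}
  {Xs : Fin n → Ω → EuclideanSpace ℝ (Fin d)} {Ys : Fin n → Ω → ℝ}
  {θs : EuclideanSpace ℝ (Fin d)} {θh : Ω → EuclideanSpace ℝ (Fin d)} {σ : ℝ}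

namespace IsRegression

variable (h : IsRegression P₀ X Y P Xs Ys θs θh)
include h

theorem measurable_residual (i : Fin n) : Measurable fun ω => Ys i ω - inner ℝ θs (Xs i ω) :=
  (h.measurable_Ys i).sub (h.measurable_Xs i).const_inner

theorem ident_residual (i : Fin n) :
    IdentDistrib (fun ω => Ys i ω - inner ℝ θs (Xs i ω)) (fun ω => Y ω - inner ℝ θs (X ω))
      P P₀ :=
  (h.ident i).comp (u := fun p : EuclideanSpace ℝ (Fin d) × ℝ => p.2 - inner ℝ θs p.1)
    (by fun_prop)

/-- Independence across the pairs combines with independence inside each pair; rearranging the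
product of pairs into a pair of products separates the whole design from the whole noise vector. -/
theorem map_design_residual (hσ : HasIndepNoise P₀ X Y θs σ) :
    P.map (fun ω => ((fun i => Xs i ω), (fun i => Ys i ω - inner ℝ θs (Xs i ω))))
      = (P.map fun ω i => Xs i ω).prod (P.map fun ω i => Ys i ω - inner ℝ θs (Xs i ω)) := by
  have hu : Measurable fun p : EuclideanSpace ℝ (Fin d) × ℝ => (p.1, p.2 - inner ℝ θs p.1) := by
    fun_prop
  have hpair : iIndepFun (fun i ω => (Xs i ω, Ys i ω - inner ℝ θs (Xs i ω))) P :=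
    h.indep.comp (fun _ p => (p.1, p.2 - inner ℝ θs p.1)) fun _ => hu
  have hX : iIndepFun (fun i ω => Xs i ω) P := h.indep.comp (fun _ p => p.1) fun _ => measurable_fst
  have hR : iIndepFun (fun i ω => Ys i ω - inner ℝ θs (Xs i ω)) P :=
    h.indep.comp (fun _ p => p.2 - inner ℝ θs p.1) fun _ => by fun_prop
  have hm : ∀ i, Measurable fun ω => (Xs i ω, Ys i ω - inner ℝ θs (Xs i ω)) := fun i =>
    (h.measurable_Xs i).prodMk (h.measurable_residual i)
  have h1 : ∀ i, P.map (fun ω => (Xs i ω, Ys i ω - inner ℝ θs (Xs i ω)))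
      = (P.map (Xs i)).prod (P.map fun ω => Ys i ω - inner ℝ θs (Xs i ω)) := by
    intro i
    rw [(h.ident_X i).map_eq, (h.ident_residual i).map_eq,
      ← (indepFun_iff_map_prod_eq_prod_map_map h.memLp_X.1.aemeasurable
        (memLp_residual h.memLp_X h.memLp_Y θs).1.aemeasurable).1 hσ.indep]
    exact ((h.ident i).comp hu).map_eq
  have hpX : ∀ i, IsProbabilityMeasure (P.map (Xs i)) := fun i =>
    Measure.isProbabilityMeasure_map (h.measurable_Xs i).aemeasurable
  have hpR : ∀ i, IsProbabilityMeasure (P.map fun ω => Ys i ω - inner ℝ θs (Xs i ω)) := fun i =>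
    Measure.isProbabilityMeasure_map (h.measurable_residual i).aemeasurable
  have h2 := (measurePreserving_arrowProdEquivProdArrow (EuclideanSpace ℝ (Fin d)) ℝ (Fin n)
    (fun i => P.map (Xs i)) (fun i => P.map fun ω => Ys i ω - inner ℝ θs (Xs i ω))).map_eq
  rw [← hX.map_fun_eq_pi_map fun i => (h.measurable_Xs i).aemeasurable,
    ← hR.map_fun_eq_pi_map fun i => (h.measurable_residual i).aemeasurable] at h2
  rw [← h2]
  simp_rw [← h1]
  rw [← hpair.map_fun_eq_pi_map fun i => (hm i).aemeasurable,
    Measure.map_map (MeasurableEquiv.measurable _) (measurable_pi_lambda _ hm)]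
  rfl

theorem lintegral_sum_mul_residual_sq (hσ : HasIndepNoise P₀ X Y θs σ) (a : Fin n → ℝ) :
    ∫⁻ e, ENNReal.ofReal ((∑ i, a i * e i) ^ 2)
        ∂(P.map fun ω i => Ys i ω - inner ℝ θs (Xs i ω))
      = ENNReal.ofReal (σ ^ 2 * ∑ i, a i ^ 2) := by
  have hR : iIndepFun (fun i ω => Ys i ω - inner ℝ θs (Xs i ω)) P :=
    h.indep.comp (fun _ p => p.2 - inner ℝ θs p.1) fun _ => by fun_prop
  have hmem : ∀ i, MemLp (fun ω => a i * (Ys i ω - inner ℝ θs (Xs i ω))) 2 P := fun i =>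
    ((h.ident_residual i).memLp_iff.2 (memLp_residual h.memLp_X h.memLp_Y θs)).const_mul _
  rw [lintegral_map ((Finset.measurable_fun_sum _ fun i _ =>
    (measurable_pi_apply i).const_mul _).pow_const 2).ennreal_ofReal
    (measurable_pi_lambda _ h.measurable_residual)]
  have h1 : Var[∑ i, fun ω => a i * (Ys i ω - inner ℝ θs (Xs i ω)); P]
      = ∑ i, Var[fun ω => a i * (Ys i ω - inner ℝ θs (Xs i ω)); P] := by
    refine IndepFun.variance_sum (fun i _ => hmem i) fun i _ j _ hij => ?_
    exact (hR.indepFun hij).comp (measurable_const_mul (a i)) (measurable_const_mul (a j))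
  have h2 : ∀ i, Var[fun ω => a i * (Ys i ω - inner ℝ θs (Xs i ω)); P] = a i ^ 2 * σ ^ 2 := by
    intro i
    rw [variance_const_mul, (h.ident_residual i).variance_eq, variance_of_integral_eq_zero
      (memLp_residual h.memLp_X h.memLp_Y θs).1.aemeasurable hσ.mean, hσ.variance]
  have h3 : ∫ ω, (∑ i, fun ω => a i * (Ys i ω - inner ℝ θs (Xs i ω))) ω ∂P = 0 := by
    simp only [Finset.sum_apply]
    rw [integral_finsetSum _ fun i _ => (hmem i).integrable one_le_two]
    simp_rw [integral_const_mul, (h.ident_residual _).integral_eq, hσ.mean]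
    simp
  rw [variance_of_integral_eq_zero
    (Finset.aemeasurable_sum _ fun i _ => (hmem i).1.aemeasurable) h3] at h1
  simp only [Finset.sum_apply, h2] at h1
  have hi : Integrable (fun ω => (∑ i, a i * (Ys i ω - inner ℝ θs (Xs i ω))) ^ 2) P := by
    have := (memLp_finsetSum Finset.univ fun i _ => hmem i).integrable_sq
    simpa using this
  rw [← ofReal_integral_eq_lintegral_ofReal hi (Filter.Eventually.of_forall fun _ => sq_nonneg _),
    h1, Finset.mul_sum]
  congr 1
  exact Finset.sum_congr rfl fun i _ => mul_comm _ _

theorem setLIntegral_projSup_le (hσ : HasIndepNoise P₀ X Y θs σ)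
    {B : Set (Fin n → EuclideanSpace ℝ (Fin d))} (hB : MeasurableSet B) :
    ∫⁻ ω in (fun ω i => Xs i ω) ⁻¹' B,
        projSup (fun i => Xs i ω) (fun i => Ys i ω - inner ℝ θs (Xs i ω)) ∂P
      ≤ ENNReal.ofReal (d * σ ^ 2) * P ((fun ω i => Xs i ω) ⁻¹' B) := by
  have hmX : Measurable fun ω i => Xs i ω := measurable_pi_lambda _ h.measurable_Xs
  have hmR : Measurable fun ω i => Ys i ω - inner ℝ θs (Xs i ω) :=
    measurable_pi_lambda _ h.measurable_residual
  have hpR : IsProbabilityMeasure (P.map fun ω i => Ys i ω - inner ℝ θs (Xs i ω)) :=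
    Measure.isProbabilityMeasure_map hmR.aemeasurable
  rw [← Measure.map_apply hmX hB]
  refine le_trans (le_of_eq ?_) (setLIntegral_prod_projSup_le
    (h.lintegral_sum_mul_residual_sq hσ) hB)
  rw [← h.map_design_residual hσ]
  exact (setLIntegral_map (measurable_fst hB) measurable_projSup (hmX.prodMk hmR)).symm

/-- The bound on the conditional expectation of the excess risk, on an event that depends only on
the design and on which the empirical Gram matrix is well conditioned. -/
theorem measureReal_condLExp_le (hσ : HasIndepNoise P₀ X Y θs σ) (hn : 0 < n)
    {A : Set (Fin n → EuclideanSpace ℝ (Fin d))} (hA : MeasurableSet A) {ρ : ℝ} (hρ : 0 < ρ)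
    (hlow : ∀ x ∈ A, GramLowerBound (P₀.map fun ω => whiten P₀ X (X ω))
      (fun i => whiten P₀ X (x i)) ρ) :
    P.real ((fun ω i => Xs i ω) ⁻¹' A) ≤ P.real {ω | condLExp (designSigma Xs) P
        (fun ω' => ENNReal.ofReal (excessRisk P₀ X Y θs θh ω')) ω
          ≤ ENNReal.ofReal (d * σ ^ 2 / (n * ρ))} := by
  have hn' : (0 : ℝ) < n := by exact_mod_cast hn
  have hmX : Measurable fun ω i => Xs i ω := measurable_pi_lambda _ h.measurable_Xs
  have hle : designSigma Xs ≤ (inferInstance : MeasurableSpace Ω) := by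
    rw [designSigma_eq_comap]
    exact hmX.comap_le
  set f : Ω → ℝ≥0∞ := fun ω' => ENNReal.ofReal (excessRisk P₀ X Y θs θh ω')
  set g := condLExp (designSigma Xs) P f with hg
  have hgm : Measurable[designSigma Xs] g := measurable_condLExp _ _ _
  set c := ENNReal.ofReal (d * σ ^ 2 / (n * ρ)) with hc
  -- The part of the event where the claimed bound fails. It belongs to the design σ-algebra, so the
  -- conditional expectation can be integrated over it; the integral is at most c P(D) although the
  -- integrand exceeds c there, which forces P(D) = 0.
  set D : Set Ω := (fun ω i => Xs i ω) ⁻¹' A ∩ {ω | c < g ω} with hD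
  have hDm : MeasurableSet[designSigma Xs] D := by
    refine MeasurableSet.inter ?_ (hgm measurableSet_Ioi)
    rw [designSigma_eq_comap]
    exact ⟨A, hA, rfl⟩
  obtain ⟨B, hB, hBD⟩ : ∃ B, MeasurableSet B ∧ (fun ω i => Xs i ω) ⁻¹' B = D := by
    rw [designSigma_eq_comap] at hDm
    exact hDm
  have h1 : ∫⁻ ω in D, g ω ∂P ≤ c * P D := by
    rw [setLIntegral_condLExp hle P f hDm]
    have h2 : ∀ᵐ ω ∂P, ω ∈ D → f ω ≤ ENNReal.ofReal (n * ρ)⁻¹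
        * projSup (fun i => Xs i ω) (fun i => Ys i ω - inner ℝ θs (Xs i ω)) := by
      filter_upwards [h.ae_mul_excessRisk_le hn] with ω hω hωD
      have h3 := hω ρ (hlow _ hωD.1)
      have h4 := (ENNReal.ofReal_le_ofReal h3).trans
        (le_projSup (fun i => Xs i ω) (fun i => Ys i ω - inner ℝ θs (Xs i ω)) (θh ω - θs))
      have h5 : f ω = ENNReal.ofReal (n * ρ)⁻¹
          * ENNReal.ofReal (n * ρ * excessRisk P₀ X Y θs θh ω) := by
        rw [← ENNReal.ofReal_mul (by positivity), inv_mul_cancel_left₀ (by positivity)]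
      rw [h5]
      gcongr
    calc ∫⁻ ω in D, f ω ∂P ≤ ∫⁻ ω in D, ENNReal.ofReal (n * ρ)⁻¹
          * projSup (fun i => Xs i ω) (fun i => Ys i ω - inner ℝ θs (Xs i ω)) ∂P := by
          refine setLIntegral_mono_ae' (hle _ hDm) h2
      _ = ENNReal.ofReal (n * ρ)⁻¹ * ∫⁻ ω in D,
          projSup (fun i => Xs i ω) (fun i => Ys i ω - inner ℝ θs (Xs i ω)) ∂P :=
          lintegral_const_mul' _ _ ENNReal.ofReal_ne_top
      _ ≤ ENNReal.ofReal (n * ρ)⁻¹ * (ENNReal.ofReal (d * σ ^ 2) * P D) := by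
          gcongr
          rw [← hBD]
          exact h.setLIntegral_projSup_le hσ hB
      _ = c * P D := by
          rw [← mul_assoc, ← ENNReal.ofReal_mul (by positivity), hc]
          congr 2
          rw [div_eq_inv_mul]
  have hPD : P D = 0 := by
    by_contra hne
    have h2 : ∫⁻ _ in D, c ∂P < ∫⁻ ω in D, g ω ∂P := by
      refine setLIntegral_strict_mono (hle _ hDm) hne (hgm.mono hle le_rfl) ?_ ?_
      · rw [setLIntegral_const]
        exact ENNReal.mul_ne_top ENNReal.ofReal_ne_top (measure_ne_top _ _)
      · exact Filter.Eventually.of_forall fun ω hω => hω.2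
    rw [setLIntegral_const] at h2
    exact absurd h1 (not_le.2 h2)
  rw [measureReal_def, measureReal_def]
  refine ENNReal.toReal_mono (measure_ne_top _ _) (measure_mono_ae ?_)
  have h3 : ∀ᵐ ω ∂P, ω ∉ D := measure_eq_zero_iff_ae_notMem.1 hPD
  filter_upwards [h3] with ω hω hωA
  by_contra hcon
  exact hω ⟨hωA, not_le.1 hcon⟩

end IsRegression

end Regression

end LeastSquares

end

/-! ### Numerical inequalities for the explicit constants. -/

noncomputable section

namespace LeastSquares

/-- Here v = κ - 1, a = √(κd/n), m = μ and l is the temperature with γ₋ = l²/3. The left side is the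
total loss in the Gram lower bound when lam = min l 1, and the right side is 1 - |1 - γ₋| / (1 +
δ̂). The hypothesis `H` is the sample size condition divided by √n. -/
theorem gamma_tradeoff {v l a m : ℝ} (hv : 0 < v) (hl : 0 < l) (ha : 0 ≤ a)
    (H : 20 * a + (5 / 2 * v + 1 / 2) * l < 1) (hm1 : v * l + 9.63 * a ≤ m)
    (hm2 : m ≤ v * l + 9.64 * a) :
    min l 1 * v / 2 + (min l 1) ^ 2 / 4 + 6.4 * a + v * l ^ 2 / 2 / min l 1
      ≤ 1 - |1 - l ^ 2 / 3| * ((1 - 2 * m) / (1 - m)) := by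
  have hvl : 0 < v * l := mul_pos hv hl
  have hm0 : 0 < m := by linarith
  have hmh : 2 * m < 1 := by linarith
  have hl2 : l < 2 := by linarith
  have h1m : 0 < 1 - m := by linarith
  -- For l ≤ 1, taking lam = l balances v lam/2 against v l²/(2 lam). Beyond 1 the constraint lam ≤
  -- 1 is active, and `H` still gives l < 2.
  rcases le_or_gt l 1 with h | h
  · rw [min_eq_left h]
    have ht : l ^ 2 ≤ 1 := by nlinarith
    have ht0 : 0 < l ^ 2 := by positivity
    have e1 : v * l ^ 2 / 2 / l = v * l / 2 := by field_simp
    rw [e1, abs_of_nonneg (by linarith)]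
    have e2 : l * v / 2 + l ^ 2 / 4 + 6.4 * a + v * l / 2 ≤ m + l ^ 2 / 4 := by linarith
    refine e2.trans ?_
    rw [← mul_div_assoc, le_sub_iff_add_le, ← le_sub_iff_add_le', div_le_iff₀ h1m]
    generalize l ^ 2 = t at ht ht0
    have k0 : 0 ≤ (1 - t) * m ^ 2 := mul_nonneg (by linarith) (sq_nonneg _)
    have k1 : 0 ≤ t * (m ^ 2 - 5 / 12 * m + 1 / 12) :=
      mul_nonneg ht0.le (by nlinarith [sq_nonneg (m - 5 / 24)])
    nlinarith
  · rw [min_eq_right h.le]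
    have hr : (1 - 2 * m) / (1 - m) ≤ 1 - m := by
      rw [div_le_iff₀ h1m]; nlinarith
    -- Each of the two terms of `H` other than l/2 is bounded by the remaining room 1 - l/2.
    have hvl' : v * l ≤ (2 - l) / 5 := by nlinarith
    have ha' : a ≤ (2 - l) / 40 := by nlinarith
    have hvv : v ≤ v * l := by nlinarith
    have hq : |1 - l ^ 2 / 3| * ((1 - 2 * m) / (1 - m)) ≤ |1 - l ^ 2 / 3| * (1 - m) := by gcongr
    rcases le_or_gt (l ^ 2) 3 with h3 | h3
    · rw [abs_of_nonneg (by linarith : (0:ℝ) ≤ 1 - l ^ 2 / 3)] at hq ⊢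
      have hq2 : (1 - l ^ 2 / 3) * (1 - m) ≤ (1 - l ^ 2 / 3) * (1 - (v * l + 9.63 * a)) :=
        mul_le_mul_of_nonneg_left (by linarith) (by linarith)
      have k1 : a * (3.21 * (l ^ 2 - 1)) ≤ (2 - l) / 40 * (3.21 * (l ^ 2 - 1)) := by
        gcongr; nlinarith
      have k2 : v * ((l - 1) ^ 2 / 2) ≤ (2 - l) / 5 * ((l - 1) ^ 2 / 2) := by
        gcongr; linarith
      have k3 : v * l * (l ^ 2 / 3) ≤ (2 - l) / 5 * (l ^ 2 / 3) := by gcongr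
      have k4 : (2 - l) / 40 * (3.21 * (l ^ 2 - 1)) + (2 - l) / 5 * ((l - 1) ^ 2 / 2)
          + (2 - l) / 5 * (l ^ 2 / 3) ≤ l ^ 2 / 3 - 1 / 4 := by
        have : 0 ≤ (l - 1) ^ 3 := pow_nonneg (by linarith) 3
        nlinarith [sq_nonneg (l - 1)]
      nlinarith
    · rw [abs_of_nonpos (by linarith : 1 - l ^ 2 / 3 ≤ (0:ℝ))] at hq ⊢
      have hl17 : 1.7 < l := by nlinarith
      have hq2 : -(1 - l ^ 2 / 3) * (1 - m) ≤ -(1 - l ^ 2 / 3) * 1 :=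
        mul_le_mul_of_nonneg_left (by linarith) (by linarith)
      have k1 : v * l * l ≤ 0.06 * 2 := by gcongr; linarith
      have k2 : l ^ 2 ≤ 4 := by nlinarith
      nlinarith

variable {κ ε : ℝ} {d n : ℕ}

theorem sampleThreshold_nonneg : 0 ≤ sampleThreshold κ d ε := sq_nonneg _

/-- The real number `λ₀` with `λ₀² = 2 L / ((κ - 1) n)`, and what the sample size condition
says about it. -/
theorem exists_temperature (hκ : 1 < κ) (hd : 0 < d) (hε : 0 < ε) (hε1 : ε < 1)
    (h : sampleThreshold κ d ε < n) :
    ∃ l : ℝ, 0 < l ∧ l ^ 2 = 2 * (Real.log ε⁻¹ + 0.73 * d) / ((κ - 1) * n) ∧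
      20 * √(κ * d / n) + (5 / 2 * (κ - 1) + 1 / 2) * l < 1 ∧
      mu κ d n ε = (κ - 1) * l + 6.81 * √2 * √(κ * d / n) ∧
      gammaMinus κ d n ε = l ^ 2 / 3 := by
  have hn : (0 : ℝ) < n := sampleThreshold_nonneg.trans_lt h
  have hd' : (0 : ℝ) < d := by exact_mod_cast hd
  have hlog : 0 < Real.log ε⁻¹ := Real.log_pos ((one_lt_inv₀ hε).2 hε1)
  have hv : 0 < κ - 1 := by linarith
  have hκ0 : 0 < κ := by linarith
  unfold sampleThreshold at h
  unfold mu gammaMinus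
  set L := Real.log ε⁻¹ + 0.73 * d
  have hL : 0 < L := by positivity
  set v := κ - 1
  have hs : 0 < √(n : ℝ) := Real.sqrt_pos.2 hn
  have e3 : √(2 * v * L) = v * √n * √(2 * L / (v * n)) := by
    have : 2 * v * L = (v ^ 2 * n) * (2 * L / (v * n)) := by field_simp
    rw [this, Real.sqrt_mul (by positivity), Real.sqrt_mul (by positivity), Real.sqrt_sq hv.le]
  have e4 : √(κ * d) = √n * √(κ * d / n) := by
    rw [← Real.sqrt_mul hn.le]; congr 1; field_simp
  refine ⟨√(2 * L / (v * n)), by positivity, Real.sq_sqrt (by positivity), ?_, ?_, ?_⟩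
  · have h1 := Real.lt_sqrt_of_sq_lt h
    rw [e3, e4] at h1
    -- The common factor √n comes out, and (5/2 + 1/(2v)) v = 5/2 v + 1/2.
    have h2 : (20 * (√n * √(κ * d / n))
        + (5 / 2 + 1 / (2 * v)) * (v * √n * √(2 * L / (v * n))))
        = √n * (20 * √(κ * d / n) + (5 / 2 * v + 1 / 2) * √(2 * L / (v * n))) := by
      field_simp
    rw [h2] at h1
    by_contra hcon
    push Not at hcon
    nlinarith
  · congr 1
    · have : 2 * v / n * L = v ^ 2 * (2 * L / (v * n)) := by field_simp
      rw [this, Real.sqrt_mul (by positivity), Real.sqrt_sq hv.le]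
    · have : 2 * κ * d / n = 2 * (κ * d / n) := by ring
      rw [this, Real.sqrt_mul (by norm_num), mul_assoc]
  · rw [Real.sq_sqrt (by positivity)]; field_simp

theorem sqrt_two_bounds : 9.63 ≤ 6.81 * √2 ∧ 6.81 * √2 ≤ 9.64 := by
  have h1 : (1.4142 : ℝ) ≤ √2 := Real.le_sqrt_of_sq_le (by norm_num)
  have h2 : √2 ≤ (1.4143 : ℝ) := Real.sqrt_le_iff.2 ⟨by norm_num, by norm_num⟩
  constructor <;> linarith

/-- The sample size condition bounds 20 a + 5/2 v l by 1, while 2μ is at most 2 v l + 19.28 a; the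
worst ratio is 0.964. -/
theorem mu_bounds (hκ : 1 < κ) (hd : 0 < d) (hε : 0 < ε) (hε1 : ε < 1)
    (h : sampleThreshold κ d ε < n) : 0 < mu κ d n ε ∧ 2 * mu κ d n ε < 0.97 := by
  obtain ⟨l, hl, -, H, hmu, -⟩ := exists_temperature hκ hd hε hε1 h
  have ha : 0 ≤ √(κ * d / n) := Real.sqrt_nonneg _
  have h2 := mul_le_mul_of_nonneg_right sqrt_two_bounds.2 ha
  have h1 := mul_le_mul_of_nonneg_right sqrt_two_bounds.1 ha
  have hvl : 0 < (κ - 1) * l := mul_pos (by linarith) hl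
  rw [hmu]
  constructor <;> nlinarith

theorem one_add_deltaHat (h : 2 * mu κ d n ε < 0.97) :
    1 + deltaHat κ d n ε = (1 - mu κ d n ε) / (1 - 2 * mu κ d n ε) := by
  unfold deltaHat
  have : 1 - 2 * mu κ d n ε ≠ 0 := by linarith
  rw [eq_div_iff this, add_mul, div_mul_cancel₀ _ this]
  ring

theorem deltaHat_nonneg (h : 0 < mu κ d n ε ∧ 2 * mu κ d n ε < 0.97) : 0 ≤ deltaHat κ d n ε :=
  div_nonneg h.1.le (by linarith [h.2])

/-- The left side is the loss at confidence level ε⁻¹ in the PAC-Bayesian bound, so this choice of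
lam turns that bound into ρ = |1 - γ₋| / (1 + δ̂). -/
theorem exists_lam_le (hκ : 1 < κ) (hd : 0 < d) (hε : 0 < ε) (hε1 : ε < 1)
    (h : sampleThreshold κ d ε < n) :
    ∃ lam : ℝ, 0 < lam ∧ lam ≤ 1 ∧
      lam * (κ - 1) / 2 + lam ^ 2 / 4 + 6.4 * √(κ * d / n)
        + (Real.log ε⁻¹ + 0.73 * d) / (n * lam)
        ≤ 1 - |1 - gammaMinus κ d n ε| / (1 + deltaHat κ d n ε) := by
  obtain ⟨l, hl, hl2, H, hmu, hg⟩ := exists_temperature hκ hd hε hε1 h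
  have hn : (0 : ℝ) < n := sampleThreshold_nonneg.trans_lt h
  have hv : 0 < κ - 1 := by linarith
  have ha : 0 ≤ √(κ * d / n) := Real.sqrt_nonneg _
  have h2 := mul_le_mul_of_nonneg_right sqrt_two_bounds.2 ha
  have h1 := mul_le_mul_of_nonneg_right sqrt_two_bounds.1 ha
  have h3 := gamma_tradeoff (m := mu κ d n ε) hv hl ha H (by linarith) (by linarith)
  have hmin : 0 < min l 1 := lt_min hl one_pos
  refine ⟨min l 1, hmin, min_le_right _ _, ?_⟩
  rw [one_add_deltaHat (mu_bounds hκ hd hε hε1 h).2, hg, ← div_mul_eq_mul_div₀,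
    div_eq_mul_inv |_|, inv_div] at *
  have e : (Real.log ε⁻¹ + 0.73 * d) / (n * min l 1) = (κ - 1) * l ^ 2 / 2 / min l 1 := by
    rw [hl2]; field_simp
  rw [e]
  exact h3

/-! ### Orders of magnitude -/

theorem sampleThreshold_le {κ₀ : ℝ} (hκ₀ : 1 < κ₀) (hκ : κ₀ ≤ κ) (hε : 0 < ε) (hε1 : ε < 1) :
    sampleThreshold κ d ε
      ≤ (20 + 2 * (5 / 2 + 1 / (2 * (κ₀ - 1)))) ^ 2 * (κ * (d + Real.log ε⁻¹)) := by
  have hlog : 0 < Real.log ε⁻¹ := Real.log_pos ((one_lt_inv₀ hε).2 hε1)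
  have hv : 0 < κ₀ - 1 := by linarith
  have hκ0 : 0 < κ := by linarith
  have hκ1 : 0 < κ - 1 := by linarith
  have hT : 0 ≤ κ * (d + Real.log ε⁻¹) := by positivity
  unfold sampleThreshold
  have h1 : √(κ * d) ≤ √(κ * (d + Real.log ε⁻¹)) := by
    apply Real.sqrt_le_sqrt; gcongr; linarith
  have h2 : √(2 * (κ - 1) * (Real.log ε⁻¹ + 0.73 * d)) ≤ 2 * √(κ * (d + Real.log ε⁻¹)) := by
    rw [Real.sqrt_le_left (by positivity), mul_pow, Real.sq_sqrt hT]
    have e1 : (κ - 1) * (Real.log ε⁻¹ + 0.73 * d) ≤ κ * (d + Real.log ε⁻¹) := by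
      apply mul_le_mul (by linarith) _ (by positivity) hκ0.le
      have : (0 : ℝ) ≤ d := by positivity
      linarith
    linarith
  have h3 : 1 / (2 * (κ - 1)) ≤ 1 / (2 * (κ₀ - 1)) := by gcongr
  calc _ ≤ (20 * √(κ * (d + Real.log ε⁻¹))
        + (5 / 2 + 1 / (2 * (κ₀ - 1))) * (2 * √(κ * (d + Real.log ε⁻¹)))) ^ 2 := by gcongr
    _ = (20 + 2 * (5 / 2 + 1 / (2 * (κ₀ - 1)))) ^ 2 * √(κ * (d + Real.log ε⁻¹)) ^ 2 := by ring
    _ = _ := by rw [Real.sq_sqrt hT]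

theorem sq_one_add_mul_sq_one_add_le {x y A B : ℝ} (hx : 0 ≤ x) (hy : 0 ≤ y) (hxA : x ≤ A)
    (hyB : y ≤ B) :
    (1 + x) ^ 2 * (1 + y) ^ 2 ≤ 1 + ((2 + A) * x + (1 + (2 + A) * A) * (2 + B) * y) := by
  have hA : 0 ≤ A := hx.trans hxA
  have hB : 0 ≤ B := hy.trans hyB
  have h1 : (1 + x) ^ 2 ≤ 1 + (2 + A) * x := by nlinarith
  have h2 : (1 + y) ^ 2 ≤ 1 + (2 + B) * y := by nlinarith
  have h3 : (1 + x) ^ 2 * (1 + y) ^ 2 ≤ (1 + (2 + A) * x) * (1 + (2 + B) * y) := by gcongr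
  have h4 : (2 + A) * x * ((2 + B) * y) ≤ (2 + A) * A * ((2 + B) * y) := by
    gcongr
  nlinarith

theorem deltaHat_le (hκ : 1 < κ) (hd : 0 < d) (hε : 0 < ε) (hε1 : ε < 1)
    (h : sampleThreshold κ d ε < n) :
    deltaHat κ d n ε ≤ 400 * √(κ * (d + Real.log ε⁻¹) / n) ∧ deltaHat κ d n ε ≤ 20 := by
  have hn : (0 : ℝ) < n := sampleThreshold_nonneg.trans_lt h
  have hlog : 0 < Real.log ε⁻¹ := Real.log_pos ((one_lt_inv₀ hε).2 hε1)
  have hd' : (0 : ℝ) < d := by exact_mod_cast hd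
  obtain ⟨l, hl, hl2, -, hmu, -⟩ := exists_temperature hκ hd hε hε1 h
  have hμ := mu_bounds hκ hd hε hε1 h
  have hv : 0 < κ - 1 := by linarith
  have hκ0 : 0 < κ := by linarith
  set ρ := √(κ * (d + Real.log ε⁻¹) / n) with hρ
  have hρ2 : ρ ^ 2 = κ * (d + Real.log ε⁻¹) / n := Real.sq_sqrt (by positivity)
  have hρ0 : 0 ≤ ρ := Real.sqrt_nonneg _
  have ha : √(κ * d / n) ≤ ρ := by
    apply Real.sqrt_le_sqrt; gcongr; linarith
  have ha0 : 0 ≤ √(κ * d / n) := Real.sqrt_nonneg _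
  have hvl : (κ - 1) * l ≤ 2 * ρ := by
    rw [← pow_le_pow_iff_left₀ (by positivity) (by positivity) two_ne_zero, mul_pow, mul_pow,
      hl2, hρ2]
    have e : (κ - 1) ^ 2 * (2 * (Real.log ε⁻¹ + 0.73 * d) / ((κ - 1) * n))
        = 2 * ((κ - 1) * (Real.log ε⁻¹ + 0.73 * d) / n) := by
      field_simp
    rw [e]
    have h1 : (κ - 1) * (Real.log ε⁻¹ + 0.73 * d) / n ≤ κ * (d + Real.log ε⁻¹) / n := by
      gcongr ?_ * ?_ / _ <;> linarith
    have h2 : 0 ≤ κ * (d + Real.log ε⁻¹) / n := by positivity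
    linarith
  have h1 : mu κ d n ε ≤ 12 * ρ := by
    rw [hmu]
    have := mul_le_mul_of_nonneg_right sqrt_two_bounds.2 ha0
    linarith
  unfold deltaHat
  have h2 : 0.03 ≤ 1 - 2 * mu κ d n ε := by linarith
  constructor
  · rw [div_le_iff₀ (by linarith)]
    have := mul_le_mul_of_nonneg_left h2 hρ0
    linarith
  · rw [div_le_iff₀ (by linarith)]
    linarith

theorem gammaMinus_le {κ₀ : ℝ} (hκ₀ : 1 < κ₀) (hκ : κ₀ ≤ κ) (hd : 0 < d) (hε : 0 < ε)
    (hε1 : ε < 1) (h : sampleThreshold κ d ε < n) :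
    0 ≤ gammaMinus κ d n ε ∧ gammaMinus κ d n ε ≤ 4 / 3 ∧
      gammaMinus κ d n ε ≤ √(2 / (κ₀ - 1)) * √(κ * (d + Real.log ε⁻¹) / n) := by
  have hn : (0 : ℝ) < n := sampleThreshold_nonneg.trans_lt h
  have hlog : 0 < Real.log ε⁻¹ := Real.log_pos ((one_lt_inv₀ hε).2 hε1)
  have hd' : (0 : ℝ) < d := by exact_mod_cast hd
  have hκ1 : 1 < κ := by linarith
  obtain ⟨l, hl, hl2, H, -, hgm⟩ := exists_temperature hκ1 hd hε hε1 h
  have hv₀ : 0 < κ₀ - 1 := by linarith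
  have hκ0 : 0 < κ := by linarith
  have hlρ : l ≤ √(2 / (κ₀ - 1)) * √(κ * (d + Real.log ε⁻¹) / n) := by
    rw [← Real.sqrt_mul (by positivity)]
    apply Real.le_sqrt_of_sq_le
    rw [hl2]
    calc 2 * (Real.log ε⁻¹ + 0.73 * d) / ((κ - 1) * n)
        ≤ 2 * (d + Real.log ε⁻¹) / ((κ₀ - 1) * n) := by
          gcongr 2 * ?_ / ((?_ - 1) * _)
          linarith
      _ = 2 / (κ₀ - 1) * (1 * (d + Real.log ε⁻¹) / n) := by field_simp
      _ ≤ _ := by gcongr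
  have hl2' : l < 2 := by
    have : 0 ≤ √(κ * d / n) := Real.sqrt_nonneg _
    nlinarith [mul_pos (show 0 < κ - 1 by linarith) hl]
  rw [hgm]
  refine ⟨by positivity, by nlinarith, le_trans (by nlinarith) hlρ⟩

/-- Since 1/(1 - γ) = 1 + γ/(1 - γ), the factor is (1 + δ̂)(1 + y), where δ̂ and y are both bounded
and of the order of the square root; a bounded product can be linearized. The bound 1 ≤ serves to
pass from the square to the factor itself. -/
theorem factor_sq_le {κ₀ g : ℝ} (hκ₀ : 1 < κ₀) (hg : g < 1) :
    ∃ c : ℝ, 0 < c ∧ ∀ (d n : ℕ) (κ ε : ℝ), 0 < d → κ₀ ≤ κ → 0 < ε → ε < 1 →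
      sampleThreshold κ d ε < n → gammaMinus κ d n ε ≤ g →
      1 ≤ (1 + deltaHat κ d n ε) / (1 - gammaMinus κ d n ε) ∧
      ((1 + deltaHat κ d n ε) / (1 - gammaMinus κ d n ε)) ^ 2
        ≤ 1 + c * √(κ * (d + Real.log ε⁻¹) / n) := by
  have hv₀ : 0 < κ₀ - 1 := by linarith
  have hg' : 0 < 1 - g := by linarith
  set B := 4 / 3 / (1 - g) with hB
  have hB0 : 0 < B := by positivity
  set K := √(2 / (κ₀ - 1)) / (1 - g) with hK
  have hK0 : 0 < K := by positivity
  refine ⟨22 * 400 + 441 * (2 + B) * K, by positivity, ?_⟩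
  intro d n κ ε hd hκ hε hε1 h hγ
  have hκ1 : 1 < κ := by linarith
  have hδ := deltaHat_nonneg (mu_bounds hκ1 hd hε hε1 h)
  obtain ⟨hx1, hx2⟩ := deltaHat_le hκ1 hd hε hε1 h
  obtain ⟨hγ0, hγ4, hγρ⟩ := gammaMinus_le hκ₀ hκ hd hε hε1 h
  generalize deltaHat κ d n ε = x at *
  generalize gammaMinus κ d n ε = γ at *
  generalize √(κ * (d + Real.log ε⁻¹) / n) = ρ at *
  have hγ1 : 0 < 1 - γ := by linarith
  have hy0 : 0 ≤ γ / (1 - γ) := by positivity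
  have hy1 : γ / (1 - γ) ≤ K * ρ := by
    calc γ / (1 - γ) ≤ (√(2 / (κ₀ - 1)) * ρ) / (1 - g) := by gcongr; linarith
      _ = _ := by rw [hK]; ring
  have hy2 : γ / (1 - γ) ≤ B := by
    rw [hB]; gcongr
  have e : (1 + x) / (1 - γ) = (1 + x) * (1 + γ / (1 - γ)) := by
    field_simp; ring
  rw [e]
  generalize γ / (1 - γ) = y at *
  refine ⟨by nlinarith [mul_nonneg hδ hy0], ?_⟩
  rw [mul_pow]
  refine (sq_one_add_mul_sq_one_add_le hδ hy0 hx2 hy2).trans ?_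
  have k1 : (2 + 20) * x ≤ (2 + 20) * (400 * ρ) := by gcongr
  have k2 : (1 + (2 + 20) * 20) * (2 + B) * y ≤ (1 + (2 + 20) * 20) * (2 + B) * (K * ρ) := by
    gcongr
  linarith

/-- With r = n/κ, log ε⁻¹ = log (κM/C) + 2 log r + log κ. Here log κ ≤ log (κM/C) because C ≤ M, and
log r ≤ r/(8c₁) + log (8c₁) is absorbed into r itself. -/
theorem sampleThreshold_lt_of_le {κ₀ c₁ : ℝ} (hκ₀ : 1 < κ₀) (hc₁ : 1 ≤ c₁)
    (H : ∀ (d : ℕ) (κ ε : ℝ), κ₀ ≤ κ → 0 < ε → ε < 1 →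
      sampleThreshold κ d ε ≤ c₁ * (κ * (d + Real.log ε⁻¹)))
    {d n : ℕ} {κ C M c : ℝ} (hd : 0 < d) (hκ : κ₀ ≤ κ) (hC : 0 < C) (hCM : C ≤ M)
    (hc : 8 * c₁ + 8 * c₁ * Real.log (8 * c₁) ≤ c)
    (hn : c * (κ * (d + Real.log (κ * M / C))) < n) :
    C / (M * n ^ 2) < 1 ∧ sampleThreshold κ d (C / (M * n ^ 2)) < n := by
  have hM : 0 < M := hC.trans_le hCM
  have hκ0 : 0 < κ := by linarith
  have hd' : (1 : ℝ) ≤ d := by exact_mod_cast hd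
  have hq : κ ≤ κ * M / C := by
    rw [mul_div_assoc]
    have : 1 ≤ M / C := (one_le_div₀ hC).2 hCM
    nlinarith
  have hlogκ : 0 < Real.log κ := Real.log_pos (by linarith)
  have hlq : Real.log κ ≤ Real.log (κ * M / C) := Real.log_le_log hκ0 hq
  have hl8 : 0 < Real.log (8 * c₁) := Real.log_pos (by linarith)
  have hc8 : 8 * c₁ ≤ c := by nlinarith
  have hc8' : 8 * c₁ * Real.log (8 * c₁) ≤ c := by linarith
  have hc0 : 0 < c := by linarith
  set r := (n : ℝ) / κ with hr
  have hnr : (n : ℝ) = κ * r := by rw [hr]; field_simp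
  have hrT : c * (d + Real.log (κ * M / C)) < r := by
    rw [hr, lt_div_iff₀ hκ0]; linarith
  have hrc : c ≤ r := by nlinarith
  have hr0 : 0 < r := by linarith
  have hn1 : 1 < (n : ℝ) := by rw [hnr]; nlinarith
  have hn0 : (0 : ℝ) < n := by linarith
  have hε : C / (M * n ^ 2) < 1 := by
    rw [div_lt_one (by positivity)]
    have : 1 < (n : ℝ) ^ 2 := one_lt_pow₀ hn1 two_ne_zero
    nlinarith
  refine ⟨hε, (H d κ _ hκ (by positivity) hε).trans_lt ?_⟩
  have hlog : Real.log (C / (M * n ^ 2))⁻¹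
      = Real.log (κ * M / C) + 2 * Real.log r + Real.log κ := by
    have e : (C / (M * n ^ 2))⁻¹ = (κ * M / C) * r ^ 2 * κ := by
      rw [hnr]; field_simp
    rw [e, Real.log_mul (by positivity) hκ0.ne', Real.log_mul (by positivity) (by positivity),
      Real.log_pow]
    norm_num
  have hlr : Real.log r ≤ r / (8 * c₁) + Real.log (8 * c₁) := by
    have h1 := Real.log_le_sub_one_of_pos (show 0 < r / (8 * c₁) by positivity)
    rw [Real.log_div hr0.ne' (by positivity)] at h1
    linarith
  rw [hlog]
  have h1 : c₁ * (d + (Real.log (κ * M / C) + 2 * Real.log r + Real.log κ)) < r := by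
    have k1 : c₁ * (2 * Real.log r) ≤ r / 4 + 2 * c₁ * Real.log (8 * c₁) := by
      calc c₁ * (2 * Real.log r) ≤ c₁ * (2 * (r / (8 * c₁) + Real.log (8 * c₁))) := by gcongr
        _ = _ := by field_simp; ring
    have k2 : 8 * c₁ * (d + Real.log (κ * M / C)) ≤ r := by
      have : 8 * c₁ * (d + Real.log (κ * M / C)) ≤ c * (d + Real.log (κ * M / C)) := by
        gcongr
        linarith
      linarith
    have k3 : c₁ * (d + (Real.log (κ * M / C) + Real.log κ))
        ≤ c₁ * (2 * (d + Real.log (κ * M / C))) := by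
      gcongr; linarith
    linarith
  calc _ = κ * (c₁ * (d + (Real.log (κ * M / C) + 2 * Real.log r + Real.log κ))) := by ring
    _ < κ * r := by gcongr
    _ = n := hnr.symm

theorem orders_of_magnitude (κ₀ g : ℝ) (hκ₀ : 1 < κ₀) (hg : g < 1) : ∃ c : ℝ, 0 < c ∧
    (∀ (d n : ℕ) (κ ε : ℝ), 1 ≤ d → κ₀ ≤ κ → 0 < ε → ε < 1 →
      sampleThreshold κ d ε ≤ c * (κ * (d + Real.log ε⁻¹)) ∧
      (sampleThreshold κ d ε < n → gammaMinus κ d n ε ≤ g →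
        (1 + deltaHat κ d n ε) ^ 2 / (1 - gammaMinus κ d n ε) ^ 2
            ≤ 1 + c * √(κ * (d + Real.log ε⁻¹) / n) ∧
        (∀ p : ℝ, 1 - ε ≤ p →
          (1 + deltaHat κ d n ε) ^ 2 / ((1 - gammaMinus κ d n ε) ^ 2 * p)
            ≤ (1 + c * √(κ * (d + Real.log ε⁻¹) / n)) * (1 - ε)⁻¹) ∧
        (1 + deltaHat κ d n ε) / (1 - gammaMinus κ d n ε)
            ≤ 1 + c * √(κ * (d + Real.log ε⁻¹) / n))) ∧
    (∀ (d n : ℕ) (κ C M : ℝ), 1 ≤ d → κ₀ ≤ κ → 0 < C → C ≤ M →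
      c * (κ * (d + Real.log (κ * M / C))) < n →
        C / (M * n ^ 2) < 1 ∧ sampleThreshold κ d (C / (M * n ^ 2)) < n) := by
  obtain ⟨c₂, hc₂, H₂⟩ := factor_sq_le hκ₀ hg
  set c₁ := (20 + 2 * (5 / 2 + 1 / (2 * (κ₀ - 1)))) ^ 2 with hc₁
  have hc₁1 : 1 ≤ c₁ := by
    have : 0 < 1 / (2 * (κ₀ - 1)) := by
      have : 0 < κ₀ - 1 := by linarith
      positivity
    rw [hc₁]; nlinarith
  have hl : 0 < Real.log (8 * c₁) := Real.log_pos (by linarith)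
  have hp : 0 < c₁ * Real.log (8 * c₁) := by positivity
  set c := c₂ + (8 * c₁ + 8 * c₁ * Real.log (8 * c₁)) with hc
  refine ⟨c, by positivity, ?_, ?_⟩
  · intro d n κ ε hd hκ hε hε1
    have hlog : 0 < Real.log ε⁻¹ := Real.log_pos ((one_lt_inv₀ hε).2 hε1)
    have hκ0 : 0 < κ := by linarith
    refine ⟨(sampleThreshold_le hκ₀ hκ hε hε1).trans ?_, ?_⟩
    · gcongr; rw [hc]; nlinarith
    · intro hn hγ
      obtain ⟨h1, h2⟩ := H₂ d n κ ε hd hκ hε hε1 hn hγ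
      have h3 : 1 + c₂ * √(κ * (d + Real.log ε⁻¹) / n)
          ≤ 1 + c * √(κ * (d + Real.log ε⁻¹) / n) := by
        gcongr; rw [hc]; nlinarith
      have h4 := h2.trans h3
      rw [div_pow] at h4
      refine ⟨h4, ?_, ?_⟩
      · intro p hp
        rw [← div_div, ← div_eq_mul_inv]
        gcongr
      · have : (1 + deltaHat κ d n ε) / (1 - gammaMinus κ d n ε)
            ≤ ((1 + deltaHat κ d n ε) / (1 - gammaMinus κ d n ε)) ^ 2 := by nlinarith
        exact this.trans (h2.trans h3)
  · intro d n κ C M hd hκ hC hCM hn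
    exact sampleThreshold_lt_of_le hκ₀ hc₁1
      (fun d κ ε h1 h2 h3 => sampleThreshold_le hκ₀ h1 h2 h3) hd hκ hC hCM
      (by rw [hc]; linarith) hn

end LeastSquares

end

/-! ### From the Gram lower bound to the explicit risk bounds. -/

noncomputable section

namespace LeastSquares

section Regression

variable {d n : ℕ} {Ω₀ Ω : Type*} [MeasurableSpace Ω₀] [MeasurableSpace Ω]
  {P₀ : Measure Ω₀} [IsProbabilityMeasure P₀] {P : Measure Ω} [IsProbabilityMeasure P]
  {X : Ω₀ → EuclideanSpace ℝ (Fin d)} {Y : Ω₀ → ℝ}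
  {Xs : Fin n → Ω → EuclideanSpace ℝ (Fin d)} {Ys : Fin n → Ω → ℝ}
  {θs : EuclideanSpace ℝ (Fin d)} {θh : Ω → EuclideanSpace ℝ (Fin d)} {σ κ ε : ℝ}

/-- Markov's inequality at level ε⁻¹. -/
theorem one_sub_le_measureReal_of_lintegral_le_one {V : Ω → ℝ≥0∞} (hV : Measurable V)
    (h1 : ∫⁻ ω, V ω ∂P ≤ 1) (hε : 0 < ε) :
    1 - ε ≤ P.real {ω | V ω ≤ ENNReal.ofReal ε⁻¹} := by
  have hm : MeasurableSet {ω | V ω ≤ ENNReal.ofReal ε⁻¹} := measurableSet_le hV measurable_const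
  have h2 := mul_meas_ge_le_lintegral hV (ENNReal.ofReal ε⁻¹) (μ := P)
  have h3 : P {ω | V ω ≤ ENNReal.ofReal ε⁻¹}ᶜ ≤ ENNReal.ofReal ε := by
    have h4 : P {ω | V ω ≤ ENNReal.ofReal ε⁻¹}ᶜ ≤ P {ω | ENNReal.ofReal ε⁻¹ ≤ V ω} :=
      by
      refine measure_mono fun ω hω => ?_
      simp only [Set.mem_compl_iff, Set.mem_ofPred_eq, not_le] at hω
      exact hω.le
    calc P {ω | V ω ≤ ENNReal.ofReal ε⁻¹}ᶜ
        = ENNReal.ofReal ε * (ENNReal.ofReal ε⁻¹ * P {ω | V ω ≤ ENNReal.ofReal ε⁻¹}ᶜ) := by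
          rw [← mul_assoc, ← ENNReal.ofReal_mul hε.le, mul_inv_cancel₀ hε.ne']
          simp
      _ ≤ ENNReal.ofReal ε * 1 := by
          gcongr
          exact (mul_le_mul_right h4 _).trans (h2.trans h1)
      _ = _ := mul_one _
  have h5 : P.real {ω | V ω ≤ ENNReal.ofReal ε⁻¹}ᶜ ≤ ε := by
    rw [measureReal_def]
    exact ENNReal.toReal_le_of_le_ofReal hε.le h3
  rw [probReal_compl_eq_one_sub hm] at h5
  linarith

namespace IsRegression

variable (h : IsRegression P₀ X Y P Xs Ys θs θh)
include h

theorem excessRisk_eq_zero (h0 : ∀ u, ∫ ω, inner ℝ u (X ω) ^ 2 ∂P₀ = 0) :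
    excessRisk P₀ X Y θs θh = 0 := by
  ext ω
  rw [h.excessRisk_eq, norm_gramSqrt_sq h.memLp_X, h0]
  rfl

/-- The event is cut out by V ≤ ε⁻¹. It is a condition on the design alone, as the conditional
statement requires. -/
theorem exists_design_event (hκ : (kurtosis P₀ X).toReal ≤ κ) (hκ1 : 1 < κ) (hd : 0 < d)
    (hε : 0 < ε) (hε1 : ε < 1) (hn : sampleThreshold κ d ε < n) :
    ∃ A : Set (Fin n → EuclideanSpace ℝ (Fin d)), MeasurableSet A ∧
      1 - ε ≤ P.real ((fun ω i => Xs i ω) ⁻¹' A) ∧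
      ∀ x ∈ A, GramLowerBound (P₀.map fun ω => whiten P₀ X (X ω)) (fun i => whiten P₀ X (x i))
        (|1 - gammaMinus κ d n ε| / (1 + deltaHat κ d n ε)) := by
  have hn0 : (0 : ℝ) < n := sampleThreshold_nonneg.trans_lt hn
  have hnp : 0 < n := by exact_mod_cast hn0
  obtain ⟨lam, hl, hl1, hlam⟩ := exists_lam_le hκ1 hd hε hε1 hn
  have hQ : IsProbabilityMeasure (P₀.map fun ω => whiten P₀ X (X ω)) :=
    Measure.isProbabilityMeasure_map
      ((whiten P₀ X).continuous.measurable.comp_aemeasurable h.memLp_X.1.aemeasurable)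
  have hmW : ∀ i, Measurable fun ω => whiten P₀ X (Xs i ω) := fun i =>
    (whiten P₀ X).continuous.measurable.comp (h.measurable_Xs i)
  obtain ⟨V, hV, hV1, hVl⟩ := (hasMoments_whiten h.memLp_X h.kurtosis_lt_top hκ).exists_evidence
    hκ1.le hd hnp hl hl1 hmW h.iIndepFun_whiten h.map_whiten
  have hV' : Measurable fun x : Fin n → EuclideanSpace ℝ (Fin d) => V fun i => whiten P₀ X (x i) :=
    hV.comp (measurable_pi_lambda _ fun i =>
      (whiten P₀ X).continuous.measurable.comp (measurable_pi_apply i))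
  refine ⟨{x | V (fun i => whiten P₀ X (x i)) ≤ ENNReal.ofReal ε⁻¹},
    measurableSet_le hV' measurable_const, ?_, ?_⟩
  · exact one_sub_le_measureReal_of_lintegral_le_one
      (hV.comp (measurable_pi_lambda _ hmW)) hV1 hε
  · intro x hx θ hθ hθ2
    have h1 := (hVl (fun i => whiten P₀ X (x i)) θ hθ hθ2).trans hx
    have hiε : 0 < ε⁻¹ := by positivity
    rw [ENNReal.ofReal_le_ofReal_iff hiε.le, ← Real.le_log_iff_exp_le hiε] at h1
    set t := (∑ i, inner ℝ θ (whiten P₀ X (x i)) ^ 2) / (n : ℝ)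
    have h2 : 1 - t - lam * (κ - 1) / 2 - lam ^ 2 / 4 - 6.4 * √(κ * d / n)
        ≤ (Real.log ε⁻¹ + 0.73 * d) / (n * lam) := by
      rw [le_div_iff₀ (by positivity)]
      linarith
    linarith

theorem setIntegral_excessRisk_le (hn : 0 < n) {A : Set Ω} (hA : MeasurableSet A) {ρ : ℝ}
    (hρ : 0 < ρ)
    (hlow : ∀ ω ∈ A, GramLowerBound (P₀.map fun ω => whiten P₀ X (X ω))
      (fun i => whiten P₀ X (Xs i ω)) ρ) :
    IntegrableOn (excessRisk P₀ X Y θs θh) A P ∧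
      ∫ ω in A, excessRisk P₀ X Y θs θh ω ∂P
        ≤ (rateConst P₀ X Y θs).toReal / (n * ρ ^ 2) := by
  have hn' : (0 : ℝ) < n := by exact_mod_cast hn
  have hi := h.integrable_norm_sum_score_sq.div_const ((n * ρ) ^ 2)
  have hle : ∀ᵐ ω ∂(P.restrict A), excessRisk P₀ X Y θs θh ω
      ≤ ‖∑ i, (Ys i ω - inner ℝ θs (Xs i ω)) • whiten P₀ X (Xs i ω)‖ ^ 2 / (n * ρ) ^ 2 := by
    rw [ae_restrict_iff' hA]
    filter_upwards [h.ae_excessRisk_le_of_gramLowerBound hn] with ω hω hωA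
    exact hω ρ hρ (hlow ω hωA)
  have hint : IntegrableOn (excessRisk P₀ X Y θs θh) A P := by
    refine Integrable.mono' hi.integrableOn h.measurable_excessRisk.aestronglyMeasurable ?_
    filter_upwards [hle] with ω hω
    rw [Real.norm_of_nonneg (h.excessRisk_nonneg ω)]
    exact hω
  refine ⟨hint, (integral_mono_ae hint hi.integrableOn hle).trans ?_⟩
  refine (setIntegral_le_integral hi (Filter.Eventually.of_forall fun ω => ?_)).trans_eq ?_
  · simp only [Pi.zero_apply]; positivity
  · rw [integral_div, h.integral_norm_sum_score_sq]
    field_simp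

theorem integral_cond_excessRisk_le (hn : 0 < n) {A : Set Ω} (hA : MeasurableSet A) {ρ : ℝ}
    (hρ : 0 < ρ)
    (hlow : ∀ ω ∈ A, GramLowerBound (P₀.map fun ω => whiten P₀ X (X ω))
      (fun i => whiten P₀ X (Xs i ω)) ρ) (hPA : 0 < P.real A) :
    Integrable (excessRisk P₀ X Y θs θh) (P[|A]) ∧
      ∫ ω, excessRisk P₀ X Y θs θh ω ∂(P[|A])
        ≤ (1 / ρ) ^ 2 / P.real A * ((rateConst P₀ X Y θs).toReal / n) := by
  obtain ⟨h1, h2⟩ := h.setIntegral_excessRisk_le hn hA hρ hlow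
  have hPA' : P A ≠ 0 := fun h0 => by simp [measureReal_def, h0] at hPA
  unfold ProbabilityTheory.cond
  refine ⟨h1.smul_measure (ENNReal.inv_ne_top.2 hPA'), ?_⟩
  rw [integral_smul_measure, ENNReal.toReal_inv, ← measureReal_def, smul_eq_mul]
  calc _ ≤ (P.real A)⁻¹ * ((rateConst P₀ X Y θs).toReal / (n * ρ ^ 2)) := by gcongr
    _ = _ := by field_simp

theorem integrable_min_excessRisk {M : ℝ} (hM : 0 ≤ M) :
    Integrable (fun ω => min (excessRisk P₀ X Y θs θh ω) M) P := by
  refine Integrable.of_bound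
    (h.measurable_excessRisk.min measurable_const).aestronglyMeasurable M
    (Filter.Eventually.of_forall fun ω => ?_)
  rw [Real.norm_of_nonneg (le_min (h.excessRisk_nonneg ω) hM)]
  exact min_le_right _ _

theorem integral_min_excessRisk_le {A : Set Ω} (hn : 0 < n) (hA : MeasurableSet A) {ρ M : ℝ}
    (hρ : 0 < ρ)
    (hlow : ∀ ω ∈ A, GramLowerBound (P₀.map fun ω => whiten P₀ X (X ω))
      (fun i => whiten P₀ X (Xs i ω)) ρ) (hPA : 1 - ε ≤ P.real A) (hM : 0 ≤ M) :
    ∫ ω, min (excessRisk P₀ X Y θs θh ω) M ∂P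
      ≤ (rateConst P₀ X Y θs).toReal / (n * ρ ^ 2) + ε * M := by
  obtain ⟨h1, h2⟩ := h.setIntegral_excessRisk_le hn hA hρ hlow
  have hi := h.integrable_min_excessRisk hM
  rw [← integral_add_compl hA hi]
  refine add_le_add (le_trans ?_ h2) ?_
  · exact integral_mono hi.integrableOn h1 fun ω => min_le_left _ _
  · calc _ ≤ ∫ _ in Aᶜ, M ∂P :=
          integral_mono hi.integrableOn (integrable_const _) fun ω => min_le_right _ _
      _ = P.real Aᶜ * M := by simp
      _ ≤ ε * M := by
          gcongr
          rw [probReal_compl_eq_one_sub hA]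
          linarith

theorem explicit_bounds (hκ : (kurtosis P₀ X).toReal ≤ κ) (hκ1 : 1 < κ) (hd : 0 < d)
    (hε : 0 < ε) (hε1 : ε < 1) (hn : sampleThreshold κ d ε < n) :
    (gammaMinus κ d n ε ≠ 1 →
      (∃ A : Set Ω, MeasurableSet A ∧ 1 - ε ≤ P.real A ∧
        Integrable (excessRisk P₀ X Y θs θh) (P[|A]) ∧
        ∫ ω, excessRisk P₀ X Y θs θh ω ∂(P[|A])
          ≤ (1 + deltaHat κ d n ε) ^ 2 / ((1 - gammaMinus κ d n ε) ^ 2 * P.real A)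
              * ((rateConst P₀ X Y θs).toReal / n)) ∧
      (∀ M : ℝ, 0 ≤ M →
        ∫ ω, min (excessRisk P₀ X Y θs θh ω) M ∂P
          ≤ (1 + deltaHat κ d n ε) ^ 2 * (rateConst P₀ X Y θs).toReal
              / ((1 - gammaMinus κ d n ε) ^ 2 * n) + ε * M)) ∧
    (∀ σ : ℝ, HasIndepNoise P₀ X Y θs σ → gammaMinus κ d n ε < 1 →
      1 - ε ≤ P.real {ω | condLExp (designSigma Xs) P
          (fun ω' => ENNReal.ofReal (excessRisk P₀ X Y θs θh ω')) ω
            ≤ ENNReal.ofReal ((1 + deltaHat κ d n ε) * d * σ ^ 2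
                / ((1 - gammaMinus κ d n ε) * n))}) := by
  have hn0 : (0 : ℝ) < n := sampleThreshold_nonneg.trans_lt hn
  have hnp : 0 < n := by exact_mod_cast hn0
  have hδ := deltaHat_nonneg (mu_bounds hκ1 hd hε hε1 hn)
  have hδ1 : 0 < 1 + deltaHat κ d n ε := by linarith
  obtain ⟨A, hA, hPA, hlow⟩ := h.exists_design_event hκ hκ1 hd hε hε1 hn
  have hmX : Measurable fun ω i => Xs i ω := measurable_pi_lambda _ h.measurable_Xs
  refine ⟨fun hγ => ?_, fun σ hσ hγ => ?_⟩
  · have hγ' : 0 < |1 - gammaMinus κ d n ε| := abs_pos.2 (sub_ne_zero.2 hγ.symm)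
    have hρ : 0 < |1 - gammaMinus κ d n ε| / (1 + deltaHat κ d n ε) := by positivity
    -- Only the square of 1 - γ₋ enters these two bounds, so γ₋ > 1 is harmless.
    have hsq := sq_abs (1 - gammaMinus κ d n ε)
    refine ⟨⟨_, hmX hA, hPA, ?_⟩, fun M hM => ?_⟩
    · obtain ⟨h1, h2⟩ := h.integral_cond_excessRisk_le hnp (hmX hA) hρ
        (fun ω hω => hlow _ hω) (by linarith)
      refine ⟨h1, h2.trans_eq ?_⟩
      rw [one_div_div, div_pow, hsq, div_div]
    · refine (h.integral_min_excessRisk_le hnp (hmX hA) hρ (fun ω hω => hlow _ hω) hPA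
        hM).trans_eq ?_
      rw [div_pow, hsq]
      congr 1
      have : (1 - gammaMinus κ d n ε) ^ 2 ≠ 0 := by rw [← hsq]; positivity
      field_simp
  · have hγ' : 0 < 1 - gammaMinus κ d n ε := by linarith
    -- The conditional bound is linear in 1/ρ, so here the sign of 1 - γ₋ matters.
    rw [abs_of_pos hγ'] at hlow
    refine hPA.trans ((h.measureReal_condLExp_le hσ hnp hA (by positivity) hlow).trans_eq ?_)
    congr 5
    field_simp

end IsRegression

theorem kurtosis_eq_zero_of_dim {X : Ω₀ → EuclideanSpace ℝ (Fin 0)} : kurtosis P₀ X = 0 := by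
  unfold kurtosis
  simp [Subsingleton.elim _ (0 : EuclideanSpace ℝ (Fin 0))]

end Regression

/-- The bounds for an inflated kurtosis coefficient, in terms of `ρ² = κ (d + log ε⁻¹) / n`. -/
theorem exists_numerical_factor : ∃ c : ℝ, 0 < c ∧ ∀ (d n : ℕ) (κ ε : ℝ), 0 < d → 0 < n →
    1 ≤ κ → 0 < ε → ε < 1 → c * (κ * (d + Real.log ε⁻¹)) ≤ n →
    sampleThreshold (2 * κ) d ε < n ∧ gammaMinus (2 * κ) d n ε ≤ 1 / 2 ∧
      (∀ p : ℝ, 1 - ε ≤ p →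
        (1 + deltaHat (2 * κ) d n ε) ^ 2 / ((1 - gammaMinus (2 * κ) d n ε) ^ 2 * p)
          ≤ (1 + c * √(κ * (d + Real.log ε⁻¹) / n)) * (1 - ε)⁻¹) ∧
      (1 + deltaHat (2 * κ) d n ε) / (1 - gammaMinus (2 * κ) d n ε)
        ≤ 1 + c * √(κ * (d + Real.log ε⁻¹) / n) := by
  -- Only κ ≥ 1 is available; using 2κ ≥ 2 keeps the denominators κ - 1 away from zero.
  obtain ⟨c, hc, H, -⟩ := orders_of_magnitude 2 (1 / 2) one_lt_two (by norm_num)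
  refine ⟨2 * c + 2, by positivity, ?_⟩
  intro d n κ ε hd hn hκ hε hε1 hle
  have hlog : 0 < Real.log ε⁻¹ := Real.log_pos ((one_lt_inv₀ hε).2 hε1)
  have hd' : (0 : ℝ) < d := by exact_mod_cast hd
  have hn' : (0 : ℝ) < n := by exact_mod_cast hn
  have hT : 0 < d + Real.log ε⁻¹ := by positivity
  have hκT : 0 < κ * (d + Real.log ε⁻¹) := by positivity
  obtain ⟨h1, h2⟩ := H d n (2 * κ) ε hd (by linarith) hε hε1
  have h3 : sampleThreshold (2 * κ) d ε < n := by linarith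
  have h4 : gammaMinus (2 * κ) d n ε ≤ 1 / 2 := by
    unfold gammaMinus
    have : 0 < 2 * κ - 1 := by linarith
    rw [div_le_iff₀ (by positivity)]
    have h5 : 2 * (d + Real.log ε⁻¹) ≤ n := by nlinarith [mul_pos hc hκT]
    nlinarith
  obtain ⟨-, h5, h6⟩ := h2 h3 h4
  have h7 : 1 + c * √(2 * κ * (d + Real.log ε⁻¹) / n)
      ≤ 1 + (2 * c + 2) * √(κ * (d + Real.log ε⁻¹) / n) := by
    have : √(2 * κ * (d + Real.log ε⁻¹) / n) ≤ 2 * √(κ * (d + Real.log ε⁻¹) / n) := by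
      rw [Real.sqrt_le_left (by positivity), mul_pow, Real.sq_sqrt (by positivity)]
      have : 0 ≤ κ * (d + Real.log ε⁻¹) / n := by positivity
      calc _ = 2 * (κ * (d + Real.log ε⁻¹) / n) := by ring
        _ ≤ _ := by linarith
    have h8 : 0 ≤ √(κ * (d + Real.log ε⁻¹) / n) := Real.sqrt_nonneg _
    nlinarith
  refine ⟨h3, h4, fun p hp => (h5 p hp).trans ?_, h6.trans h7⟩
  have : 0 < 1 - ε := by linarith
  gcongr

end LeastSquares

end

/-! ### Truncated expectation with a numerical constant. -/

noncomputable section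

namespace LeastSquares

theorem one_le_one_add_mul_one_sub_sq {x : ℝ} (h0 : 0 ≤ x) (h1 : x ≤ 1 / 2) :
    1 ≤ (1 + 6 * x) * (1 - x) ^ 2 := by
  nlinarith [mul_nonneg h0 (mul_nonneg (show 0 ≤ 1 / 2 - x by linarith)
    (show 0 ≤ 8 - 6 * x by linarith))]

/-- The Young inequality `s log (1 + G) ≤ s log s - s + 1 + G`, for `s ≤ m`. -/
theorem mul_log_one_add_le {s m G : ℝ} (hs : 0 ≤ s) (hsm : s ≤ m) (hG : 0 ≤ G) :
    s * Real.log (1 + G) ≤ 1 + G + s * Real.log m := by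
  rcases hs.eq_or_lt with h0 | hpos
  · rw [← h0]; linarith
  · have h1 := Real.log_le_sub_one_of_pos (show 0 < (1 + G) / s by positivity)
    rw [Real.log_div (by positivity) hpos.ne'] at h1
    have h2 : Real.log s ≤ Real.log m := Real.log_le_log hpos hsm
    have h3 : s * ((1 + G) / s) = 1 + G := by field_simp
    nlinarith

/-- The relation gives rρ = (D + log m)/ρ, which for small ρ makes rρ/4 at least log m + 1/(8ρ). The
first term cancels m, and exp (-1/(8ρ)) ≤ 8ρ. -/
theorem mul_exp_neg_le {m ρ r D : ℝ} (hm : 1 < m) (hD : 1 ≤ D) (hρ : 0 < ρ) (hρ1 : ρ ≤ 1 / 32)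
    (h : r * ρ ^ 2 = D + Real.log m) : m * Real.exp (-(r * ρ / 4)) ≤ 8 * ρ := by
  have hl : 0 < Real.log m := Real.log_pos hm
  have h1 : r * ρ = (D + Real.log m) / ρ := by rw [← h]; field_simp
  have h2 : Real.log m + 1 / (8 * ρ) ≤ r * ρ / 4 := by
    rw [h1, div_div, ← sub_nonneg]
    have : (D + Real.log m) / (ρ * 4) - (Real.log m + 1 / (8 * ρ))
        = (2 * D - 1 + Real.log m * (2 - 8 * ρ)) / (8 * ρ) := by field_simp; ring
    rw [this]
    have : 0 ≤ Real.log m * (2 - 8 * ρ) := mul_nonneg hl.le (by linarith)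
    apply div_nonneg <;> linarith
  have h3 : Real.exp (-(r * ρ / 4)) ≤ Real.exp (-Real.log m) * Real.exp (-(1 / (8 * ρ))) := by
    rw [← Real.exp_add]
    apply Real.exp_le_exp.2; linarith
  have h4 : Real.exp (-(1 / (8 * ρ))) ≤ 8 * ρ := by
    rw [Real.exp_neg]
    refine inv_le_of_inv_le₀ (by positivity) ?_
    have := Real.add_one_le_exp (1 / (8 * ρ))
    rw [← one_div]; linarith
  have h5 : Real.exp (-Real.log m) = m⁻¹ := by rw [Real.exp_neg, Real.exp_log (by linarith)]
  calc m * Real.exp (-(r * ρ / 4)) ≤ m * (m⁻¹ * (8 * ρ)) := by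
        rw [h5] at h3
        gcongr
        exact h3.trans (by gcongr)
    _ = 8 * ρ := by field_simp

section Regression

variable {d n : ℕ} {Ω₀ Ω : Type*} [MeasurableSpace Ω₀] [MeasurableSpace Ω]
  {P₀ : Measure Ω₀} [IsProbabilityMeasure P₀] {P : Measure Ω} [IsProbabilityMeasure P]
  {X : Ω₀ → EuclideanSpace ℝ (Fin d)} {Y : Ω₀ → ℝ}
  {Xs : Fin n → Ω → EuclideanSpace ℝ (Fin d)} {Ys : Fin n → Ω → ℝ}
  {θs : EuclideanSpace ℝ (Fin d)} {θh : Ω → EuclideanSpace ℝ (Fin d)} {σ κ : ℝ}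

namespace IsRegression

variable (h : IsRegression P₀ X Y P Xs Ys θs θh)
include h

/-- The lower bound for the empirical Gram matrix, with a random level `log (1 + G)`. -/
theorem exists_gramLowerBound_log (hκ : (kurtosis P₀ X).toReal ≤ κ) (hκ1 : 1 ≤ κ) (hd : 0 < d)
    (hn : 0 < n) {lam : ℝ} (hl : 0 < lam) (hl1 : lam ≤ 1) :
    ∃ G : Ω → ℝ, (∀ ω, 0 ≤ G ω) ∧ Measurable G ∧ Integrable G P ∧ ∫ ω, G ω ∂P ≤ 1 ∧
      ∀ᵐ ω ∂P, GramLowerBound (P₀.map fun ω => whiten P₀ X (X ω))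
        (fun i => whiten P₀ X (Xs i ω))
        (1 - (lam * (κ - 1) / 2 + lam ^ 2 / 4 + 6.4 * √(κ * d / n) + 0.73 * d / (n * lam)
          + Real.log (1 + G ω) / (n * lam))) := by
  have hn' : (0 : ℝ) < n := by exact_mod_cast hn
  have hQ : IsProbabilityMeasure (P₀.map fun ω => whiten P₀ X (X ω)) :=
    Measure.isProbabilityMeasure_map
      ((whiten P₀ X).continuous.measurable.comp_aemeasurable h.memLp_X.1.aemeasurable)
  have hmW : ∀ i, Measurable fun ω => whiten P₀ X (Xs i ω) := fun i =>
    (whiten P₀ X).continuous.measurable.comp (h.measurable_Xs i)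
  obtain ⟨V, hV, hV1, hVl⟩ := (hasMoments_whiten h.memLp_X h.kurtosis_lt_top hκ).exists_evidence
    hκ1 hd hn hl hl1 hmW h.iIndepFun_whiten h.map_whiten
  have hVm : Measurable fun ω => V fun i => whiten P₀ X (Xs i ω) :=
    hV.comp (measurable_pi_lambda _ hmW)
  have hne : ∫⁻ ω, V (fun i => whiten P₀ X (Xs i ω)) ∂P ≠ ⊤ := (hV1.trans_lt ENNReal.one_lt_top).ne
  refine ⟨fun ω => (V fun i => whiten P₀ X (Xs i ω)).toReal, fun ω => ENNReal.toReal_nonneg,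
    hVm.ennreal_toReal, integrable_toReal_of_lintegral_ne_top hVm.aemeasurable hne, ?_, ?_⟩
  · rw [integral_toReal hVm.aemeasurable (ae_lt_top hVm hne)]
    exact ENNReal.toReal_le_of_le_ofReal zero_le_one (by simpa using hV1)
  · filter_upwards [ae_lt_top hVm hne] with ω hω θ hθ hθ2
    have h1 := ENNReal.toReal_mono hω.ne (hVl (fun i => whiten P₀ X (Xs i ω)) θ hθ hθ2)
    rw [ENNReal.toReal_ofReal (Real.exp_nonneg _)] at h1
    set G := (V fun i => whiten P₀ X (Xs i ω)).toReal
    have hG : 0 ≤ G := ENNReal.toReal_nonneg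
    have h2 := h1.trans (show G ≤ 1 + G by linarith)
    rw [← Real.le_log_iff_exp_le (by linarith)] at h2
    set t := (∑ i, inner ℝ θ (whiten P₀ X (Xs i ω)) ^ 2) / (n : ℝ)
    have h3 : 1 - t - lam * (κ - 1) / 2 - lam ^ 2 / 4 - 6.4 * √(κ * d / n)
        ≤ 0.73 * d / (n * lam) + Real.log (1 + G) / (n * lam) := by
      rw [← add_div, le_div_iff₀ (by positivity)]
      linarith
    linarith

/-- The loss in the Gram bound is a deterministic part D = O(ρ) plus the random part log (1 +
G)/(rρ), multiplied by the truncated score T ≤ m. Young's inequality bounds T log (1 + G) by 1 + G +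
T log m; T and G have mean at most 1, and log m/(rρ) ≤ ρ by the definition of ρ. -/
theorem mul_min_excessRisk_le (hκ : (kurtosis P₀ X).toReal ≤ κ) (hκ1 : 1 ≤ κ) (hd : 0 < d)
    (hn : 0 < n) {C M ρ : ℝ} (hC : 0 < C) (hCC : (rateConst P₀ X Y θs).toReal ≤ C) (hM : 0 < M)
    (hm : 1 < M * n / C) (hρ : 0 < ρ) (hρ1 : ρ ≤ 1 / 32)
    (hρ2 : n / κ * ρ ^ 2 = d + Real.log (M * n / C)) :
    n / C * ∫ ω, min (excessRisk P₀ X Y θs θh ω) M ∂P ≤ 1 + 76 * ρ := by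
  have hn' : (0 : ℝ) < n := by exact_mod_cast hn
  have hd' : (1 : ℝ) ≤ d := by exact_mod_cast hd
  have hκ0 : 0 < κ := by linarith
  set m := M * n / C with hmdef
  have hlm : 0 < Real.log m := Real.log_pos hm
  set r := (n : ℝ) / κ with hr
  have hr0 : 0 < r := by positivity
  have hrρ : 0 < r * ρ := by positivity
  -- With this temperature lam κ = ρ and n lam = rρ, so every deterministic loss is O(ρ).
  set lam := ρ / κ with hlam
  have hl0 : 0 < lam := by positivity
  have hlρ : lam ≤ ρ := div_le_self hρ.le hκ1
  have hnl : n * lam = r * ρ := by rw [hlam, hr]; ring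
  obtain ⟨G, hG0, hGm, hGi, hG1, hlow⟩ := h.exists_gramLowerBound_log hκ hκ1 hd hn hl0
    (by linarith)
  set D := lam * (κ - 1) / 2 + lam ^ 2 / 4 + 6.4 * √(κ * d / n) + 0.73 * d / (n * lam) with hD
  have hdr : (d : ℝ) / (r * ρ) ≤ ρ := by
    rw [div_le_iff₀ hrρ]
    nlinarith
  have hDρ : D ≤ 8 * ρ := by
    have e1 : lam * (κ - 1) / 2 ≤ ρ / 2 := by
      have : lam * κ = ρ := by rw [hlam]; field_simp
      linarith
    have e2 : lam ^ 2 / 4 ≤ ρ / 4 := by nlinarith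
    have e3 : √(κ * d / n) ≤ ρ := by
      rw [Real.sqrt_le_left hρ.le]
      have : κ * d / n = d / r := by rw [hr]; field_simp
      rw [this, div_le_iff₀ hr0]
      linarith
    have e4 : 0.73 * d / (n * lam) ≤ 0.73 * ρ := by
      rw [hnl, mul_div_assoc]
      gcongr
    linarith
  have hD0 : 0 ≤ D := by
    have : 0 ≤ κ - 1 := by linarith
    rw [hD]; positivity
  set S : Ω → ℝ := fun ω =>
    ‖∑ i, (Ys i ω - inner ℝ θs (Xs i ω)) • whiten P₀ X (Xs i ω)‖ ^ 2 / (n * C) with hS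
  have hS0 : ∀ ω, 0 ≤ S ω := fun ω => by positivity
  have hSi : Integrable S P := h.integrable_norm_sum_score_sq.div_const _
  have hS1 : ∫ ω, S ω ∂P ≤ 1 := by
    rw [hS, integral_div, h.integral_norm_sum_score_sq, div_le_one (by positivity)]
    gcongr
  set T : Ω → ℝ := fun ω => min (S ω) m with hT
  have hT0 : ∀ ω, 0 ≤ T ω := fun ω => le_min (hS0 ω) (by linarith)
  have hTi : Integrable T P := hSi.inf (integrable_const m)
  have hT1 : ∫ ω, T ω ∂P ≤ 1 :=
    (integral_mono hTi hSi fun ω => min_le_left _ _).trans hS1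
  have hpt : ∀ᵐ ω ∂P, n / C * min (excessRisk P₀ X Y θs θh ω) M
      ≤ (6 / (r * ρ) + m * Real.exp (-(r * ρ / 4)))
        + (1 + 6 * D + 6 * Real.log m / (r * ρ)) * T ω
        + (6 / (r * ρ) + m * Real.exp (-(r * ρ / 4))) * G ω := by
    filter_upwards [hlow, h.ae_excessRisk_le_of_gramLowerBound hn] with ω hω hE
    have hU0 : 0 ≤ Real.log (1 + G ω) := Real.log_nonneg (by linarith [hG0 ω])
    have hscale : n / C * min (excessRisk P₀ X Y θs θh ω) M
        = min (n / C * excessRisk P₀ X Y θs θh ω) m := by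
      rw [mul_min_of_nonneg _ _ (by positivity)]
      congr 1
      rw [hmdef]; ring
    have hyoung := mul_log_one_add_le (hT0 ω) (min_le_right _ _) (hG0 ω)
    have hyoung' : 6 * (T ω * Real.log (1 + G ω)) / (r * ρ)
        ≤ 6 / (r * ρ) + 6 / (r * ρ) * G ω + 6 * Real.log m / (r * ρ) * T ω := by
      calc _ ≤ 6 * (1 + G ω + T ω * Real.log m) / (r * ρ) := by gcongr
        _ = _ := by ring
    have hexp : 0 ≤ m * Real.exp (-(r * ρ / 4)) := by positivity
    have hexpG : 0 ≤ m * Real.exp (-(r * ρ / 4)) * G ω := mul_nonneg hexp (hG0 ω)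
    rw [hscale]
    rcases le_or_gt (Real.log (1 + G ω)) (r * ρ / 4) with hU | hU
    · set Λ := D + Real.log (1 + G ω) / (n * lam) with hΛ
      have hΛ0 : 0 ≤ Λ := by rw [hΛ, hnl]; positivity
      have hΛ1 : Λ ≤ 1 / 2 := by
        have : Real.log (1 + G ω) / (n * lam) ≤ 1 / 4 := by
          rw [hnl, div_le_iff₀ hrρ]; linarith
        linarith
      have h1 := hE (1 - Λ) (by linarith) hω
      have h1Λ : 0 < 1 - Λ := by linarith
      have h2 : n / C * excessRisk P₀ X Y θs θh ω ≤ S ω * (1 + 6 * Λ) := by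
        have h3 : n / C * excessRisk P₀ X Y θs θh ω ≤ S ω / (1 - Λ) ^ 2 := by
          calc _ ≤ n / C * (‖∑ i, (Ys i ω - inner ℝ θs (Xs i ω)) • whiten P₀ X (Xs i ω)‖ ^ 2
                / (n * (1 - Λ)) ^ 2) := by gcongr
            _ = _ := by rw [hS]; field_simp
        refine h3.trans ?_
        rw [div_le_iff₀ (by positivity), mul_assoc]
        exact le_mul_of_one_le_right (hS0 ω) (one_le_one_add_mul_one_sub_sq hΛ0 hΛ1)
      have h4 : min (n / C * excessRisk P₀ X Y θs θh ω) m ≤ T ω * (1 + 6 * Λ) := by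
        rw [hT, min_mul_of_nonneg _ _ (by linarith)]
        exact min_le_min h2 (le_mul_of_one_le_right (by linarith) (by linarith))
      have h5 : T ω * (1 + 6 * Λ)
          = T ω * (1 + 6 * D) + 6 * (T ω * Real.log (1 + G ω)) / (r * ρ) := by
        rw [hΛ, hnl]; ring
      linarith
    -- Where the Gram bound is useless, the truncation m is used. The condition log (1 + G) > rρ/4
    -- supplies an exponentially small weight multiplied by the integrable 1 + G.
    · have h1 : 1 ≤ Real.exp (-(r * ρ / 4)) * (1 + G ω) := by
        rw [Real.lt_log_iff_exp_lt (by linarith [hG0 ω])] at hU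
        calc (1 : ℝ) = Real.exp (-(r * ρ / 4)) * Real.exp (r * ρ / 4) := by
              rw [← Real.exp_add]; simp
          _ ≤ _ := by gcongr
      have h2 : min (n / C * excessRisk P₀ X Y θs θh ω) m
          ≤ m * (Real.exp (-(r * ρ / 4)) * (1 + G ω)) :=
        (min_le_right _ _).trans (le_mul_of_one_le_right (by linarith) h1)
      have h3 : 0 ≤ (1 + 6 * D + 6 * Real.log m / (r * ρ)) * T ω :=
        mul_nonneg (by positivity) (hT0 ω)
      have h4 : 0 ≤ 6 / (r * ρ) * G ω := mul_nonneg (by positivity) (hG0 ω)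
      have h5 : 0 ≤ 6 / (r * ρ) := by positivity
      linarith
  rw [← integral_const_mul]
  have hfi : Integrable (fun ω => (6 / (r * ρ) + m * Real.exp (-(r * ρ / 4)))
        + (1 + 6 * D + 6 * Real.log m / (r * ρ)) * T ω
        + (6 / (r * ρ) + m * Real.exp (-(r * ρ / 4))) * G ω) P :=
    ((integrable_const _).fun_add (hTi.const_mul _)).fun_add (hGi.const_mul _)
  refine (integral_mono_ae ((h.integrable_min_excessRisk hM.le).const_mul _) hfi hpt).trans ?_
  rw [integral_affine hTi hGi]
  have hexp := mul_exp_neg_le hm hd' hρ hρ1 hρ2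
  have hexp0 : 0 ≤ m * Real.exp (-(r * ρ / 4)) := by positivity
  have hlog : 2 / (r * ρ) + Real.log m / (r * ρ) ≤ 2 * ρ := by
    rw [← add_div, div_le_iff₀ hrρ]
    nlinarith
  have hT0' : 0 ≤ ∫ ω, T ω ∂P := integral_nonneg hT0
  have k1 : (1 + 6 * D + 6 * Real.log m / (r * ρ)) * ∫ ω, T ω ∂P
      ≤ 1 + 6 * D + 6 * Real.log m / (r * ρ) :=
    mul_le_of_le_one_right (by positivity) hT1
  have k2 : (6 / (r * ρ) + m * Real.exp (-(r * ρ / 4))) * ∫ ω, G ω ∂P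
      ≤ 6 / (r * ρ) + m * Real.exp (-(r * ρ / 4)) :=
    mul_le_of_le_one_right (by positivity) hG1
  have k3 : 6 * Real.log m / (r * ρ) = 6 * (Real.log m / (r * ρ)) := by ring
  have k4 : 6 / (r * ρ) = 3 * (2 / (r * ρ)) := by ring
  -- The constant is 76 = 48 + 16 + 12: from 6D ≤ 48ρ, twice the exponential term, and six times the
  -- estimate `hlog`.
  linarith

end IsRegression

end Regression

/-- When the sample is not large with respect to `d + log m`, the number `m` is bounded. -/
theorem le_of_mul_log_lt {r q D B c : ℝ} (hB : 1 ≤ B) (hc : 2 * B ≤ c) (hr : 0 < r) (hq : 0 < q)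
    (hD : 0 ≤ D) (h1 : c * (D + Real.log q) ≤ r) (h2 : r < B * (D + Real.log (q * r))) :
    q * r ≤ 4 * B * Real.log (4 * B) * Real.exp (4 * B * Real.log (4 * B)) := by
  set R := 4 * B * Real.log (4 * B) with hR
  have hlB : 0 < Real.log (4 * B) := Real.log_pos (by linarith)
  have hR0 : 0 < R := by positivity
  rw [Real.log_mul hq.ne' hr.ne'] at h2
  have hlr : Real.log r ≤ r / (4 * B) + Real.log (4 * B) := by
    have h1 := Real.log_le_sub_one_of_pos (show 0 < r / (4 * B) by positivity)
    rw [Real.log_div hr.ne' (by positivity)] at h1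
    linarith
  have hDq : 2 * B * (D + Real.log q) ≤ r := by
    rcases le_or_gt 0 (D + Real.log q) with h0 | h0
    · nlinarith
    · nlinarith
  have h3 : B * Real.log r ≤ r / 4 + R / 4 := by
    calc B * Real.log r ≤ B * (r / (4 * B) + Real.log (4 * B)) := by gcongr
      _ = r / 4 + R / 4 := by rw [hR]; field_simp
  -- The two halves of the upper bound on r are at most r/2 and r/4 + R/4.
  have hrR : r ≤ R := by linarith
  have hlq : Real.log q ≤ R := by nlinarith
  have hqe : q ≤ Real.exp R := (Real.log_le_iff_le_exp hq).1 hlq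
  calc q * r ≤ Real.exp R * R := by gcongr
    _ = _ := mul_comm _ _

/-- Three regimes for m = Mn/C. If m ≤ 1, bounding the minimum by M suffices. If ρ ≤ 1/32, the main
estimate applies. If ρ > 1/32, the sample size condition bounds m by the numerical constant R ≤
32Rρ. Only an upper bound C on the rate constant is assumed, so that σ²d may be substituted. -/
theorem exists_truncated_bound : ∃ c : ℝ, 0 < c ∧
    ∀ (d n : ℕ) {Ω₀ Ω : Type*} [MeasurableSpace Ω₀] [MeasurableSpace Ω]
      (P₀ : Measure Ω₀) [IsProbabilityMeasure P₀] (P : Measure Ω) [IsProbabilityMeasure P]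
      (X : Ω₀ → EuclideanSpace ℝ (Fin d)) (Y : Ω₀ → ℝ)
      (Xs : Fin n → Ω → EuclideanSpace ℝ (Fin d)) (Ys : Fin n → Ω → ℝ)
      (θs : EuclideanSpace ℝ (Fin d)) (θh : Ω → EuclideanSpace ℝ (Fin d)) (κ C M : ℝ),
      0 < n → 0 < d → IsRegression P₀ X Y P Xs Ys θs θh →
      (kurtosis P₀ X).toReal ≤ κ → 1 ≤ κ → (rateConst P₀ X Y θs).toReal ≤ C →
      0 < M → 0 < C → c * (κ * (d + Real.log (κ * M / C))) ≤ n →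
        n / C * ∫ ω, min (excessRisk P₀ X Y θs θh ω) M ∂P
          ≤ 1 + c * √(κ * (d + Real.log (M * n / C)) / n) := by
  set R := 4 * 1024 * Real.log (4 * 1024) * Real.exp (4 * 1024 * Real.log (4 * 1024)) with hR
  have hlB : 0 < Real.log (4 * 1024) := Real.log_pos (by norm_num)
  have hR0 : 0 < R := by positivity
  refine ⟨2048 + 32 * R, by positivity, ?_⟩
  intro d n Ω₀ Ω _ _ P₀ _ P _ X Y Xs Ys θs θh κ C M hn hd h hκ hκ1 hCC hM hC hle
  have hn' : (0 : ℝ) < n := by exact_mod_cast hn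
  have hd' : (1 : ℝ) ≤ d := by exact_mod_cast hd
  have hκ0 : 0 < κ := by linarith
  have htriv : n / C * ∫ ω, min (excessRisk P₀ X Y θs θh ω) M ∂P ≤ M * n / C := by
    have h1 : ∫ ω, min (excessRisk P₀ X Y θs θh ω) M ∂P ≤ ∫ _, M ∂P :=
      integral_mono (h.integrable_min_excessRisk hM.le) (integrable_const M)
        fun ω => min_le_right _ _
    simp only [integral_const, probReal_univ, smul_eq_mul, one_mul] at h1
    calc _ ≤ n / C * M := by gcongr
      _ = _ := by ring
  have hs0 : 0 ≤ √(κ * (d + Real.log (M * n / C)) / n) := Real.sqrt_nonneg _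
  rcases le_or_gt (M * n / C) 1 with hm | hm
  · have : 0 ≤ (2048 + 32 * R) * √(κ * (d + Real.log (M * n / C)) / n) := by positivity
    linarith
  have hlm : 0 < Real.log (M * n / C) := Real.log_pos hm
  set ρ := √(κ * (d + Real.log (M * n / C)) / n) with hρ
  have hρ0 : 0 < ρ := by positivity
  have hρ2 : n / κ * ρ ^ 2 = d + Real.log (M * n / C) := by
    rw [Real.sq_sqrt (by positivity)]; field_simp
  rcases le_or_gt ρ (1 / 32) with hρ1 | hρ1
  · refine (h.mul_min_excessRisk_le hκ hκ1 hd hn hC hCC hM hm hρ0 hρ1 hρ2).trans ?_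
    have : 0 < R * ρ := by positivity
    linarith
  · have hr0 : 0 < (n : ℝ) / κ := by positivity
    have e : M * n / C = κ * M / C * (n / κ) := by field_simp
    have h1 : (2048 + 32 * R) * (d + Real.log (κ * M / C)) ≤ n / κ := by
      rw [le_div_iff₀ hκ0]; linarith
    have h2 : n / κ < 1024 * (d + Real.log (κ * M / C * (n / κ))) := by
      rw [← e, ← hρ2]
      have : 1 < 1024 * ρ ^ 2 := by nlinarith
      nlinarith
    have h3 := le_of_mul_log_lt (by norm_num) (by linarith) hr0 (by positivity)
      (by positivity) h1 h2
    rw [← e, ← hR] at h3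
    have h4 : R ≤ 32 * R * ρ := by nlinarith
    linarith

section Noise

variable {d n : ℕ} {Ω₀ Ω : Type*} [MeasurableSpace Ω₀] [MeasurableSpace Ω]
  {P₀ : Measure Ω₀} [IsProbabilityMeasure P₀] {P : Measure Ω} [IsProbabilityMeasure P]
  {X : Ω₀ → EuclideanSpace ℝ (Fin d)} {Y : Ω₀ → ℝ}
  {Xs : Fin n → Ω → EuclideanSpace ℝ (Fin d)} {Ys : Fin n → Ω → ℝ}
  {θs : EuclideanSpace ℝ (Fin d)} {θh : Ω → EuclideanSpace ℝ (Fin d)} {σ : ℝ}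

/-- Independence factors the expectation, and the whitened design has mean squared norm at most d.
-/
theorem IsRegression.rateConst_le (h : IsRegression P₀ X Y P Xs Ys θs θh)
    (hσ : HasIndepNoise P₀ X Y θs σ) : (rateConst P₀ X Y θs).toReal ≤ σ ^ 2 * d := by
  rw [← h.integral_norm_score_sq]
  have hm : AEMeasurable (fun ω => whiten P₀ X (X ω)) P₀ :=
    (whiten P₀ X).continuous.measurable.comp_aemeasurable h.memLp_X.1.aemeasurable
  have hQ : IsProbabilityMeasure (P₀.map fun ω => whiten P₀ X (X ω)) :=
    Measure.isProbabilityMeasure_map hm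
  have h1 : ∫ ω, ‖whiten P₀ X (X ω)‖ ^ 2 ∂P₀ ≤ d := by
    have := (hasMoments_whiten h.memLp_X h.kurtosis_lt_top le_rfl).integral_norm_sq_le
    rwa [integral_map hm (by fun_prop)] at this
  have h2 : IndepFun (fun ω => (Y ω - inner ℝ θs (X ω)) ^ 2) (fun ω => ‖whiten P₀ X (X ω)‖ ^ 2)
      P₀ :=
    (hσ.indep.comp (φ := fun x => ‖whiten P₀ X x‖ ^ 2) (ψ := fun e : ℝ => e ^ 2)
      (by fun_prop) (by fun_prop)).symm
  have h3 := h2.integral_fun_mul_eq_mul_integral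
    ((memLp_residual h.memLp_X h.memLp_Y θs).1.pow 2) (hm.norm.pow_const 2).aestronglyMeasurable
  simp_rw [norm_smul, mul_pow, Real.norm_eq_abs, sq_abs]
  rw [h3, hσ.variance]
  gcongr

end Noise

end LeastSquares

end

/-! ### Degenerate designs and assembly of the statement. -/

noncomputable section

namespace LeastSquares

section Regression

variable {d n : ℕ} {Ω₀ Ω : Type*} [MeasurableSpace Ω₀] [MeasurableSpace Ω]
  {P₀ : Measure Ω₀} [IsProbabilityMeasure P₀] {P : Measure Ω} [IsProbabilityMeasure P]
  {X : Ω₀ → EuclideanSpace ℝ (Fin d)} {Y : Ω₀ → ℝ}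
  {Xs : Fin n → Ω → EuclideanSpace ℝ (Fin d)} {Ys : Fin n → Ω → ℝ}
  {θs : EuclideanSpace ℝ (Fin d)} {θh : Ω → EuclideanSpace ℝ (Fin d)}

/-- Either the excess risk vanishes, or the kurtosis coefficient is at least one. -/
theorem IsRegression.excessRisk_eq_zero_or (h : IsRegression P₀ X Y P Xs Ys θs θh) :
    excessRisk P₀ X Y θs θh = 0 ∨ (1 ≤ (kurtosis P₀ X).toReal ∧ 0 < d) := by
  by_cases h0 : ∀ u, ∫ ω, inner ℝ u (X ω) ^ 2 ∂P₀ = 0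
  · exact Or.inl (h.excessRisk_eq_zero h0)
  · push Not at h0
    obtain ⟨u, hu⟩ := h0
    have h1 := one_le_kurtosis h.memLp_X h.kurtosis_lt_top hu
    refine Or.inr ⟨h1, Nat.pos_of_ne_zero ?_⟩
    rintro rfl
    rw [kurtosis_eq_zero_of_dim] at h1
    norm_num at h1

/-- Weakens the constant in the sample size condition. The factor x may be negative, since log
(κM/C) may be, and then the smaller product is bounded by 0 ≤ y. -/
theorem mul_le_of_le_of_mul_le {a c x y : ℝ} (ha : 0 ≤ a) (hac : a ≤ c) (hy : 0 ≤ y)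
    (h : c * x ≤ y) : a * x ≤ y := by
  rcases le_or_gt 0 x with hx | hx <;> nlinarith

theorem IsRegression.numerical_bounds_of_excessRisk_eq_zero
    (h0 : excessRisk P₀ X Y θs θh = 0) {K L : ℝ} {ε : ℝ} (hK : 0 ≤ K) (hε : 0 < ε) :
    (∃ A : Set Ω, MeasurableSet A ∧ 1 - ε ≤ P.real A ∧
      Integrable (excessRisk P₀ X Y θs θh) (P[|A]) ∧
      ∫ ω, excessRisk P₀ X Y θs θh ω ∂(P[|A]) ≤ K) ∧
    1 - ε ≤ P.real {ω | condLExp (designSigma Xs) P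
        (fun ω' => ENNReal.ofReal (excessRisk P₀ X Y θs θh ω')) ω ≤ ENNReal.ofReal L} := by
  rw [h0]
  refine ⟨⟨Set.univ, MeasurableSet.univ, by simp [hε.le], integrable_zero _ _ _, by simpa⟩, ?_⟩
  have : condLExp (designSigma Xs) P (fun ω' => ENNReal.ofReal ((0 : Ω → ℝ) ω')) = 0 := by
    simp only [Pi.zero_apply, ENNReal.ofReal_zero]
    exact condLExp_zero P
  rw [this]
  simp [hε.le]

theorem IsRegression.integral_min_eq_zero (h0 : excessRisk P₀ X Y θs θh = 0) {M : ℝ}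
    (hM : 0 < M) : ∫ ω, min (excessRisk P₀ X Y θs θh ω) M ∂P = 0 := by
  rw [h0]
  simp [hM.le]

end Regression

end LeastSquares

end

theorem proposition4p10 :
    -- Orders of magnitude of the explicit quantities.
    (∀ κ₀ g : ℝ, 1 < κ₀ → g < 1 → ∃ c : ℝ, 0 < c ∧
      (∀ (d n : ℕ) (κ ε : ℝ), 1 ≤ d → κ₀ ≤ κ → 0 < ε → ε < 1 →
        LeastSquares.sampleThreshold κ d ε ≤ c * (κ * (d + Real.log ε⁻¹)) ∧
        (LeastSquares.sampleThreshold κ d ε < n → LeastSquares.gammaMinus κ d n ε ≤ g →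
          (1 + LeastSquares.deltaHat κ d n ε) ^ 2 / (1 - LeastSquares.gammaMinus κ d n ε) ^ 2
              ≤ 1 + c * √(κ * (d + Real.log ε⁻¹) / n) ∧
          (∀ p : ℝ, 1 - ε ≤ p →
            (1 + LeastSquares.deltaHat κ d n ε) ^ 2
                / ((1 - LeastSquares.gammaMinus κ d n ε) ^ 2 * p)
              ≤ (1 + c * √(κ * (d + Real.log ε⁻¹) / n)) * (1 - ε)⁻¹) ∧
          (1 + LeastSquares.deltaHat κ d n ε) / (1 - LeastSquares.gammaMinus κ d n ε)
              ≤ 1 + c * √(κ * (d + Real.log ε⁻¹) / n))) ∧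
      (∀ (d n : ℕ) (κ C M : ℝ), 1 ≤ d → κ₀ ≤ κ → 0 < C → C ≤ M →
        c * (κ * (d + Real.log (κ * M / C))) < n →
          C / (M * n ^ 2) < 1 ∧
          LeastSquares.sampleThreshold κ d (C / (M * n ^ 2)) < n)) ∧
    -- The explicit bounds.
    (∀ (d n : ℕ) {Ω₀ Ω : Type*} [MeasurableSpace Ω₀] [MeasurableSpace Ω]
      (P₀ : Measure Ω₀) [IsProbabilityMeasure P₀] (P : Measure Ω) [IsProbabilityMeasure P]
      (X : Ω₀ → EuclideanSpace ℝ (Fin d)) (Y : Ω₀ → ℝ)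
      (Xs : Fin n → Ω → EuclideanSpace ℝ (Fin d)) (Ys : Fin n → Ω → ℝ)
      (θs : EuclideanSpace ℝ (Fin d)) (θh : Ω → EuclideanSpace ℝ (Fin d)) (κ C : ℝ),
      LeastSquares.IsRegression P₀ X Y P Xs Ys θs θh →
      κ = (LeastSquares.kurtosis P₀ X).toReal →
      C = (LeastSquares.rateConst P₀ X Y θs).toReal →
      ∀ ε : ℝ, 0 < ε → ε < 1 → 1 < κ → LeastSquares.sampleThreshold κ d ε < n →
        (LeastSquares.gammaMinus κ d n ε ≠ 1 →
          (∃ A : Set Ω, MeasurableSet A ∧ 1 - ε ≤ P.real A ∧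
            Integrable (LeastSquares.excessRisk P₀ X Y θs θh) (P[|A]) ∧
            ∫ ω, LeastSquares.excessRisk P₀ X Y θs θh ω ∂(P[|A])
              ≤ (1 + LeastSquares.deltaHat κ d n ε) ^ 2
                  / ((1 - LeastSquares.gammaMinus κ d n ε) ^ 2 * P.real A) * (C / n)) ∧
          (∀ M : ℝ, 0 ≤ M →
            ∫ ω, min (LeastSquares.excessRisk P₀ X Y θs θh ω) M ∂P
              ≤ (1 + LeastSquares.deltaHat κ d n ε) ^ 2 * C
                  / ((1 - LeastSquares.gammaMinus κ d n ε) ^ 2 * n) + ε * M)) ∧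
        (∀ σ : ℝ, LeastSquares.HasIndepNoise P₀ X Y θs σ →
          LeastSquares.gammaMinus κ d n ε < 1 →
          1 - ε ≤ P.real {ω |
            condLExp (LeastSquares.designSigma Xs) P
                (fun ω' => ENNReal.ofReal (LeastSquares.excessRisk P₀ X Y θs θh ω')) ω
              ≤ ENNReal.ofReal ((1 + LeastSquares.deltaHat κ d n ε) * d * σ ^ 2
                  / ((1 - LeastSquares.gammaMinus κ d n ε) * n))})) ∧
    -- The bounds with a numerical constant.
    (∃ c : ℝ, 0 < c ∧
      ∀ (d n : ℕ) {Ω₀ Ω : Type*} [MeasurableSpace Ω₀] [MeasurableSpace Ω]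
      (P₀ : Measure Ω₀) [IsProbabilityMeasure P₀] (P : Measure Ω) [IsProbabilityMeasure P]
      (X : Ω₀ → EuclideanSpace ℝ (Fin d)) (Y : Ω₀ → ℝ)
      (Xs : Fin n → Ω → EuclideanSpace ℝ (Fin d)) (Ys : Fin n → Ω → ℝ)
      (θs : EuclideanSpace ℝ (Fin d)) (θh : Ω → EuclideanSpace ℝ (Fin d)) (κ C : ℝ),
      0 < n →
      LeastSquares.IsRegression P₀ X Y P Xs Ys θs θh →
      κ = (LeastSquares.kurtosis P₀ X).toReal →
      C = (LeastSquares.rateConst P₀ X Y θs).toReal →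
        (∀ ε : ℝ, 0 < ε → ε < 1 → c * (κ * (d + Real.log ε⁻¹)) ≤ n →
          ∃ A : Set Ω, MeasurableSet A ∧ 1 - ε ≤ P.real A ∧
            Integrable (LeastSquares.excessRisk P₀ X Y θs θh) (P[|A]) ∧
            ∫ ω, LeastSquares.excessRisk P₀ X Y θs θh ω ∂(P[|A])
              ≤ (1 + c * √(κ * (d + Real.log ε⁻¹) / n)) * (1 - ε)⁻¹ * (C / n)) ∧
        (∀ M : ℝ, 0 < M → 0 < C → c * (κ * (d + Real.log (κ * M / C))) ≤ n →
          n / C * ∫ ω, min (LeastSquares.excessRisk P₀ X Y θs θh ω) M ∂P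
            ≤ 1 + c * √(κ * (d + Real.log (M * n / C)) / n)) ∧
        (∀ σ : ℝ, LeastSquares.HasIndepNoise P₀ X Y θs σ →
          (∀ M : ℝ, 0 < M → c * (κ * (d + Real.log (κ * M / σ ^ 2))) ≤ n →
            ∫ ω, min (LeastSquares.excessRisk P₀ X Y θs θh ω) M ∂P
              ≤ (1 + c * √(κ * (d + Real.log (M * n / σ ^ 2)) / n)) * (σ ^ 2 * d / n)) ∧
          (∀ ε : ℝ, 0 < ε → ε < 1 → c * (κ * (d + Real.log ε⁻¹)) ≤ n →
            1 - ε ≤ P.real {ω |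
              condLExp (LeastSquares.designSigma Xs) P
                  (fun ω' => ENNReal.ofReal (LeastSquares.excessRisk P₀ X Y θs θh ω')) ω
                ≤ ENNReal.ofReal
                    ((1 + c * √(κ * (d + Real.log ε⁻¹) / n)) * (d * σ ^ 2 / n))}))) := by
  refine ⟨LeastSquares.orders_of_magnitude, ?_, ?_⟩
  · intro d n Ω₀ Ω _ _ P₀ _ P _ X Y Xs Ys θs θh κ C h hκ hC ε hε hε1 hκ1 hn
    -- In dimension zero the kurtosis coefficient is 0, which contradicts 1 < κ.
    have hd : 0 < d := by
      refine Nat.pos_of_ne_zero ?_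
      rintro rfl
      rw [hκ, LeastSquares.kurtosis_eq_zero_of_dim] at hκ1
      norm_num at hκ1
    rw [hC]
    exact h.explicit_bounds hκ.ge hκ1 hd hε hε1 hn
  · obtain ⟨c₁, hc₁, H₁⟩ := LeastSquares.exists_numerical_factor
    obtain ⟨c₂, hc₂, H₂⟩ := LeastSquares.exists_truncated_bound
    refine ⟨c₁ + c₂, by positivity, ?_⟩
    intro d n Ω₀ Ω _ _ P₀ _ P _ X Y Xs Ys θs θh κ C hn h hκ hC
    have hn' : (0 : ℝ) < n := by exact_mod_cast hn
    have hC0 : 0 ≤ C := hC ▸ ENNReal.toReal_nonneg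
    have hκ0 : 0 ≤ κ := hκ ▸ ENNReal.toReal_nonneg
    have hfac : ∀ t : ℝ, 0 ≤ 1 + (c₁ + c₂) * √t := fun t => by positivity
    have hf1 : ∀ t : ℝ, 1 + c₁ * √t ≤ 1 + (c₁ + c₂) * √t := fun t => by
      gcongr; linarith
    have hf2 : ∀ t : ℝ, 1 + c₂ * √t ≤ 1 + (c₁ + c₂) * √t := fun t => by
      gcongr; linarith
    -- With no lower bound on κ, a design that vanishes almost surely has to be set apart; there the
    -- excess risk is zero. Otherwise κ ≥ 1 and d ≥ 1.
    rcases h.excessRisk_eq_zero_or with h0 | ⟨hκ1, hd⟩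
    · refine ⟨fun ε hε hε1 _ => ?_, fun M hM _ _ => ?_, fun σ hσ => ⟨fun M hM _ => ?_,
        fun ε hε hε1 _ => ?_⟩⟩
      · have : 0 < 1 - ε := by linarith
        exact (LeastSquares.IsRegression.numerical_bounds_of_excessRisk_eq_zero (Xs := Xs) (L := 0) h0
          (mul_nonneg (mul_nonneg (hfac _) (by positivity)) (by positivity)) hε).1
      · rw [LeastSquares.IsRegression.integral_min_eq_zero h0 hM, mul_zero]
        exact hfac _
      · rw [LeastSquares.IsRegression.integral_min_eq_zero h0 hM]
        exact mul_nonneg (hfac _) (by positivity)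
      · exact (LeastSquares.IsRegression.numerical_bounds_of_excessRisk_eq_zero h0 le_rfl hε).2
    · rw [← hκ] at hκ1
      have hd' : (1 : ℝ) ≤ d := by exact_mod_cast hd
      refine ⟨fun ε hε hε1 hle => ?_, fun M hM hCpos hle => ?_, fun σ hσ => ⟨fun M hM hle => ?_,
        fun ε hε hε1 hle => ?_⟩⟩
      · obtain ⟨h1, h2, h3, -⟩ := H₁ d n κ ε hd hn hκ1 hε hε1
          (LeastSquares.mul_le_of_le_of_mul_le hc₁.le (by linarith) hn'.le hle)
        -- The explicit bounds accept any upper bound on the kurtosis, here 2κ.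
        obtain ⟨A, hA, hPA, hi, hb⟩ := ((h.explicit_bounds (by rw [← hκ]; linarith)
          (by linarith) hd hε hε1 h1).1 (by linarith)).1
        refine ⟨A, hA, hPA, hi, hb.trans ?_⟩
        rw [← hC]
        have : 0 < 1 - ε := by linarith
        gcongr
        exact (h3 _ hPA).trans (by gcongr; linarith)
      · exact (H₂ d n P₀ P X Y Xs Ys θs θh κ C M hn hd h hκ.ge hκ1 hC.ge hM hCpos
          (LeastSquares.mul_le_of_le_of_mul_le hc₂.le (by linarith) hn'.le hle)).trans (hf2 _)
      · have hσ2 : 0 < σ ^ 2 := pow_pos hσ.pos 2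
        have hσd : σ ^ 2 ≤ σ ^ 2 * d := by nlinarith
        have hle2 := LeastSquares.mul_le_of_le_of_mul_le hc₂.le (show c₂ ≤ c₁ + c₂ by linarith) hn'.le hle
        -- The truncated bound is used with σ²d in place of C. As σ² ≤ σ²d, the logarithms only grow
        -- when σ²d is replaced by σ² in them.
        have h1 := H₂ d n P₀ P X Y Xs Ys θs θh κ (σ ^ 2 * d) M hn hd h hκ.ge hκ1
          (h.rateConst_le hσ) hM (by positivity) (le_trans (by gcongr) hle2)
        have h2 : √(κ * (d + Real.log (M * n / (σ ^ 2 * d))) / n)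
            ≤ √(κ * (d + Real.log (M * n / σ ^ 2)) / n) := by gcongr
        have h3 : n / (σ ^ 2 * d) * ∫ ω, min (LeastSquares.excessRisk P₀ X Y θs θh ω) M ∂P
            ≤ 1 + (c₁ + c₂) * √(κ * (d + Real.log (M * n / σ ^ 2)) / n) :=
          h1.trans ((hf2 _).trans (by gcongr))
        calc ∫ ω, min (LeastSquares.excessRisk P₀ X Y θs θh ω) M ∂P
            = (n / (σ ^ 2 * d) * ∫ ω, min (LeastSquares.excessRisk P₀ X Y θs θh ω) M ∂P)
                * (σ ^ 2 * d / n) := by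
              rw [mul_right_comm, div_mul_div_cancel₀' (by positivity),
                div_self (by positivity), one_mul]
          _ ≤ _ := by gcongr
      · obtain ⟨h1, h2, -, h4⟩ := H₁ d n κ ε hd hn hκ1 hε hε1
          (LeastSquares.mul_le_of_le_of_mul_le hc₁.le (by linarith) hn'.le hle)
        have hb := (h.explicit_bounds (by rw [← hκ]; linarith)
          (by linarith) hd hε hε1 h1).2 σ hσ (by linarith)
        refine hb.trans ?_
        refine measureReal_mono (fun ω hω => le_trans hω (ENNReal.ofReal_le_ofReal ?_))
        calc _ = (1 + LeastSquares.deltaHat (2 * κ) d n ε) / (1 - LeastSquares.gammaMinus (2 * κ) d n ε)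
              * (d * σ ^ 2 / n) := by rw [div_mul_div_comm]; ring
          _ ≤ _ := by
            gcongr
            exact h4.trans (hf1 _)
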